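/- **Setting.** Let $\gamma\in\mathbb C$ with $\sinh\gamma\ne0$, $q^x=e^{-\gamma x}$, $T>0$, $h,h'\in\mathbb R$, $\alpha=\frac{h-h'}{2\gamma T}$, $\theta(\kappa)=e^{\kappa\sigma^z/2}$, and let $R(\lambda,\mu)\in\mathrm{End}(\mathbb C^2\otimes\mathbb C^2)$ be the XXZ $R$-matrix with entries $R^{++}_{++}=R^{--}_{--}=1$, $R^{+-}_{+-}=R^{-+}_{-+}=b(\lambda,\mu)=\frac{\sin(\mu-\lambda)}{\sin(\mu-\lambda+i\gamma)}$, $R^{+-}_{-+}=R^{-+}_{+-}=\frac{\sin(i\gamma)}{\sin(\mu-\lambda+i\gamma)}$ (all other entries zero). Let $P$ be the transposition of the two factors, $P_{0,m}$ the transposition of the factors $0,m$, and $\check R=PR$. Let $M$ be even, $\sigma\in\{\pm1\}^M$, $\nu\in\mathbb C^M$. Put $R^{(+1)}_{0,j}(\lambda,\nu)=R_{0,j}(\lambda,\nu)$, $R^{(-1)}_{0,j}(\lambda,\nu)=R_{j,0}^{t_1}(\nu,\lambda)$ ($t_1$: transposition in the first space on which $R$ acts), and $$T(\lambda|\sigma,\nu,h)=\theta_0(h/T)\,R^{(\sigma_M)}_{0,M}(\lambda,\nu_M)\cdots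 R^{(\sigma_1)}_{0,1}(\lambda,\nu_1),\quad t=\mathrm{tr}_0T,\quad \Sigma=\tfrac12\sum_{j=1}^M\sigma_j\sigma^z_j,$$ $$T_\perp(\lambda|\xi,h)=R_{0,m}(\lambda,\xi_m)\cdots R_{0,1}(\lambda,\xi_1)\,\theta_0(h/T).$$ A point $\lambda$ is *regular* if $\sin(\nu_j-\lambda+i\sigma_j\gamma)\ne0$ for all $j$, i.e. if no denominator in $T(\lambda|\sigma,\nu,h)$ vanishes. A *spin-zero eigenstate* at $(\sigma,\nu,h)$ consists of a non-zero vector $|\Psi\rangle$ and a non-zero linear form $\langle\Psi|$ with $\Sigma|\Psi\rangle=0$, $\langle\Psi|\Sigma=0$ that are right and left eigenvectors of $t(\lambda|\sigma,\nu,h)$ with a common eigenvalue $\Lambda(\lambda)$ for every regular $\lambda$. It is *simple* if $\langle\Psi|\Psi\rangle\ne0$ and $|\Psi\rangle$ is, up to a factor, the only spin-zero vector with this eigenvalue function. Let $\Psi_0$ be a spin-zero eigenstate at $(\sigma,\nu,h)$ with eigenvalue $\Lambda_0$ and $\Psi_n$ a spin-zero eigenstate at $(\sigma,\nu,h')$ with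 eigenvalue $\Lambda_n$, such that $\langle\Psi_0|\Psi_n\rangle\ne0\ne\langle\Psi_n|\Psi_0\rangle$. Put $\rho_n(\lambda)=\Lambda_n(\lambda)/\Lambda_0(\lambda)$ and, for $\xi\in\mathbb C^m$, $m\ge0$, $$F^{(-)}_{n;m}(\xi)=\frac{\langle\Psi_0|T(\xi_1|\sigma,\nu,h')\otimes\cdots\otimes T(\xi_m|\sigma,\nu,h')|\Psi_n\rangle}{\langle\Psi_0|\Psi_n\rangle\prod_j\Lambda_n(\xi_j)},\qquad F^{(+)}_{n;m}(\xi)=\frac{\langle\Psi_n|T(\xi_1|\sigma,\nu,h)\otimes\cdots\otimes T(\xi_m|\sigma,\nu,h)|\Psi_0\rangle}{\langle\Psi_n|\Psi_0\rangle\prod_j\Lambda_0(\xi_j)},$$ operators on $(\mathbb C^2)^{\otimes m}$ (so $F^{(\pm)}_{n;0}=1$; upper indices of matrix elements are row indices, lower ones column indices). Call $\xi$ *admissible* for $F^{(\pm)}$ if all $\xi_j$ are regular and the eigenvalues in the denominator of $F^{(\pm)}$ do not vanish at them. **Statement.** The following holds for both signs, at all $\xi$ that are admissible for the form factors of $\Psi_0,\Psi_n$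 that occur. 1. *Normalization:* $\mathrm{tr}\,F^{(\pm)}_{n;m}(\xi)=1$. 2. *Reduction* ($m\ge1$): $\mathrm{tr}_mF^{(\pm)}_{n;m}(\xi)=F^{(\pm)}_{n;m-1}(\xi_1,\dots,\xi_{m-1})$ and $\mathrm{tr}_1\{q^{\pm\alpha\sigma^z_1}F^{(\pm)}_{n;m}(\xi)\}=\rho_n^{\pm1}(\xi_1)F^{(\pm)}_{n;m-1}(\xi_2,\dots,\xi_m)$. 3. *Exchange:* $\check R_{j,j+1}(\xi_j,\xi_{j+1})F^{(\pm)}_{n;m}(\xi)=F^{(\pm)}_{n;m}(\dots,\xi_{j+1},\xi_j,\dots)\check R_{j,j+1}(\xi_j,\xi_{j+1})$ for $1\le j\le m-1$, if $\sin(\xi_{j+1}-\xi_j+i\gamma)\ne0$. 4. *$U(1)$ symmetry:* $[F^{(\pm)}_{n;m}(\xi),\theta(\kappa)^{\otimes m}]=0$ for all $\kappa\in\mathbb C$. 5. *Crossing:* Let $\Psi_0,\Psi_n$ be simple, $1\le j\le M$; let $\sigma\iota_j$ be $\sigma$ with $\sigma_j$ replaced by $-\sigma_j$ and $\nu S_j$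 be $\nu$ with $\nu_j$ replaced by $\nu_j+i\sigma_j\gamma$. There are simple spin-zero eigenstates $\Psi_0'$ at $(\sigma\iota_j,\nu S_j,h)$ and $\Psi_n'$ at $(\sigma\iota_j,\nu S_j,h')$ with non-zero overlaps and with the eigenvalues $\Lambda'(\lambda)=\frac{\sin(\nu_j-\lambda+i\sigma_j\gamma)}{\sin(\nu_j-\lambda)}\Lambda(\lambda)$, $\Lambda=\Lambda_0$ resp. $\Lambda_n$ (at all $\lambda$ regular for both parameter sets); and any spin-zero eigenstates with these eigenvalues have the same form factors $F^{(\pm)}_{n;m}(\xi)$ as $\Psi_0,\Psi_n$, for $\xi_1,\dots,\xi_m$ also regular for $(\sigma\iota_j,\nu S_j)$. 6. *Commutativity of rows:* Let $\Psi_0,\Psi_n$ be simple, $P\in\mathfrak S^M$, $(\sigma P)_k=\sigma_{Pk}$, $(\nu P)_k=\nu_{Pk}$. There are simple spin-zero eigenstates $\Psi_0'$ at $(\sigma P,\nu P,h)$ and $\Psi_n'$ at $(\sigma P,\nu P,h')$ with non-zero overlaps and with eigenvalues $\Lambda_0$ and $\Lambda_n$; and any spin-zero eigenstates with these eigenvalues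 have the same form factors $F^{(\pm)}_{n;m}(\xi)$ as $\Psi_0,\Psi_n$. 7. *Transposition:* If $\Psi_0,\Psi_n$ are simple, $$(F^{(-)}_{n;m})^{\alpha_1\dots\alpha_m}_{\beta_1\dots\beta_m}(\xi)=\Bigl[\prod_{j=1}^m\rho_n^{-1}(\xi_j)\Bigr]\bigl((q^{\alpha\sigma^z})^{\otimes m}F^{(+)}_{n;m}\bigr)^{\beta_m\dots\beta_1}_{\alpha_m\dots\alpha_1}(\xi_m,\dots,\xi_1).$$ 8. *Meromorphy:* the matrix elements of $F^{(\pm)}_{n;m}$ are meromorphic functions of $\xi\in\mathbb C^m$, and of each $\xi_j$ when the other variables are fixed. 9. *Asymptotics* ($m\ge1$, $(\xi_1,\dots,\xi_{m-1})$ admissible): for $\mathrm{Im}\,\xi_m\to+\infty$ and for $\mathrm{Im}\,\xi_m\to-\infty$, $$F^{(+)}_{n;m}(\xi)\to F^{(+)}_{n;m-1}(\xi_1,\dots,\xi_{m-1})\,\frac{\theta_m(h/T)}{\mathrm{tr}\,\theta(h/T)},\qquad F^{(-)}_{n;m}(\xi)\to F^{(-)}_{n;m-1}(\xi_1,\dots,\xi_{m-1})\,\frac{\theta_m(h'/T)}{\mathrm{tr}\,\theta(h'/T)}.$$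 10. *Discrete reduced $q$-Knizhnik–Zamolodchikov equation:* Let $m\ge1$, $M\ge1$, $\sigma_k=-1$ for all $k$, $\sin(\nu_1-\nu_k-i\gamma)\ne0$ for all $k$, $\xi_m=\nu_1$, and $\sin(\xi_j-\xi_m\pm i\gamma)\ne0$ for $j<m$. Then, with $(h_+,h_+')=(h,h')$ and $(h_-,h_-')=(h',h)$, $$F^{(\pm)}_{n;m}(\xi_1,\dots,\xi_{m-1},\xi_m-i\gamma)=\rho_n^{\mp1}(\xi_m)\,\mathrm{tr}_0\bigl\{T_\perp^{-1}(\xi_m|\xi,h_\pm)\,F^{(\pm)}_{n;m}(\xi)\,\sigma_0^yP_{0,m}^{t_0}\sigma_0^y\,T_\perp(\xi_m|\xi,h'_\pm)\bigr\},$$ where $t_0$ is the transposition in space $0$ and the left-hand side is the value of the meromorphic function, that is, the limit of $F^{(\pm)}_{n;m}(\xi_1,\dots,\xi_{m-1},z)$ for $z\to\xi_m-i\gamma$, $z\ne\xi_m-i\gamma$. -/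

import Mathlib

open Filter Topology
open scoped Matrix

noncomputable section

namespace XXZ

/-! ## Operators on tensor products of copies of `ℂ²`

The basis vector `e_+` has index `0`, the basis vector `e_-` has index `1`. A vector of
`(ℂ²)^{⊗ n}` is a function on the set `Spins n` of basis indices, an operator is a matrix
over that set. -/

/-- Basis indices of `(ℂ²)^{⊗ n}`. -/
abbrev Spins (n : ℕ) : Type := Fin n → Fin 2

/-- Operators on `(ℂ²)^{⊗ n}`. -/
abbrev Op (n : ℕ) : Type := Matrix (Spins n) (Spins n) ℂ

/-- Operators on `ℂ² ⊗ ℂ²`. -/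
abbrev Op2 : Type := Matrix (Fin 2 × Fin 2) (Fin 2 × Fin 2) ℂ

/-- The one-site operator `A` acting on the factor `i`. -/
def siteOp {n : ℕ} (i : Fin n) (A : Matrix (Fin 2) (Fin 2) ℂ) : Op n :=
  fun s t => if ∀ k, k ≠ i → s k = t k then A (s i) (t i) else 0

/-- The two-site operator `A_{i,j}`: the first space of `A` is the factor `i`, the second
space is the factor `j`. -/
def pairOp {n : ℕ} (i j : Fin n) (A : Op2) : Op n :=
  fun s t => if ∀ k, k ≠ i → k ≠ j → s k = t k then A (s i, s j) (t i, t j) else 0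

/-- `A^{⊗ n}`. -/
def tensorPow (n : ℕ) (A : Matrix (Fin 2) (Fin 2) ℂ) : Op n :=
  fun s t => ∏ j, A (s j) (t j)

/-- The partial trace over the first factor. -/
def traceFirst {n : ℕ} (A : Op (n + 1)) : Op n :=
  fun s t => ∑ c : Fin 2, A (Fin.cons c s : Spins (n + 1)) (Fin.cons c t : Spins (n + 1))

/-- The partial trace over the last factor. -/
def traceLast {n : ℕ} (A : Op (n + 1)) : Op n :=
  fun s t => ∑ c : Fin 2, A (Fin.snoc s c : Spins (n + 1)) (Fin.snoc t c : Spins (n + 1))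

/-- `A ⊗ B`, with `B` acting on an additional last factor. -/
def tensorLast {n : ℕ} (A : Op n) (B : Matrix (Fin 2) (Fin 2) ℂ) : Op (n + 1) :=
  fun s t => A (Fin.init s) (Fin.init t) * B (s (Fin.last n)) (t (Fin.last n))

/-- `1 ⊗ A`, with the identity on an additional first factor. -/
def idTensor {n : ℕ} (A : Op n) : Op (n + 1) :=
  fun s t => if s 0 = t 0 then A (Fin.tail s) (Fin.tail t) else 0

/-- The matrix element `X^a_b` with respect to the first factor: an operator on the
remaining factors (`a` is the row, `b` the column). -/
def block {n : ℕ} (X : Op (n + 1)) (a b : Fin 2) : Op n :=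
  fun s t => X (Fin.cons a s : Spins (n + 1)) (Fin.cons b t : Spins (n + 1))

/-- The Pauli matrix `σ^z`. -/
def sigmaZ : Matrix (Fin 2) (Fin 2) ℂ := !![1, 0; 0, -1]

/-- The Pauli matrix `σ^y`. -/
def sigmaY : Matrix (Fin 2) (Fin 2) ℂ := !![0, -Complex.I; Complex.I, 0]

/-- `θ(κ) = exp (κ σ^z / 2)`. -/
def theta (κ : ℂ) : Matrix (Fin 2) (Fin 2) ℂ :=
  !![Complex.exp (κ / 2), 0; 0, Complex.exp (-κ / 2)]

/-- The transposition matrix `P` on `ℂ² ⊗ ℂ²`. -/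
def permMat : Op2 := fun s t => if s = t.swap then 1 else 0

/-- Transposition with respect to the first space. -/
def transposeFirst (A : Op2) : Op2 := fun s t => A (t.1, s.2) (s.1, t.2)

/-! ## The XXZ `R`-matrix and the monodromy matrices -/

/-- The function `b(l, μ)`. -/
def bFun (γ l μ : ℂ) : ℂ := Complex.sin (μ - l) / Complex.sin (μ - l + Complex.I * γ)

/-- The function `c(l, μ)`. -/
def cFun (γ l μ : ℂ) : ℂ :=
  Complex.sin (Complex.I * γ) / Complex.sin (μ - l + Complex.I * γ)

/-- The six-vertex `R`-matrix `R(l, μ)`. -/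
def RMat (γ l μ : ℂ) : Op2 := fun s t =>
  if s = t then (if s.1 = s.2 then 1 else bFun γ l μ)
  else if s = t.swap then cFun γ l μ else 0

/-- `R^{(s)}_{0,j}(l, ν)` on the factors `0, 1, …, M`; the factor `0` is the auxiliary space
and the factor `j.succ` is the `j`-th quantum space. -/
def RStag (γ : ℂ) {M : ℕ} (s : ℤˣ) (j : Fin M) (l ν : ℂ) : Op (M + 1) :=
  if s = 1 then pairOp 0 j.succ (RMat γ l ν)
  else pairOp j.succ 0 (transposeFirst (RMat γ ν l))

/-- The `σ`-staggered inhomogeneous monodromy matrix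
`T(l) = θ_0(h/T) R^{(σ_M)}_{0,M}(l, ν_M) ⋯ R^{(σ_1)}_{0,1}(l, ν_1)`. -/
def monodromy (γ : ℂ) (T : ℝ) {M : ℕ} (σ : Fin M → ℤˣ) (ν : Fin M → ℂ) (h : ℝ) (l : ℂ) :
    Op (M + 1) :=
  siteOp 0 (theta ((h / T : ℝ) : ℂ)) *
    (List.ofFn fun j : Fin M => RStag γ (σ j) j l (ν j)).reverse.prod

/-- The quantum transfer matrix `t(l) = tr_0 T(l)`. -/
def transfer (γ : ℂ) (T : ℝ) {M : ℕ} (σ : Fin M → ℤˣ) (ν : Fin M → ℂ) (h : ℝ) (l : ℂ) :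
    Op M :=
  traceFirst (monodromy γ T σ ν h l)

/-- The points `l` at which no entry of `T(l)` has a vanishing denominator. -/
def RegularAt (γ : ℂ) {M : ℕ} (σ : Fin M → ℤˣ) (ν : Fin M → ℂ) (l : ℂ) : Prop :=
  ∀ j, Complex.sin (ν j - l + Complex.I * ((σ j : ℤ) : ℂ) * γ) ≠ 0

/-- The pseudo-spin operator `Σ = ½ ∑_j σ_j σ_j^z`. -/
def pseudoSpin {M : ℕ} (σ : Fin M → ℤˣ) : Op M :=
  ∑ j, (((σ j : ℤ) : ℂ) / 2) • siteOp j sigmaZ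

/-- The inhomogeneous twisted row-to-row monodromy matrix
`T_⊥(l|ξ, h) = R_{0,m}(l, ξ_m) ⋯ R_{0,1}(l, ξ_1) θ_0(h/T)`. -/
def monodromyPerp (γ : ℂ) (T : ℝ) {m : ℕ} (ξ : Fin m → ℂ) (h : ℝ) (l : ℂ) : Op (m + 1) :=
  (List.ofFn fun j : Fin m => (pairOp 0 j.succ (RMat γ l (ξ j)) : Op (m + 1))).reverse.prod *
    siteOp 0 (theta ((h / T : ℝ) : ℂ))

/-! ## Spin-zero eigenstates and thermal form factors -/

/-- A pseudo-spin-zero eigenstate `Ψ` of the commuting family of transfer matrices `t(l)`: a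
right eigenvector `|Ψ⟩`, a left eigenvector `⟨Ψ|` (a linear form, acting on vectors through
`⬝ᵥ` without complex conjugation) and their common eigenvalue `Λ(l)`. The value `Λ(l)` at a
pole of `t(l)` carries no information. -/
structure Eigenstate (γ : ℂ) (T : ℝ) {M : ℕ} (σ : Fin M → ℤˣ) (ν : Fin M → ℂ) (h : ℝ) where
  ket : Spins M → ℂ
  bra : Spins M → ℂ
  eigenvalue : ℂ → ℂ
  ket_ne_zero : ket ≠ 0
  bra_ne_zero : bra ≠ 0
  ket_eigen : ∀ l, RegularAt γ σ ν l → transfer γ T σ ν h l *ᵥ ket = eigenvalue l • ket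
  bra_eigen : ∀ l, RegularAt γ σ ν l → bra ᵥ* transfer γ T σ ν h l = eigenvalue l • bra
  ket_spin : pseudoSpin σ *ᵥ ket = 0
  bra_spin : bra ᵥ* pseudoSpin σ = 0

variable {γ : ℂ} {T : ℝ} {M : ℕ} {σ : Fin M → ℤˣ} {ν : Fin M → ℂ} {h h' : ℝ}

/-- The eigenvalue function of `Ψ` is a simple one in the pseudo-spin-zero sector: it
determines `|Ψ⟩` up to a factor, and `⟨Ψ|Ψ⟩ ≠ 0`. -/
def Eigenstate.IsSimple (S : Eigenstate γ T σ ν h) : Prop :=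
  S.bra ⬝ᵥ S.ket ≠ 0 ∧
    ∀ v : Spins M → ℂ, pseudoSpin σ *ᵥ v = 0 →
      (∀ l, RegularAt γ σ ν l → transfer γ T σ ν h l *ᵥ v = S.eigenvalue l • v) →
      ∃ c : ℂ, v = c • S.ket

/-- Both overlaps `⟨Ψ_0(h)|Ψ_n(h')⟩` and `⟨Ψ_n(h')|Ψ_0(h)⟩` are different from zero. -/
def Overlap (S0 : Eigenstate γ T σ ν h) (Sn : Eigenstate γ T σ ν h') : Prop :=
  S0.bra ⬝ᵥ Sn.ket ≠ 0 ∧ Sn.bra ⬝ᵥ S0.ket ≠ 0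

/-- The matrix with the entries
`⟨bra|T^{a_1}_{b_1}(ξ_1) ⋯ T^{a_m}_{b_m}(ξ_m)|ket⟩ / (⟨bra|ket⟩ ∏_j Λ(ξ_j))`. -/
def ffMatrix (γ : ℂ) (T : ℝ) {M : ℕ} (σ : Fin M → ℤˣ) (ν : Fin M → ℂ) (h : ℝ)
    (bra ket : Spins M → ℂ) (Λ : ℂ → ℂ) {m : ℕ} (ξ : Fin m → ℂ) : Op m :=
  fun a b =>
    (bra ⬝ᵥ ((List.ofFn fun j => block (monodromy γ T σ ν h (ξ j)) (a j) (b j)).prod *ᵥ ket)) /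
      ((bra ⬝ᵥ ket) * ∏ j, Λ (ξ j))

/-- The generalized thermal form factors; the sign `ε = 1` stands for `F^{(+)}_{n;m}` and
`ε = -1` for `F^{(-)}_{n;m}`. -/
def thermalFF (ε : ℤˣ) (S0 : Eigenstate γ T σ ν h) (Sn : Eigenstate γ T σ ν h') {m : ℕ}
    (ξ : Fin m → ℂ) : Op m :=
  if ε = 1 then ffMatrix γ T σ ν h Sn.bra S0.ket S0.eigenvalue ξ
  else ffMatrix γ T σ ν h' S0.bra Sn.ket Sn.eigenvalue ξ

/-- `ρ_n(l) = Λ_n(l|h') / Λ_0(l|h)`. -/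
def rho (S0 : Eigenstate γ T σ ν h) (Sn : Eigenstate γ T σ ν h') (l : ℂ) : ℂ :=
  Sn.eigenvalue l / S0.eigenvalue l

/-- The points `ξ` at which no denominator in the definition of `F^{(ε)}_{n;m}(ξ)` vanishes. -/
def Admissible (ε : ℤˣ) (S0 : Eigenstate γ T σ ν h) (Sn : Eigenstate γ T σ ν h') {m : ℕ}
    (ξ : Fin m → ℂ) : Prop :=
  ∀ j, RegularAt γ σ ν (ξ j) ∧
    (if ε = 1 then S0.eigenvalue (ξ j) else Sn.eigenvalue (ξ j)) ≠ 0

/-- `α = (h - h') / (2 γ T)`. -/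
def alpha (γ : ℂ) (T h h' : ℝ) : ℂ := ((h - h' : ℝ) : ℂ) / (2 * γ * (T : ℂ))

/-- `q^x` for `q = e^{-γ}`. -/
def qPow (γ x : ℂ) : ℂ := Complex.exp (-γ * x)

/-- `q^{x σ^z}` for `q = e^{-γ}`. -/
def qSigmaZ (γ x : ℂ) : Matrix (Fin 2) (Fin 2) ℂ := !![qPow γ x, 0; 0, qPow γ (-x)]

/-! ## Changing the staggering and the inhomogeneities -/

/-- The staggering `σ ι_j`. -/
def flipStag (σ : Fin M → ℤˣ) (j : Fin M) : Fin M → ℤˣ :=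
  Function.update σ j (-σ j)

/-- The inhomogeneities `ν S_j`. -/
def shiftInhom (γ : ℂ) (σ : Fin M → ℤˣ) (ν : Fin M → ℂ) (j : Fin M) : Fin M → ℂ :=
  Function.update ν j (ν j + Complex.I * ((σ j : ℤ) : ℂ) * γ)

/-- `S'` is the state at `(σ ι_j, ν S_j)` that carries the same label as `S`: the crossing of
row `j` multiplies the transfer matrix, up to a similarity transformation, by
`sin (ν_j - l + i σ_j γ) / sin (ν_j - l)`, and the eigenvalue of `S'` is the eigenvalue of `S`
multiplied by that factor. -/
def CrossedLabel (j : Fin M) (S : Eigenstate γ T σ ν h)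
    (S' : Eigenstate γ T (flipStag σ j) (shiftInhom γ σ ν j) h) : Prop :=
  ∀ l, RegularAt γ σ ν l → RegularAt γ (flipStag σ j) (shiftInhom γ σ ν j) l →
    S'.eigenvalue l = Complex.sin (ν j - l + Complex.I * ((σ j : ℤ) : ℂ) * γ) /
      Complex.sin (ν j - l) * S.eigenvalue l

/-- `S'` is the state at `(σ P, ν P)` that carries the same label as `S`: it has the same
eigenvalue. -/
def PermutedLabel (P : Equiv.Perm (Fin M)) (S : Eigenstate γ T σ ν h)
    (S' : Eigenstate γ T (σ ∘ P) (ν ∘ P) h) : Prop :=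
  ∀ l, RegularAt γ σ ν l → S'.eigenvalue l = S.eigenvalue l

/-! ## Meromorphic functions of several variables -/

/-- A function on `ℂ^m`, given up to its values on the polar set, is meromorphic if it is
locally a quotient of two holomorphic functions with a denominator whose germ is not zero. -/
def IsMeromorphic {m : ℕ} (f : (Fin m → ℂ) → ℂ) : Prop :=
  ∀ x₀ : Fin m → ℂ, ∃ G D : (Fin m → ℂ) → ℂ,
    AnalyticAt ℂ G x₀ ∧ AnalyticAt ℂ D x₀ ∧ (∃ᶠ x in 𝓝 x₀, D x ≠ 0) ∧
      ∀ᶠ x in 𝓝 x₀, D x ≠ 0 → f x = G x / D x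

end XXZ

end

noncomputable section

namespace XXZ

/-! ## Embedding one- and two-site operators with entries in a ring -/

section Embedding

variable {A : Type*} [Ring A] {n : ℕ}

/-! The six-vertex `R`-matrix has crossing symmetry: partial transposition amounts to conjugation by
`σ^y` and a shift of the spectral parameter. Hence, at regular points, the staggered monodromy
matrix is the ordinary monodromy matrix `twMono` with entire entries and inhomogeneities `entInhom`,
up to the scalar `denom` and conjugation by the involution `gaugeOp` (`blockMat_RStag`,
`block_monodromy`). The pseudo-spin becomes half the total spin. Scalars and gauge cancel in the
form factors (`ffMatrix_eq`), so everything reduces to the form factors `entFF` of an unstaggered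
model.

Several properties are then direct. The trace of a monodromy matrix standing next to the ket or the
bra is a transfer matrix acting on its eigenvector, which gives normalization and reduction.
Exchange is the `RTT` relation under a matrix element, and the `U(1)` symmetry is the ice rule. For
large imaginary spectral parameter the rescaled Lax matrices become diagonal, and on spin-zero
vectors their product is a scalar, which leaves only the twist.

Crossing does not change `entInhom`, a permutation of rows permutes it, and transposition combined
with reversal of the sites reverses it. All three properties therefore follow from the invariance of
form factors under permutations of the inhomogeneities. The natural intertwiner, built from
`R`-matrices, is singular at special inhomogeneities. What survives there is the equality of the
traces of all words in the monodromy matrix elements (`trace_lift_perm`), obtained by conjugation at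
generic points and by continuity at the others. The projector onto a simple eigenstate is itself a
word in the commuting family (`exists_lift_eq_projector`), so form factors are ratios of traces of
words. The word can be corrected so that it stays idempotent after the permutation
(`exists_idempotent_lift`); having trace one, it is then the projector onto the corresponding state.

For the `q`-Knizhnik–Zamolodchikov equation let `μ` be the first entire inhomogeneity and `η = iγ`.
Since `L(0)` is proportional to the permutation `P`, the monodromy matrix at `μ` is a local operator
times the transfer matrix (`twMono_special`). Since `L(-η)` is proportional to `P - 1`, the
monodromy matrix at `μ + η` converts `1 - P` on two auxiliary spaces into the same local operator
(`fstMat_twMono_crossed`). So the last monodromy matrix can be moved to an extra auxiliary space,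
carried through the others by `RTT` (`perpMono_intertwine`), and traced against the bra. The
eigenvalues at these points do not vanish because the monodromy matrix, or its transpose in the
auxiliary space, is invertible there. -/

theorem sum_agree_off_site (i : Fin n) (s : Spins n) (f : Spins n → A) :
    (∑ k : Spins n, if ∀ j, j ≠ i → s j = k j then f k else 0) =
      ∑ c : Fin 2, f (Function.update s i c) := by
  rw [← Finset.sum_filter]
  symm
  refine Finset.sum_nbij (fun c => Function.update s i c) ?_ ?_ ?_ ?_
  · intro c _
    simp only [Finset.mem_filter, Finset.mem_univ, true_and]
    intro j hj
    rw [Function.update_of_ne hj]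
  · intro c _ d _ hcd
    simpa using congrFun hcd i
  · intro k hk
    simp only [Finset.coe_filter, Finset.mem_univ, true_and, Set.mem_ofPred_eq] at hk
    refine ⟨k i, by simp, ?_⟩
    funext j
    by_cases hj : j = i
    · subst hj; simp
    · simp [Function.update_of_ne hj, hk j hj]
  · intros; rfl

theorem sum_agree_off_pair {i j : Fin n} (hij : i ≠ j) (s : Spins n) (f : Spins n → A) :
    (∑ k : Spins n, if ∀ l, l ≠ i → l ≠ j → s l = k l then f k else 0) =
      ∑ c : Fin 2 × Fin 2, f (Function.update (Function.update s i c.1) j c.2) := by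
  rw [← Finset.sum_filter]
  symm
  refine Finset.sum_nbij (fun c => Function.update (Function.update s i c.1) j c.2) ?_ ?_ ?_ ?_
  · intro c _
    simp only [Finset.mem_filter, Finset.mem_univ, true_and]
    intro l hl hl'
    rw [Function.update_of_ne hl', Function.update_of_ne hl]
  · intro c _ d _ hcd
    have h1 := congrFun hcd i
    have h2 := congrFun hcd j
    simp only [Function.update_of_ne hij, Function.update_self] at h1 h2
    exact Prod.ext h1 h2
  · intro k hk
    simp only [Finset.coe_filter, Finset.mem_univ, true_and, Set.mem_ofPred_eq] at hk
    refine ⟨(k i, k j), by simp, ?_⟩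
    funext l
    by_cases hj : l = j
    · subst hj; simp
    · by_cases hi : l = i
      · subst hi; simp [Function.update_of_ne hj]
      · simp [Function.update_of_ne hj, Function.update_of_ne hi, hk l hi hj]
  · intros; rfl

/-- The one-site operator `X` on the factor `i`, with entries in `A`. -/
def siteMat (i : Fin n) (X : Matrix (Fin 2) (Fin 2) A) : Matrix (Spins n) (Spins n) A :=
  fun s t => if ∀ k, k ≠ i → s k = t k then X (s i) (t i) else 0

/-- The two-site operator `X_{i,j}`, with entries in `A`. -/
def pairMat (i j : Fin n) (X : Matrix (Fin 2 × Fin 2) (Fin 2 × Fin 2) A) :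
    Matrix (Spins n) (Spins n) A :=
  fun s t => if ∀ k, k ≠ i → k ≠ j → s k = t k then X (s i, s j) (t i, t j) else 0

theorem siteOp_eq (i : Fin n) (X : Matrix (Fin 2) (Fin 2) ℂ) : siteOp i X = siteMat i X := rfl

theorem pairOp_eq (i j : Fin n) (X : Op2) : pairOp i j X = pairMat i j X := rfl

theorem siteMat_mul (i : Fin n) (X Y : Matrix (Fin 2) (Fin 2) A) :
    siteMat i (X * Y) = siteMat i X * siteMat i Y := by
  ext s t
  rw [Matrix.mul_apply]
  have : ∀ k, siteMat i X s k * siteMat i Y k t =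
      if ∀ j, j ≠ i → s j = k j then X (s i) (k i) * siteMat i Y k t else 0 := by
    intro k; simp only [siteMat, ite_mul, zero_mul]
  simp only [this]
  rw [sum_agree_off_site i s (fun k => X (s i) (k i) * siteMat i Y k t)]
  have h2 : ∀ c, (∀ k, k ≠ i → Function.update s i c k = t k) ↔ ∀ k, k ≠ i → s k = t k := by
    intro c
    refine forall_congr' fun k => imp_congr_right fun hk => ?_
    rw [Function.update_of_ne hk]
  simp only [siteMat, h2, Function.update_self, mul_ite, mul_zero, Matrix.mul_apply]
  split_ifs <;> simp

theorem siteMat_one (i : Fin n) : siteMat i (1 : Matrix (Fin 2) (Fin 2) A) = 1 := by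
  ext s t
  simp only [siteMat, Matrix.one_apply]
  by_cases h : s = t
  · subst h; simp
  · rw [if_neg h]
    split_ifs with h1 h2
    · exact absurd (funext fun k => if hk : k = i then hk ▸ h2 else h1 k hk) h
    · rfl
    · rfl

theorem siteMat_add (i : Fin n) (X Y : Matrix (Fin 2) (Fin 2) A) :
    siteMat i (X + Y) = siteMat i X + siteMat i Y := by
  ext s t
  simp only [siteMat, Matrix.add_apply]
  split_ifs <;> simp

/-- `siteMat` as a ring homomorphism. -/
def siteHom (i : Fin n) : Matrix (Fin 2) (Fin 2) A →+* Matrix (Spins n) (Spins n) A where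
  toFun := siteMat i
  map_one' := siteMat_one i
  map_mul' := siteMat_mul i
  map_zero' := by ext s t; simp [siteMat]
  map_add' := siteMat_add i

@[simp] theorem siteHom_apply (i : Fin n) (X : Matrix (Fin 2) (Fin 2) A) :
    siteHom i X = siteMat i X := rfl

theorem pairMat_mul {i j : Fin n} (hij : i ≠ j)
    (X Y : Matrix (Fin 2 × Fin 2) (Fin 2 × Fin 2) A) :
    pairMat i j (X * Y) = pairMat i j X * pairMat i j Y := by
  ext s t
  rw [Matrix.mul_apply]
  have : ∀ k, pairMat i j X s k * pairMat i j Y k t =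
      if ∀ l, l ≠ i → l ≠ j → s l = k l then X (s i, s j) (k i, k j) * pairMat i j Y k t
      else 0 := by
    intro k; simp only [pairMat, ite_mul, zero_mul]
  simp only [this]
  rw [sum_agree_off_pair hij s (fun k => X (s i, s j) (k i, k j) * pairMat i j Y k t)]
  have h2 : ∀ c d, (∀ k, k ≠ i → k ≠ j →
      Function.update (Function.update s i c) j d k = t k) ↔
        ∀ k, k ≠ i → k ≠ j → s k = t k := by
    intro c d
    refine forall_congr' fun k => imp_congr_right fun hk => imp_congr_right fun hk' => ?_
    rw [Function.update_of_ne hk', Function.update_of_ne hk]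
  simp only [pairMat, h2, Function.update_self, Function.update_of_ne hij, mul_ite, mul_zero,
    Matrix.mul_apply]
  split_ifs <;> simp

theorem pairMat_one {i j : Fin n} (hij : i ≠ j) :
    pairMat i j (1 : Matrix (Fin 2 × Fin 2) (Fin 2 × Fin 2) A) = 1 := by
  ext s t
  simp only [pairMat, Matrix.one_apply]
  by_cases h : s = t
  · subst h; simp
  · rw [if_neg h]
    split_ifs with h1 h2
    · refine absurd (funext fun k => ?_) h
      by_cases hi : k = i
      · subst hi; exact congrArg Prod.fst h2
      by_cases hj : k = j
      · subst hj; exact congrArg Prod.snd h2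
      exact h1 k hi hj
    · rfl
    · rfl

/-- `pairMat` as a ring homomorphism. -/
def pairHom {i j : Fin n} (hij : i ≠ j) :
    Matrix (Fin 2 × Fin 2) (Fin 2 × Fin 2) A →+* Matrix (Spins n) (Spins n) A where
  toFun := pairMat i j
  map_one' := pairMat_one hij
  map_mul' := pairMat_mul hij
  map_zero' := by ext s t; simp [pairMat]
  map_add' X Y := by
    ext s t
    simp only [pairMat, Matrix.add_apply]
    split_ifs <;> simp

@[simp] theorem pairHom_apply {i j : Fin n} (hij : i ≠ j)
    (X : Matrix (Fin 2 × Fin 2) (Fin 2 × Fin 2) A) : pairHom hij X = pairMat i j X := rfl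

/-- `X ⊗ 1` on two factors. -/
def fstMat (X : Matrix (Fin 2) (Fin 2) A) : Matrix (Fin 2 × Fin 2) (Fin 2 × Fin 2) A :=
  fun s t => if s.2 = t.2 then X s.1 t.1 else 0

/-- `1 ⊗ X` on two factors. -/
def sndMat (X : Matrix (Fin 2) (Fin 2) A) : Matrix (Fin 2 × Fin 2) (Fin 2 × Fin 2) A :=
  fun s t => if s.1 = t.1 then X s.2 t.2 else 0

theorem pairMat_fstMat {i j : Fin n} (hij : i ≠ j) (X : Matrix (Fin 2) (Fin 2) A) :
    pairMat i j (fstMat X) = siteMat i X := by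
  ext s t
  simp only [pairMat, fstMat, siteMat]
  rw [← ite_and]
  congr 1
  simp only [eq_iff_iff]
  constructor
  · rintro ⟨h1, h2⟩ k hk
    by_cases hj : k = j
    · rw [hj, h2]
    · exact h1 k hk hj
  · intro h
    exact ⟨fun k hk _ => h k hk, h j hij.symm⟩

theorem pairMat_sndMat {i j : Fin n} (hij : i ≠ j) (X : Matrix (Fin 2) (Fin 2) A) :
    pairMat i j (sndMat X) = siteMat j X := by
  ext s t
  simp only [pairMat, sndMat, siteMat]
  rw [← ite_and]
  congr 1
  simp only [eq_iff_iff]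
  constructor
  · rintro ⟨h1, h2⟩ k hk
    by_cases hj : k = i
    · rw [hj, h2]
    · exact h1 k hj hk
  · intro h
    exact ⟨fun k _ hk => h k hk, h i hij⟩

theorem fstMat_mul (X Y : Matrix (Fin 2) (Fin 2) A) :
    fstMat (X * Y) = fstMat X * fstMat Y := by
  ext ⟨a, b⟩ ⟨c, d⟩
  simp only [fstMat, Matrix.mul_apply, Fintype.sum_prod_type, Fin.sum_univ_two]
  fin_cases b <;> fin_cases d <;> simp

theorem sndMat_mul (X Y : Matrix (Fin 2) (Fin 2) A) :
    sndMat (X * Y) = sndMat X * sndMat Y := by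
  ext ⟨a, b⟩ ⟨c, d⟩
  simp only [sndMat, Matrix.mul_apply, Fintype.sum_prod_type, Fin.sum_univ_two]
  fin_cases a <;> fin_cases c <;> simp

/-- The entries need not commute, so the order in which the two spaces are multiplied fixes the
order of the entries. This and the next lemma differ in nothing else, and that difference is the
content of an `RTT` relation. -/
theorem fstMat_mul_sndMat_apply (X Y : Matrix (Fin 2) (Fin 2) A) (s t : Fin 2 × Fin 2) :
    (fstMat X * sndMat Y) s t = X s.1 t.1 * Y s.2 t.2 := by
  obtain ⟨a, b⟩ := s
  obtain ⟨c, d⟩ := t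
  simp only [fstMat, sndMat, Matrix.mul_apply, Fintype.sum_prod_type, Fin.sum_univ_two]
  fin_cases b <;> fin_cases c <;> simp

theorem sndMat_mul_fstMat_apply (X Y : Matrix (Fin 2) (Fin 2) A) (s t : Fin 2 × Fin 2) :
    (sndMat Y * fstMat X) s t = Y s.2 t.2 * X s.1 t.1 := by
  obtain ⟨a, b⟩ := s
  obtain ⟨c, d⟩ := t
  simp only [fstMat, sndMat, Matrix.mul_apply, Fintype.sum_prod_type, Fin.sum_univ_two]
  fin_cases a <;> fin_cases d <;> simp

theorem fstMat_commute_sndMat {X Y : Matrix (Fin 2) (Fin 2) A}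
    (h : ∀ a b c d, Commute (X a b) (Y c d)) : Commute (fstMat X) (sndMat Y) := by
  ext s t
  rw [fstMat_mul_sndMat_apply, sndMat_mul_fstMat_apply, h]

theorem siteMat_commute {i j : Fin n} (hij : i ≠ j) {X Y : Matrix (Fin 2) (Fin 2) A}
    (h : ∀ a b c d, Commute (X a b) (Y c d)) : Commute (siteMat i X) (siteMat j Y) := by
  rw [← pairMat_fstMat hij, ← pairMat_sndMat hij]
  exact (fstMat_commute_sndMat h).map (pairHom hij)

theorem pairMat_commute_siteMat {i j k : Fin n} (hij : i ≠ j) (hki : k ≠ i) (hkj : k ≠ j)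
    {Z : Matrix (Fin 2 × Fin 2) (Fin 2 × Fin 2) A} {Y : Matrix (Fin 2) (Fin 2) A}
    (h : ∀ a b c d, Commute (Z a b) (Y c d)) : Commute (pairMat i j Z) (siteMat k Y) := by
  ext s t
  rw [Matrix.mul_apply, Matrix.mul_apply]
  have e1 : ∀ l, pairMat i j Z s l * siteMat k Y l t =
      if ∀ m, m ≠ i → m ≠ j → s m = l m then Z (s i, s j) (l i, l j) * siteMat k Y l t
      else 0 := by
    intro l; simp only [pairMat, ite_mul, zero_mul]
  have e2 : ∀ l, siteMat k Y s l * pairMat i j Z l t =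
      if ∀ m, m ≠ k → s m = l m then Y (s k) (l k) * pairMat i j Z l t else 0 := by
    intro l; simp only [siteMat, ite_mul, zero_mul]
  simp only [e1, e2]
  rw [sum_agree_off_pair hij s (fun l => Z (s i, s j) (l i, l j) * siteMat k Y l t),
    sum_agree_off_site k s (fun l => Y (s k) (l k) * pairMat i j Z l t)]
  -- Only the intermediate configuration that already agrees with `t` at the sites acted on first
  -- contributes, so each side is a single term.
  rw [Finset.sum_eq_single (t i, t j), Finset.sum_eq_single (t k)]
  · simp only [siteMat, pairMat, Function.update_self, Function.update_of_ne hij,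
      Function.update_of_ne hki, Function.update_of_ne hkj, Function.update_of_ne hki.symm,
      Function.update_of_ne hkj.symm]
    have c1 : (∀ m, m ≠ k → Function.update (Function.update s i (t i)) j (t j) m = t m) ↔
        ∀ m, m ≠ k → m ≠ i → m ≠ j → s m = t m := by
      refine forall_congr' fun m => imp_congr_right fun hm => ?_
      by_cases hj : m = j
      · subst hj; simp
      · by_cases hi : m = i
        · subst hi; simp [Function.update_of_ne hj]
        · simp [hi, hj]
    have c2 : (∀ m, m ≠ i → m ≠ j → Function.update s k (t k) m = t m) ↔
        ∀ m, m ≠ k → m ≠ i → m ≠ j → s m = t m := by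
      refine forall_congr' fun m => ?_
      by_cases hk : m = k
      · subst hk; simp
      · simp [hk]
    simp only [c1, c2]
    split_ifs
    · exact h _ _ _ _
    · simp
  · intro c _ hc
    simp only [pairMat, Function.update_of_ne hki.symm, Function.update_of_ne hkj.symm]
    rw [if_neg, mul_zero]
    intro hcon
    exact hc (by simpa using hcon k hki hkj)
  · simp
  · rintro ⟨c, d⟩ _ hc
    simp only [siteMat]
    rw [if_neg, mul_zero]
    intro hcon
    apply hc
    have h1 := hcon i hki.symm
    have h2 := hcon j hkj.symm
    simp only [Function.update_of_ne hij, Function.update_self] at h1 h2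
    rw [h1, h2]
  · simp

end Embedding

/-! ## Ordered products -/

section OrderedProducts

variable {A : Type*} [Monoid A]

theorem prod_ofFn_intertwine {n : ℕ} {K : A} {f g : Fin n → A} (h : ∀ k, K * f k = g k * K) :
    K * (List.ofFn f).prod = (List.ofFn g).prod * K := by
  induction n with
  | zero => simp
  | succ n ih =>
    rw [List.ofFn_succ, List.ofFn_succ, List.prod_cons, List.prod_cons, ← mul_assoc, h 0,
      mul_assoc, ih fun k => h k.succ, mul_assoc]

/-- An `R`-matrix passes the two factors on which it acts only as a pair, and all others one by one.
As `i` and `j` are neighbours, the pair is a contiguous block of the ordered product. This order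
serves products of monodromy matrices, the reversed one below serves the rows inside a monodromy
matrix. -/
theorem prod_ofFn_intertwine_adjacent {n : ℕ} {K : A} {f g : Fin n → A} {i j : Fin n}
    (hij : (j : ℕ) = i + 1) (h : ∀ k, k ≠ i → k ≠ j → K * f k = g k * K)
    (h2 : K * (f i * f j) = g i * g j * K) :
    K * (List.ofFn f).prod = (List.ofFn g).prod * K := by
  induction n with
  | zero => exact i.elim0
  | succ n ih =>
    obtain ⟨j, rfl⟩ := Fin.exists_succ_eq.2 (show j ≠ 0 by rintro rfl; simp at hij)
    induction i using Fin.cases with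
    | zero =>
      cases n with
      | zero => exact j.elim0
      | succ n =>
        obtain rfl : j = 0 := by ext; simpa using hij
        rw [List.ofFn_succ, List.ofFn_succ, List.ofFn_succ (f := g), List.ofFn_succ (n := n)]
        simp only [List.prod_cons]
        have h3 := prod_ofFn_intertwine (K := K) (f := fun k : Fin n => f k.succ.succ)
          (g := fun k => g k.succ.succ)
          (fun k => h _ (Fin.succ_ne_zero _) (by simp [Fin.ext_iff]))
        rw [← mul_assoc (f 0), ← mul_assoc, h2, mul_assoc _ K, h3]
        simp only [mul_assoc]
    | succ i =>
      rw [List.ofFn_succ, List.ofFn_succ, List.prod_cons, List.prod_cons, ← mul_assoc,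
        h 0 (Fin.succ_ne_zero _).symm (Fin.succ_ne_zero _).symm, mul_assoc,
        ih (f := fun k => f k.succ) (g := fun k => g k.succ) (i := i) (j := j)
          (by simpa using hij) (fun k hk hk' => h _ (by simpa using hk) (by simpa using hk')) h2,
        mul_assoc]

theorem prod_ofFn_reverse_intertwine {n : ℕ} {K : A} {f g : Fin n → A}
    (h : ∀ k, K * f k = g k * K) :
    K * (List.ofFn f).reverse.prod = (List.ofFn g).reverse.prod * K := by
  induction n with
  | zero => simp
  | succ n ih =>
    rw [List.ofFn_succ, List.ofFn_succ, List.reverse_cons, List.reverse_cons, List.prod_append,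
      List.prod_append, List.prod_singleton, List.prod_singleton, ← mul_assoc,
      ih fun k => h k.succ, mul_assoc, h 0, mul_assoc]

theorem prod_ofFn_reverse_intertwine_adjacent {n : ℕ} {K : A} {f g : Fin n → A} {i j : Fin n}
    (hij : (j : ℕ) = i + 1) (h : ∀ k, k ≠ i → k ≠ j → K * f k = g k * K)
    (h2 : K * (f j * f i) = g j * g i * K) :
    K * (List.ofFn f).reverse.prod = (List.ofFn g).reverse.prod * K := by
  induction n with
  | zero => exact i.elim0
  | succ n ih =>
    obtain ⟨j, rfl⟩ := Fin.exists_succ_eq.2 (show j ≠ 0 by rintro rfl; simp at hij)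
    induction i using Fin.cases with
    | zero =>
      cases n with
      | zero => exact j.elim0
      | succ n =>
        obtain rfl : j = 0 := by ext; simpa using hij
        rw [List.ofFn_succ, List.ofFn_succ, List.ofFn_succ (f := g), List.ofFn_succ (n := n)]
        simp only [List.reverse_cons, List.prod_append, List.prod_singleton]
        have h3 := prod_ofFn_reverse_intertwine (K := K) (f := fun k : Fin n => f k.succ.succ)
          (g := fun k => g k.succ.succ)
          (fun k => h _ (Fin.succ_ne_zero _) (by simp [Fin.ext_iff]))
        simp only [← mul_assoc]
        rw [h3]
        simp only [mul_assoc]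
        rw [h2]
        simp only [mul_assoc]
    | succ i =>
      rw [List.ofFn_succ, List.ofFn_succ, List.reverse_cons, List.reverse_cons, List.prod_append,
        List.prod_append, List.prod_singleton, List.prod_singleton, ← mul_assoc,
        ih (f := fun k => f k.succ) (g := fun k => g k.succ) (i := i) (j := j)
          (by simpa using hij) (fun k hk hk' => h _ (by simpa using hk) (by simpa using hk')) h2,
        mul_assoc, h 0 (Fin.succ_ne_zero _).symm (Fin.succ_ne_zero _).symm, mul_assoc]

end OrderedProducts

/-! ## The tensor product of matrices with non-commuting entries -/

section TensorProduct

variable {A : Type*} [Ring A]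

/-- `X_1 ⊗ ⋯ ⊗ X_m`, the entries being multiplied in this order. -/
def tensorMat {m : ℕ} (X : Fin m → Matrix (Fin 2) (Fin 2) A) : Matrix (Spins m) (Spins m) A :=
  fun a b => (List.ofFn fun j => X j (a j) (b j)).prod

/-- `1 ⊗ Z`, with the identity on an additional first factor. -/
def idMat {n : ℕ} (Z : Matrix (Spins n) (Spins n) A) :
    Matrix (Spins (n + 1)) (Spins (n + 1)) A :=
  fun s t => if s 0 = t 0 then Z (Fin.tail s) (Fin.tail t) else 0

theorem sum_cons {n : ℕ} (f : Spins (n + 1) → A) :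
    ∑ s, f s = ∑ c : Fin 2, ∑ r : Spins n, f (Fin.cons c r : Spins (n + 1)) := by
  rw [← (Fin.consEquiv fun _ : Fin (n + 1) => Fin 2).sum_comp, Fintype.sum_prod_type]
  rfl

theorem idMat_mul {n : ℕ} (Z W : Matrix (Spins n) (Spins n) A) :
    idMat (Z * W) = idMat Z * idMat W := by
  ext s t
  simp only [idMat, Matrix.mul_apply, sum_cons, Fin.cons_zero, Fin.tail_cons]
  rw [Finset.sum_eq_single (s 0)]
  · simp only [if_true]
    split_ifs <;> simp
  · intro c _ hc
    simp [hc.symm]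
  · simp

theorem idMat_one {n : ℕ} : idMat (1 : Matrix (Spins n) (Spins n) A) = 1 := by
  ext s t
  simp only [idMat, Matrix.one_apply, ← ite_and]
  congr 1
  rw [eq_iff_iff]
  constructor
  · rintro ⟨h0, h1⟩
    rw [← Fin.cons_self_tail s, ← Fin.cons_self_tail t, h0, h1]
  · rintro rfl
    exact ⟨rfl, rfl⟩

/-- `idMat` as a monoid homomorphism. -/
def idHom (n : ℕ) : Matrix (Spins n) (Spins n) A →* Matrix (Spins (n + 1)) (Spins (n + 1)) A where
  toFun := idMat
  map_one' := idMat_one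
  map_mul' := idMat_mul

theorem idMat_siteMat {n : ℕ} (j : Fin n) (X : Matrix (Fin 2) (Fin 2) A) :
    idMat (siteMat j X) = siteMat j.succ X := by
  ext s t
  simp only [idMat, siteMat, Fin.tail, Fin.forall_fin_succ (P := fun k => k ≠ j.succ → s k = t k),
    ne_eq, (Fin.succ_ne_zero j).symm, not_false_eq_true, true_implies, Fin.succ_inj, ite_and]
  exact if_congr Iff.rfl (if_congr Iff.rfl rfl rfl) rfl

theorem siteMat_zero_mul_idMat {n : ℕ} (X : Matrix (Fin 2) (Fin 2) A)
    (Z : Matrix (Spins n) (Spins n) A) (s t : Spins (n + 1)) :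
    (siteMat 0 X * idMat Z : Matrix (Spins (n + 1)) (Spins (n + 1)) A) s t = X (s 0) (t 0) * Z (Fin.tail s) (Fin.tail t) := by
  have : ∀ k, siteMat 0 X s k * idMat Z k t =
      if ∀ j, j ≠ 0 → s j = k j then X (s 0) (k 0) * idMat Z k t else 0 := by
    intro k; simp only [siteMat, ite_mul, zero_mul]
  rw [Matrix.mul_apply]
  simp only [this]
  rw [sum_agree_off_site 0 s (fun k => X (s 0) (k 0) * idMat Z k t), Finset.sum_eq_single (t 0)]
  · have : Fin.tail (Function.update s 0 (t 0)) = Fin.tail s := by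
      funext k; simp [Fin.tail]
    simp [idMat, this]
  · intro c _ hc
    simp [idMat, hc]
  · simp

theorem idMat_mul_siteMat_zero {n : ℕ} (X : Matrix (Fin 2) (Fin 2) A)
    (Z : Matrix (Spins n) (Spins n) A) (s t : Spins (n + 1)) :
    (idMat Z * siteMat 0 X : Matrix (Spins (n + 1)) (Spins (n + 1)) A) s t = Z (Fin.tail s) (Fin.tail t) * X (s 0) (t 0) := by
  have : ∀ k, idMat Z s k * siteMat 0 X k t =
      if ∀ j, j ≠ 0 → t j = k j then idMat Z s k * X (k 0) (t 0) else 0 := by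
    intro k; simp only [siteMat, mul_ite, mul_zero, eq_comm]
  rw [Matrix.mul_apply]
  simp only [this]
  rw [sum_agree_off_site 0 t (fun k => idMat Z s k * X (k 0) (t 0)),
    Finset.sum_eq_single (s 0)]
  · have : Fin.tail (Function.update t 0 (s 0)) = Fin.tail t := by
      funext k; simp [Fin.tail]
    simp [idMat, this]
  · intro c _ hc
    simp [idMat, hc.symm]
  · simp

/-- The order of the sites is the order of the entries, so no commutativity is needed. As an ordered
product, the tensor product becomes accessible to the intertwining lemmas. -/
theorem tensorMat_eq_prod {m : ℕ} (X : Fin m → Matrix (Fin 2) (Fin 2) A) :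
    tensorMat X = (List.ofFn fun j => siteMat j (X j)).prod := by
  induction m with
  | zero =>
    ext s t
    simp [tensorMat, Subsingleton.elim s t]
  | succ m ih =>
    rw [List.ofFn_succ, List.prod_cons]
    have : (List.ofFn fun j : Fin m => siteMat j.succ (X j.succ)).prod =
        idMat (tensorMat fun j : Fin m => X j.succ) := by
      rw [ih]
      change _ = idHom (A := A) m _
      rw [map_list_prod, List.map_ofFn]
      congr 1
      congr 1
      funext j
      exact (idMat_siteMat j (X j.succ)).symm
    rw [this]
    ext s t
    rw [siteMat_zero_mul_idMat]
    simp [tensorMat, List.ofFn_succ, Fin.tail]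

end TensorProduct

/-! ## The entire `R`-matrix and the Yang-Baxter equation -/

/-- The six-vertex matrix with the weights `a`, `b`, `c`. -/
def sixVertex (a b c : ℂ) : Op2 := fun s t =>
  if s = t then (if s.1 = s.2 then a else b) else if s = t.swap then c else 0

/-- `sin (u + η) R`, an entire function of the difference `u` of the spectral parameters. -/
def entR (η u : ℂ) : Op2 := sixVertex (Complex.sin (u + η)) (Complex.sin u) (Complex.sin η)

theorem RMat_eq_smul_entR (γ l μ : ℂ) (hs : Complex.sin (μ - l + Complex.I * γ) ≠ 0) :
    RMat γ l μ = (Complex.sin (μ - l + Complex.I * γ))⁻¹ • entR (Complex.I * γ) (μ - l) := by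
  ext s t
  simp only [RMat, entR, sixVertex, bFun, cFun, Matrix.smul_apply, smul_eq_mul]
  split_ifs <;> first | (field_simp; done) | simp

/-- Unitarity. The only component that is not immediate is `sin² η - sin² u = sin (η + u) sin (η -
u)`. -/
theorem entR_mul_entR_neg (η u : ℂ) :
    entR η u * entR η (-u) = (Complex.sin (η + u) * Complex.sin (η - u)) • (1 : Op2) := by
  ext ⟨a, b⟩ ⟨c, d⟩
  have h1 := Complex.sin_sq_add_cos_sq u
  have h2 := Complex.sin_sq_add_cos_sq η
  fin_cases a <;> fin_cases b <;> fin_cases c <;> fin_cases d <;>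
    simp [Matrix.mul_apply, Fintype.sum_prod_type, entR, sixVertex, Complex.sin_add, Complex.sin_sub] <;>
    first
      | ring1
      | linear_combination Complex.sin u ^ 2 * h2 - Complex.sin η ^ 2 * h1

theorem permMat_mul_apply (X : Op2) (s t : Fin 2 × Fin 2) :
    (permMat * X) s t = X s.swap t := by
  rw [Matrix.mul_apply, Finset.sum_eq_single s.swap]
  · simp [permMat]
  · intro k _ hk
    rw [permMat, if_neg, zero_mul]
    rintro rfl
    simp at hk
  · simp

theorem mul_permMat_apply (X : Op2) (s t : Fin 2 × Fin 2) :
    (X * permMat) s t = X s t.swap := by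
  rw [Matrix.mul_apply, Finset.sum_eq_single t.swap]
  · simp [permMat]
  · intro k _ hk
    rw [permMat, if_neg hk, mul_zero]
  · simp

theorem permMat_mul_self : permMat * permMat = 1 := by
  ext s t
  rw [permMat_mul_apply, permMat, Matrix.one_apply]
  simp [Prod.swap_inj]

theorem permMat_mul_entR (η u : ℂ) : permMat * entR η u = entR η u * permMat := by
  ext ⟨a, b⟩ ⟨c, d⟩
  rw [permMat_mul_apply, mul_permMat_apply]
  fin_cases a <;> fin_cases b <;> fin_cases c <;> fin_cases d <;> simp [entR, sixVertex]

/-- The Yang-Baxter equation for three six-vertex matrices, in components. -/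
theorem sixVertex_yangBaxter {a₁ b₁ a₂ b₂ a₃ b₃ c : ℂ} (h1 : a₁ * b₂ = a₂ * b₁ + b₃ * c)
    (h2 : a₁ * a₃ = c * a₂ + b₁ * b₃) (h3 : b₂ * a₃ = b₃ * a₂ + c * b₁)
    (i j k i' j' k' : Fin 2) :
    (∑ x : Fin 2, ∑ y : Fin 2, ∑ z : Fin 2, sixVertex a₁ b₁ c (i, j) (x, y) *
      sixVertex a₂ b₂ c (x, k) (i', z) * sixVertex a₃ b₃ c (y, z) (j', k')) =
    ∑ x : Fin 2, ∑ y : Fin 2, ∑ z : Fin 2, sixVertex a₃ b₃ c (j, k) (y, z) *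
      sixVertex a₂ b₂ c (i, z) (x, k') * sixVertex a₁ b₁ c (x, y) (i', j') := by
  -- All 64 components are checked; each is trivial or is `±c` times one of the three hypotheses.
  simp only [Fin.sum_univ_two, sixVertex, Prod.mk.injEq, Prod.swap_prod_mk]
  fin_cases i <;> fin_cases j <;> fin_cases k <;> fin_cases i' <;> fin_cases j' <;>
    fin_cases k' <;> simp <;>
    first
      | ring1
      | linear_combination c * h1
      | linear_combination c * h2
      | linear_combination c * h3
      | linear_combination (-c) * h1
      | linear_combination (-c) * h2
      | linear_combination (-c) * h3

/-- The Yang-Baxter equation in components. -/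
theorem entR_yangBaxter (η u v : ℂ) (i j k i' j' k' : Fin 2) :
    (∑ x : Fin 2, ∑ y : Fin 2, ∑ z : Fin 2,
      entR η (u - v) (i, j) (x, y) * entR η u (x, k) (i', z) * entR η v (y, z) (j', k')) =
    ∑ x : Fin 2, ∑ y : Fin 2, ∑ z : Fin 2,
      entR η v (j, k) (y, z) * entR η u (i, z) (x, k') * entR η (u - v) (x, y) (i', j') := by
  have hu := Complex.sin_sq_add_cos_sq u
  have hη := Complex.sin_sq_add_cos_sq η
  have hv := Complex.sin_sq_add_cos_sq v
  -- For weights at `u - v`, `u`, `v` the three hypotheses are addition theorems for the sine.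
  apply sixVertex_yangBaxter <;>
    simp only [Complex.sin_add, Complex.sin_sub, Complex.cos_sub]
  · linear_combination (Complex.sin v * Complex.sin η) * hu
  · linear_combination (Complex.sin u * Complex.cos v * Complex.sin v -
      Complex.cos u * Complex.sin v ^ 2) * hη +
      (Complex.sin η ^ 2 * Complex.cos u + Complex.sin u * Complex.sin η * Complex.cos η) * hv
  · ring

theorem entR_swap (η u : ℂ) (s t : Fin 2 × Fin 2) : entR η u s.swap t.swap = entR η u s t := by
  obtain ⟨a, b⟩ := s
  obtain ⟨c, d⟩ := t
  fin_cases a <;> fin_cases b <;> fin_cases c <;> fin_cases d <;> simp [entR, sixVertex]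

/-! ## The `RTT` relation -/

section RTT

theorem commute_prod_apply {A : Type*} [Ring A] {c : A} (l : List (Matrix (Fin 2) (Fin 2) A))
    (h : ∀ X ∈ l, ∀ a b, Commute c (X a b)) (a b : Fin 2) : Commute c (l.prod a b) := by
  induction l generalizing a b with
  | nil =>
    rw [List.prod_nil, Matrix.one_apply]
    split_ifs
    · exact Commute.one_right c
    · exact Commute.zero_right c
  | cons X l ih =>
    rw [List.prod_cons, Matrix.mul_apply]
    exact Commute.sum_right _ _ _ fun k _ => (h X (by simp) a k).mul_right
      (ih (fun Y hY => h Y (by simp [hY])) k b)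

variable {A : Type*} [Ring A] [Algebra ℂ A]

theorem map_algebraMap_mul_apply {n : Type*} [Fintype n] (R : Matrix n n ℂ) (Z : Matrix n n A)
    (s t : n) : (R.map (algebraMap ℂ A) * Z) s t = ∑ k, R s k • Z k t := by
  simp [Matrix.mul_apply, Algebra.smul_def]

theorem mul_map_algebraMap_apply {n : Type*} [Fintype n] (R : Matrix n n ℂ) (Z : Matrix n n A)
    (s t : n) : (Z * R.map (algebraMap ℂ A)) s t = ∑ k, R k t • Z s k := by
  simp [Matrix.mul_apply, Algebra.smul_def, Algebra.commutes]

/-- For non-commuting entries the trace is not cyclic in general; it is when one factor has scalar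
entries. -/
theorem trace_map_algebraMap_mul {n : Type*} [Fintype n] (R : Matrix n n ℂ) (Z : Matrix n n A) :
    (R.map (algebraMap ℂ A) * Z).trace = (Z * R.map (algebraMap ℂ A)).trace := by
  simp only [Matrix.trace, Matrix.diag_apply, map_algebraMap_mul_apply, mul_map_algebraMap_apply]
  exact Finset.sum_comm

theorem map_algebraMap_smul_one {n : Type*} [DecidableEq n] (c : ℂ) :
    (c • (1 : Matrix n n ℂ)).map (algebraMap ℂ A) = c • (1 : Matrix n n A) := by
  ext s t
  rw [Matrix.map_apply, Matrix.smul_apply, Matrix.smul_apply, Matrix.one_apply, Matrix.one_apply]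
  split_ifs <;> simp [Algebra.algebraMap_eq_smul_one]

/-- `R_{12} X_1 Y_2 = Y_2 X_1 R_{12}`. -/
def RTT (R : Op2) (X Y : Matrix (Fin 2) (Fin 2) A) : Prop :=
  R.map (algebraMap ℂ A) * (fstMat X * sndMat Y) = sndMat Y * fstMat X * R.map (algebraMap ℂ A)

/-- The coproduct of the `RTT` algebra. Entries belonging to different sites commute, so the factors
can be regrouped into two pairs, and `R` passes one pair at a time. -/
theorem RTT.mul {R : Op2} {X Y X' Y' : Matrix (Fin 2) (Fin 2) A} (h : RTT R X Y)
    (h' : RTT R X' Y') (h1 : ∀ a b c d, Commute (X' a b) (Y c d))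
    (h2 : ∀ a b c d, Commute (X a b) (Y' c d)) : RTT R (X * X') (Y * Y') := by
  have c1 := (fstMat_commute_sndMat h1).eq
  have c2 := (fstMat_commute_sndMat h2).eq
  unfold RTT at *
  rw [fstMat_mul, sndMat_mul]
  calc R.map (algebraMap ℂ A) * (fstMat X * fstMat X' * (sndMat Y * sndMat Y'))
      = R.map (algebraMap ℂ A) * (fstMat X * (fstMat X' * sndMat Y) * sndMat Y') := by
        simp only [mul_assoc]
    _ = R.map (algebraMap ℂ A) * (fstMat X * sndMat Y) * (fstMat X' * sndMat Y') := by
        rw [c1]; simp only [mul_assoc]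
    _ = sndMat Y * fstMat X * (R.map (algebraMap ℂ A) * (fstMat X' * sndMat Y')) := by
        rw [h]; simp only [mul_assoc]
    _ = sndMat Y * (fstMat X * sndMat Y') * fstMat X' * R.map (algebraMap ℂ A) := by
        rw [h']; simp only [mul_assoc]
    _ = _ := by rw [c2]; simp only [mul_assoc]

theorem RTT.map {B : Type*} [Ring B] [Algebra ℂ B] {R : Op2} {X Y : Matrix (Fin 2) (Fin 2) A}
    (h : RTT R X Y) (f : A →ₐ[ℂ] B) : RTT R (X.map f) (Y.map f) := by
  unfold RTT at *
  have h' := congrArg (fun Z => Z.map f) h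
  simp only [Matrix.map_mul] at h'
  have e1 : (R.map (algebraMap ℂ A)).map f = R.map (algebraMap ℂ B) := by
    ext s t; simp
  have e2 : ∀ X : Matrix (Fin 2) (Fin 2) A, (fstMat X).map f = fstMat (X.map f) := by
    intro X; ext s t; simp only [fstMat, Matrix.map_apply]; split_ifs <;> simp
  have e3 : ∀ X : Matrix (Fin 2) (Fin 2) A, (sndMat X).map f = sndMat (X.map f) := by
    intro X; ext s t; simp only [sndMat, Matrix.map_apply]; split_ifs <;> simp
  rwa [e1, e2, e3] at h'

theorem RTT.prod_reverse {R : Op2} {M : ℕ} {X Y : Fin M → Matrix (Fin 2) (Fin 2) A}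
    (h : ∀ j, RTT R (X j) (Y j))
    (hc : ∀ i j, i ≠ j → ∀ a b c d, Commute (X i a b) (Y j c d)) :
    RTT R (List.ofFn X).reverse.prod (List.ofFn Y).reverse.prod := by
  induction M with
  | zero =>
    have e1 : fstMat (1 : Matrix (Fin 2) (Fin 2) A) = 1 := by
      ext ⟨a, b⟩ ⟨c, d⟩
      fin_cases a <;> fin_cases b <;> fin_cases c <;> fin_cases d <;> simp [fstMat]
    have e2 : sndMat (1 : Matrix (Fin 2) (Fin 2) A) = 1 := by
      ext ⟨a, b⟩ ⟨c, d⟩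
      fin_cases a <;> fin_cases b <;> fin_cases c <;> fin_cases d <;> simp [sndMat]
    simp [RTT, e1, e2]
  | succ M ih =>
    simp only [List.ofFn_succ, List.reverse_cons, List.prod_append, List.prod_singleton]
    refine (ih (fun j => h j.succ) fun i j hij => hc _ _ (by simpa using hij)).mul (h 0) ?_ ?_
    · intro a b c d
      refine commute_prod_apply _ ?_ c d
      intro Z hZ
      simp only [List.mem_reverse, List.mem_ofFn] at hZ
      obtain ⟨k, rfl⟩ := hZ
      exact hc 0 k.succ (Fin.succ_ne_zero k).symm a b
    · intro a b c d
      refine (commute_prod_apply _ ?_ a b).symm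
      intro Z hZ
      simp only [List.mem_reverse, List.mem_ofFn] at hZ
      obtain ⟨k, rfl⟩ := hZ
      exact fun a b => (hc k.succ 0 (Fin.succ_ne_zero k) a b c d).symm

/-- Conjugating one order of the product by the invertible scalar matrix `R` gives the other, and
the trace over both auxiliary spaces does not see the conjugation. -/
theorem RTT.commute_trace {R R' : Op2} {c : ℂ} (hc : c ≠ 0) (hR : R * R' = c • 1)
    {X Y : Matrix (Fin 2) (Fin 2) A} (h : RTT R X Y) : Commute X.trace Y.trace := by
  have hR' : R.map (algebraMap ℂ A) * R'.map (algebraMap ℂ A) = c • 1 := by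
    rw [← Matrix.map_mul, hR]
    exact map_algebraMap_smul_one c
  have hR'' : R'.map (algebraMap ℂ A) * R.map (algebraMap ℂ A) = c • 1 := by
    have : R' * R = c • 1 := by
      have h1 : R * (c⁻¹ • R') = 1 := by rw [Matrix.mul_smul, hR, smul_smul, inv_mul_cancel₀ hc,
        one_smul]
      have h2 := mul_eq_one_comm.1 h1
      rw [Matrix.smul_mul] at h2
      rw [← h2, smul_smul, mul_inv_cancel₀ hc, one_smul]
    rw [← Matrix.map_mul, this]
    exact map_algebraMap_smul_one c
  have e1 : (fstMat X * sndMat Y).trace = X.trace * Y.trace := by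
    simp only [Matrix.trace, Matrix.diag_apply, fstMat_mul_sndMat_apply, Fintype.sum_prod_type,
      Finset.sum_mul_sum]
  have e2 : (sndMat Y * fstMat X).trace = Y.trace * X.trace := by
    simp only [Matrix.trace, Matrix.diag_apply, sndMat_mul_fstMat_apply, Fintype.sum_prod_type,
      Finset.sum_mul_sum]
    exact Finset.sum_comm
  have e3 : c • (fstMat X * sndMat Y).trace = c • (sndMat Y * fstMat X).trace := by
    calc c • (fstMat X * sndMat Y).trace
        = (R'.map (algebraMap ℂ A) * (R.map (algebraMap ℂ A) * (fstMat X * sndMat Y))).trace := by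
          rw [← mul_assoc, hR'', Matrix.smul_mul, one_mul, Matrix.trace_smul]
      _ = (sndMat Y * fstMat X * (R.map (algebraMap ℂ A) * R'.map (algebraMap ℂ A))).trace := by
          rw [h, trace_map_algebraMap_mul, mul_assoc]
      _ = _ := by rw [hR', Matrix.mul_smul, mul_one, Matrix.trace_smul]
  rw [e1, e2] at e3
  exact smul_right_injective A hc e3

end RTT

/-! ## The entire monodromy matrix -/

/-- `siteMat` with scalar entries, as an algebra homomorphism. -/
def siteAlgHom {n : ℕ} (i : Fin n) : Matrix (Fin 2) (Fin 2) ℂ →ₐ[ℂ] Op n where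
  __ := siteHom (A := ℂ) i
  commutes' c := by
    change siteMat i _ = _
    ext s t
    have := congrFun (congrFun (siteMat_one (A := ℂ) i) s) t
    simp only [siteMat, Matrix.algebraMap_eq_diagonal, Matrix.one_apply] at this ⊢
    simp only [Matrix.diagonal_apply, Pi.algebraMap_apply, Algebra.algebraMap_self,
      RingHom.id_apply]
    split_ifs at this ⊢ <;> simp_all

@[simp] theorem siteAlgHom_apply {n : ℕ} (i : Fin n) (X : Matrix (Fin 2) (Fin 2) ℂ) :
    siteAlgHom i X = siteOp i X := rfl

theorem siteOp_commute {n : ℕ} {i j : Fin n} (hij : i ≠ j) (X Y : Matrix (Fin 2) (Fin 2) ℂ) :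
    Commute (siteOp i X) (siteOp j Y) :=
  siteMat_commute hij fun _ _ _ _ => Commute.all _ _

/-- The matrix `L(u)` of operators on one site. -/
def laxMat (η u : ℂ) : Matrix (Fin 2) (Fin 2) (Matrix (Fin 2) (Fin 2) ℂ) :=
  fun a b s t => entR η u (a, s) (b, t)

/-- This is the Yang–Baxter equation with the third space read as the quantum space. -/
theorem laxMat_rtt (η u v : ℂ) : RTT (entR η (u - v)) (laxMat η u) (laxMat η v) := by
  ext ⟨i, j⟩ ⟨i', j'⟩ k k'
  rw [map_algebraMap_mul_apply, mul_map_algebraMap_apply]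
  simp only [Matrix.sum_apply, Matrix.smul_apply, fstMat_mul_sndMat_apply,
    sndMat_mul_fstMat_apply, Fintype.sum_prod_type]
  simp only [Matrix.mul_apply, laxMat, smul_eq_mul, Finset.mul_sum]
  have := entR_yangBaxter η u v i j k i' j' k'
  simp only [mul_assoc] at this
  rw [this]
  exact Finset.sum_congr rfl fun x _ => Finset.sum_congr rfl fun y _ =>
    Finset.sum_congr rfl fun z _ => by ring

/-- `L_{0,j}(u)` as a matrix in the auxiliary space. -/
def laxOp (η : ℂ) {M : ℕ} (j : Fin M) (u : ℂ) : Matrix (Fin 2) (Fin 2) (Op M) :=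
  (laxMat η u).map (siteAlgHom j)

/-- `L_{0,M}(ν_M - l) ⋯ L_{0,1}(ν_1 - l)` as a matrix in the auxiliary space. -/
def entMono (η : ℂ) {M : ℕ} (ν : Fin M → ℂ) (l : ℂ) : Matrix (Fin 2) (Fin 2) (Op M) :=
  (List.ofFn fun j => laxOp η j (ν j - l)).reverse.prod

/-- The twisted entire monodromy matrix. -/
def twMono (η : ℂ) {M : ℕ} (ν : Fin M → ℂ) (κ l : ℂ) : Matrix (Fin 2) (Fin 2) (Op M) :=
  (theta κ).map (algebraMap ℂ (Op M)) * entMono η ν l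

/-- The twisted entire transfer matrix. -/
def twTransfer (η : ℂ) {M : ℕ} (ν : Fin M → ℂ) (κ l : ℂ) : Op M := (twMono η ν κ l).trace

theorem theta_apply (κ : ℂ) (a b : Fin 2) :
    theta κ a b = if a = b then theta κ a a else 0 := by
  fin_cases a <;> fin_cases b <;> simp [theta]

theorem twMono_apply (η : ℂ) {M : ℕ} (ν : Fin M → ℂ) (κ l : ℂ) (a b : Fin 2) :
    twMono η ν κ l a b = theta κ a a • entMono η ν l a b := by
  rw [twMono, map_algebraMap_mul_apply, Finset.sum_eq_single a]
  · intro c _ hc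
    rw [theta_apply, if_neg hc.symm, zero_smul]
  · simp

variable {η : ℂ} {M : ℕ}

theorem laxOp_commute {i j : Fin M} (hij : i ≠ j) (u v : ℂ) (a b c d : Fin 2) :
    Commute (laxOp η i u a b) (laxOp η j v c d) :=
  siteOp_commute hij _ _

theorem entMono_rtt (ν : Fin M → ℂ) (x y : ℂ) :
    RTT (entR η (y - x)) (entMono η ν x) (entMono η ν y) := by
  refine RTT.prod_reverse (fun j => ?_) fun i j hij a b c d => laxOp_commute hij _ _ _ _ _ _
  have := (laxMat_rtt η (ν j - x) (ν j - y)).map (siteAlgHom j)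
  -- The inhomogeneity drops out of the difference, so the same `R`-matrix serves every site.
  rwa [show ν j - x - (ν j - y) = y - x by ring] at this

theorem theta_rtt {A : Type*} [Ring A] [Algebra ℂ A] (u κ : ℂ) :
    RTT (entR η u) ((theta κ).map (algebraMap ℂ A)) ((theta κ).map (algebraMap ℂ A)) := by
  refine RTT.map (A := ℂ) ?_ (Algebra.ofId ℂ A)
  ext ⟨a, b⟩ ⟨c, d⟩
  rw [map_algebraMap_mul_apply, mul_map_algebraMap_apply]
  simp only [fstMat_mul_sndMat_apply, sndMat_mul_fstMat_apply, Fintype.sum_prod_type,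
    Fin.sum_univ_two]
  fin_cases a <;> fin_cases b <;> fin_cases c <;> fin_cases d <;>
    simp [theta, entR, sixVertex, mul_comm]

theorem twMono_rtt (ν : Fin M → ℂ) (κ x y : ℂ) :
    RTT (entR η (y - x)) (twMono η ν κ x) (twMono η ν κ y) :=
  (theta_rtt _ κ).mul (entMono_rtt ν x y)
    (fun a b c d => (Algebra.commutes (theta κ c d) (entMono η ν x a b)).symm)
    fun a b c d => Algebra.commutes (theta κ a b) (entMono η ν y c d)

/-! ## Exchanging neighbouring rows -/

section RowExchange

variable {η : ℂ} {M : ℕ}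

/-- The Yang–Baxter equation again, now with two quantum spaces in the first two places and the
auxiliary space in the third. The symmetry `entR_swap` brings the factors into this form. -/
theorem laxMat_exchange (u v : ℂ) (a b : Fin 2) :
    permMat * entR η (u - v) * ∑ c, fstMat (laxMat η u a c) * sndMat (laxMat η v c b) =
      (∑ c, fstMat (laxMat η v a c) * sndMat (laxMat η u c b)) * (permMat * entR η (u - v)) := by
  ext ⟨i, j⟩ ⟨i', j'⟩
  rw [mul_assoc, permMat_mul_apply, permMat_mul_entR, ← mul_assoc, mul_permMat_apply]
  simp only [Matrix.mul_apply (M := entR η (u - v)), Matrix.mul_apply (N := entR η (u - v)),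
    Matrix.sum_apply, fstMat_mul_sndMat_apply, Fintype.sum_prod_type, Prod.swap_prod_mk,
    Finset.mul_sum, Finset.sum_mul, laxMat]
  have h := entR_yangBaxter η u v j i a i' j' b
  have hs : ∀ w x y z t, entR η w (x, y) (z, t) = entR η w (y, x) (t, z) :=
    fun w x y z t => (entR_swap η w (x, y) (z, t)).symm
  have e1 : ∀ x y z, entR η (u - v) (j, i) (x, y) * (entR η u (a, x) (z, i') *
      entR η v (z, y) (b, j')) = entR η (u - v) (j, i) (x, y) * entR η u (x, a) (i', z) *
      entR η v (y, z) (j', b) := by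
    intro x y z
    rw [hs u a x, hs v z y, mul_assoc]
  have e2 : ∀ x y z, entR η v (a, i) (z, y) * entR η u (z, j) (b, x) *
      entR η (u - v) (y, x) (j', i') = entR η v (i, a) (y, z) * entR η u (j, z) (x, b) *
      entR η (u - v) (x, y) (i', j') := by
    intro x y z
    rw [hs v a i, hs u z j, hs (u - v) y x]
  simp only [e1, e2]
  rw [h, Finset.sum_comm]

/-- The operator that exchanges the rows `i` and `j`. -/
def rowExchange (η : ℂ) (ν : Fin M → ℂ) (i j : Fin M) : Op M :=
  pairOp j i (permMat * entR η (ν j - ν i))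

theorem rowExchange_mul_entMono (ν : Fin M → ℂ) {i j : Fin M} (hij : (j : ℕ) = i + 1) (l : ℂ)
    (a b : Fin 2) :
    rowExchange η ν i j * entMono η ν l a b =
      entMono η (ν ∘ Equiv.swap i j) l a b * rowExchange η ν i j := by
  have hne : i ≠ j := by rintro rfl; omega
  -- The diagonal matrix is the exchange operator acting trivially in the auxiliary space; it makes
  -- the statement an intertwining relation between products of matrices over `Op M`.
  have key : Matrix.diagonal (fun _ : Fin 2 => rowExchange η ν i j) * entMono η ν l =
      entMono η (ν ∘ Equiv.swap i j) l * Matrix.diagonal (fun _ => rowExchange η ν i j) := by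
    refine prod_ofFn_reverse_intertwine_adjacent hij ?_ ?_
    · intro k hki hkj
      ext1 a b
      rw [Matrix.diagonal_mul, Matrix.mul_diagonal]
      simp only [Function.comp, Equiv.swap_apply_of_ne_of_ne hki hkj]
      exact pairMat_commute_siteMat hne.symm hkj hki fun _ _ _ _ => Commute.all _ _
    · ext1 a b
      rw [Matrix.diagonal_mul, Matrix.mul_diagonal]
      simp only [Matrix.mul_apply (M := laxOp η _ _), Function.comp, Equiv.swap_apply_left,
        Equiv.swap_apply_right]
      have := congrArg (pairHom hne.symm) (laxMat_exchange (η := η) (ν j - l) (ν i - l) a b)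
      simp only [map_mul, map_sum, pairHom_apply, pairMat_fstMat hne.symm,
        pairMat_sndMat hne.symm] at this
      rw [show ν j - l - (ν i - l) = ν j - ν i by ring] at this
      rw [rowExchange, pairOp_eq, pairMat_mul hne.symm]
      exact this
  have := congrFun (congrFun key a) b
  rwa [Matrix.diagonal_mul, Matrix.mul_diagonal] at this

theorem rowExchange_isUnit (ν : Fin M → ℂ) {i j : Fin M} (hij : i ≠ j)
    (h1 : Complex.sin (η + (ν j - ν i)) ≠ 0) (h2 : Complex.sin (η - (ν j - ν i)) ≠ 0) :
    IsUnit (rowExchange η ν i j) := by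
  have h3 : permMat * entR η (ν j - ν i) * (entR η (-(ν j - ν i)) * permMat) =
      (Complex.sin (η + (ν j - ν i)) * Complex.sin (η - (ν j - ν i))) • (1 : Op2) := by
    rw [mul_assoc, ← mul_assoc (entR _ _), entR_mul_entR_neg, Matrix.smul_mul, one_mul,
      Matrix.mul_smul, permMat_mul_self]
  have h4 : IsUnit (permMat * entR η (ν j - ν i)) := by
    refine IsUnit.of_mul_eq_one ((Complex.sin (η + (ν j - ν i)) *
      Complex.sin (η - (ν j - ν i)))⁻¹ • (entR η (-(ν j - ν i)) * permMat)) ?_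
    rw [Matrix.mul_smul, h3, smul_smul, inv_mul_cancel₀ (mul_ne_zero h1 h2), one_smul]
  exact h4.map (pairHom hij.symm)

end RowExchange

/-! ## The `U(1)` grading -/

section Grading

/-- `±1` for `e_±`. -/
def spinSign (c : Fin 2) : ℤ := if c = 0 then 1 else -1

/-- The eigenvalue of `∑_j σ_j^z` at a basis vector. -/
def spinWt {n : ℕ} (s : Spins n) : ℤ := ∑ j, spinSign (s j)

/-- The operator `∑_j σ_j^z`. -/
def spinOp (n : ℕ) : Op n := Matrix.diagonal fun s => (spinWt s : ℂ)

/-- `X` raises the eigenvalue of `∑_j σ_j^z` by `d`. -/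
def HasDeg {n : ℕ} (d : ℤ) (X : Op n) : Prop := ∀ s t, X s t ≠ 0 → spinWt s - spinWt t = d

variable {n : ℕ}

theorem HasDeg.mul {d e : ℤ} {X Y : Op n} (hX : HasDeg d X) (hY : HasDeg e Y) :
    HasDeg (d + e) (X * Y) := by
  intro s t hst
  rw [Matrix.mul_apply] at hst
  obtain ⟨k, -, hk⟩ := Finset.exists_ne_zero_of_sum_ne_zero hst
  rw [← hX s k (left_ne_zero_of_mul hk), ← hY k t (right_ne_zero_of_mul hk)]
  ring

theorem HasDeg.sum {ι : Type*} {d : ℤ} {X : ι → Op n} {S : Finset ι}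
    (h : ∀ i ∈ S, HasDeg d (X i)) : HasDeg d (∑ i ∈ S, X i) := by
  intro s t hst
  rw [Matrix.sum_apply] at hst
  obtain ⟨k, hk, hk'⟩ := Finset.exists_ne_zero_of_sum_ne_zero hst
  exact h k hk s t hk'

theorem HasDeg.smul {d : ℤ} {X : Op n} (h : HasDeg d X) (c : ℂ) : HasDeg d (c • X) := by
  intro s t hst
  exact h s t (right_ne_zero_of_mul hst)

theorem HasDeg.one : HasDeg 0 (1 : Op n) := by
  intro s t hst
  obtain rfl : s = t := by
    by_contra h
    exact hst (Matrix.one_apply_ne h)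
  simp

theorem HasDeg.commute_spinOp {X : Op n} (h : HasDeg 0 X) : Commute X (spinOp n) := by
  ext s t
  rw [spinOp, Matrix.mul_diagonal, Matrix.diagonal_mul]
  by_cases hst : X s t = 0
  · simp [hst]
  · rw [sub_eq_zero.1 (h s t hst), mul_comm]

theorem spinOp_mulVec_eq_zero {v : Spins n → ℂ} :
    spinOp n *ᵥ v = 0 ↔ ∀ s, v s ≠ 0 → spinWt s = 0 := by
  simp only [funext_iff, spinOp, Matrix.mulVec_diagonal, Pi.zero_apply, mul_eq_zero]
  refine forall_congr' fun s => ?_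
  norm_cast
  tauto

theorem spinOp_transpose : (spinOp n)ᵀ = spinOp n := Matrix.diagonal_transpose _

theorem vecMul_spinOp (v : Spins n → ℂ) : v ᵥ* spinOp n = spinOp n *ᵥ v := by
  rw [← Matrix.mulVec_transpose, spinOp_transpose]

theorem HasDeg.dotProduct_mulVec {d : ℤ} {X : Op n} (h : HasDeg d X) {v w : Spins n → ℂ}
    (hv : spinOp n *ᵥ v = 0) (hw : spinOp n *ᵥ w = 0) (hne : v ⬝ᵥ (X *ᵥ w) ≠ 0) : d = 0 := by
  obtain ⟨s, -, hs⟩ := Finset.exists_ne_zero_of_sum_ne_zero hne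
  obtain ⟨t, -, ht⟩ := Finset.exists_ne_zero_of_sum_ne_zero (right_ne_zero_of_mul hs)
  rw [← h s t (left_ne_zero_of_mul ht), spinOp_mulVec_eq_zero.1 hv s (left_ne_zero_of_mul hs),
    spinOp_mulVec_eq_zero.1 hw t (right_ne_zero_of_mul ht), sub_zero]

theorem HasDeg.siteOp {d : ℤ} (i : Fin n) {X : Matrix (Fin 2) (Fin 2) ℂ}
    (h : ∀ a b, X a b ≠ 0 → spinSign a - spinSign b = d) : HasDeg d (siteOp i X) := by
  intro s t hst
  rw [XXZ.siteOp] at hst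
  split_ifs at hst with hst'
  · rw [spinWt, spinWt, ← Finset.sum_sub_distrib, Finset.sum_eq_single i]
    · exact h _ _ hst
    · intro k _ hk
      rw [hst' k hk, sub_self]
    · simp
  · exact absurd rfl hst

variable {η : ℂ} {M : ℕ}

/-- The ice rule: a non-zero vertex conserves the sum of the auxiliary and the quantum spin, so the
quantum spin gains what the auxiliary spin loses. -/
theorem laxOp_hasDeg (j : Fin M) (u : ℂ) (a b : Fin 2) :
    HasDeg (spinSign b - spinSign a) (laxOp η j u a b) := by
  refine HasDeg.siteOp j fun s t => ?_
  fin_cases a <;> fin_cases b <;> fin_cases s <;> fin_cases t <;>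
    simp [laxMat, entR, sixVertex, spinSign]

theorem hasDeg_list_prod (l : List (Matrix (Fin 2) (Fin 2) (Op M)))
    (h : ∀ X ∈ l, ∀ a b, HasDeg (spinSign b - spinSign a) (X a b)) (a b : Fin 2) :
    HasDeg (spinSign b - spinSign a) (l.prod a b) := by
  induction l generalizing a b with
  | nil =>
    rw [List.prod_nil, Matrix.one_apply]
    split_ifs with hab
    · rw [hab, sub_self]; exact HasDeg.one
    · intro s t hst; exact absurd rfl hst
  | cons X l ih =>
    rw [List.prod_cons, Matrix.mul_apply]
    refine HasDeg.sum fun k _ => ?_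
    have := (h X (by simp) a k).mul (ih (fun Y hY => h Y (by simp [hY])) k b)
    rwa [show spinSign k - spinSign a + (spinSign b - spinSign k) = spinSign b - spinSign a by
      ring] at this

theorem entMono_hasDeg (ν : Fin M → ℂ) (l : ℂ) (a b : Fin 2) :
    HasDeg (spinSign b - spinSign a) (entMono η ν l a b) := by
  refine hasDeg_list_prod _ ?_ a b
  intro X hX
  simp only [List.mem_reverse, List.mem_ofFn] at hX
  obtain ⟨j, rfl⟩ := hX
  exact laxOp_hasDeg j _

theorem twMono_hasDeg (ν : Fin M → ℂ) (κ l : ℂ) (a b : Fin 2) :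
    HasDeg (spinSign b - spinSign a) (twMono η ν κ l a b) := by
  rw [twMono_apply]
  exact (entMono_hasDeg ν l a b).smul _

theorem twTransfer_hasDeg (ν : Fin M → ℂ) (κ l : ℂ) : HasDeg 0 (twTransfer η ν κ l) := by
  rw [twTransfer, Matrix.trace]
  refine HasDeg.sum fun a _ => ?_
  have := twMono_hasDeg (η := η) ν κ l a a
  rwa [sub_self] at this

theorem rowExchange_commute_spinOp (ν : Fin M → ℂ) {i j : Fin M} (hij : i ≠ j) :
    Commute (rowExchange η ν i j) (spinOp M) := by
  refine HasDeg.commute_spinOp ?_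
  intro s t hst
  rw [rowExchange, pairOp] at hst
  split_ifs at hst with hst'
  · have hd : ∀ a b c d : Fin 2, (permMat * entR η (ν j - ν i)) (a, b) (c, d) ≠ 0 →
        spinSign a + spinSign b = spinSign c + spinSign d := by
      intro a b c d
      rw [permMat_mul_apply]
      fin_cases a <;> fin_cases b <;> fin_cases c <;> fin_cases d <;>
        simp [entR, sixVertex, spinSign]
    rw [spinWt, spinWt, ← Finset.sum_sub_distrib, ← Finset.sum_subset (Finset.subset_univ {i, j}),
      Finset.sum_pair hij]
    · linarith [hd _ _ _ _ hst]
    · intro k _ hk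
      simp only [Finset.mem_insert, Finset.mem_singleton, not_or] at hk
      rw [hst' k hk.2 hk.1, sub_self]
  · exact absurd rfl hst

end Grading

/-! ## Continuity and commutativity -/

section Continuity

variable {η : ℂ} {M : ℕ}

theorem continuous_list_prod_ofFn {X R : Type*} [TopologicalSpace X] [TopologicalSpace R]
    [Monoid R] [ContinuousMul R] {n : ℕ} {f : X → Fin n → R} (h : ∀ j, Continuous fun x => f x j) :
    Continuous fun x => (List.ofFn (f x)).reverse.prod := by
  induction n with
  | zero => simpa using continuous_const
  | succ n ih =>
    simp only [List.ofFn_succ, List.reverse_cons, List.prod_append, List.prod_singleton]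
    exact (ih fun j => h j.succ).mul (h 0)

theorem continuous_laxOp (j : Fin M) : Continuous fun u => laxOp η j u := by
  refine continuous_matrix fun a b => continuous_matrix fun s t => ?_
  simp only [laxOp, Matrix.map_apply, siteAlgHom_apply, siteOp, laxMat, entR, sixVertex]
  split_ifs <;> fun_prop

theorem continuous_entMono (l : ℂ) : Continuous fun ν : Fin M → ℂ => entMono η ν l := by
  refine continuous_list_prod_ofFn fun j => (continuous_laxOp j).comp ?_
  fun_prop

theorem continuous_twMono (ν : Fin M → ℂ) (κ : ℂ) : Continuous fun l => twMono η ν κ l := by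
  have h : Continuous fun l => entMono η ν l := by
    refine continuous_list_prod_ofFn fun j => (continuous_laxOp j).comp ?_
    fun_prop
  refine continuous_matrix fun a b => ?_
  simp only [twMono_apply]
  exact (h.matrix_elem a b).const_smul (theta κ a a)

theorem continuous_twTransfer (ν : Fin M → ℂ) (κ : ℂ) :
    Continuous fun l => twTransfer η ν κ l := by
  unfold twTransfer
  exact (continuous_twMono ν κ).matrix_trace

/-- Exceptional parameters are isolated. This is what allows them to be reached by continuity below.
-/
theorem eventually_ne_zero_of_entire {f : ℂ → ℂ} (hf : AnalyticOnNhd ℂ f Set.univ)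
    (hne : ∃ z, f z ≠ 0) (z₀ : ℂ) : ∀ᶠ z in 𝓝[≠] z₀, f z ≠ 0 := by
  rcases (hf z₀ (Set.mem_univ _)).eventually_eq_zero_or_eventually_ne_zero with h | h
  · obtain ⟨z, hz⟩ := hne
    exact absurd (hf.eqOn_zero_of_preconnected_of_eventuallyEq_zero isPreconnected_univ
      (Set.mem_univ z₀) h (Set.mem_univ z)) hz
  · exact h

/-- The `RTT` argument needs an invertible `R`-matrix. It fails only at the zeros of an entire
function of `y`, which is not identically zero because its value at `y = x` is `sin² η`; continuity
covers these zeros. -/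
theorem twTransfer_commute (hη : Complex.sin η ≠ 0) (ν : Fin M → ℂ) (κ x y : ℂ) :
    Commute (twTransfer η ν κ x) (twTransfer η ν κ y) := by
  have hcl : IsClosed {z | Commute (twTransfer η ν κ x) (twTransfer η ν κ z)} :=
    isClosed_eq (continuous_const.matrix_mul (continuous_twTransfer ν κ))
      ((continuous_twTransfer ν κ).matrix_mul continuous_const)
  have hev : ∀ᶠ z in 𝓝[≠] y,
      z ∈ {z | Commute (twTransfer η ν κ x) (twTransfer η ν κ z)} := by
    have h1 := eventually_ne_zero_of_entire (f := fun z => Complex.sin (η + (z - x)) *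
      Complex.sin (η - (z - x))) (fun z _ => by fun_prop) ⟨x, by simpa using hη⟩ y
    filter_upwards [h1] with z hz
    exact (twMono_rtt ν κ x z).commute_trace hz (entR_mul_entR_neg η (z - x))
  exact hcl.mem_of_frequently_of_tendsto hev.frequently (tendsto_id.mono_left nhdsWithin_le_nhds)

/-! ### Holomorphic dependence on the spectral parameter -/

theorem differentiable_list_prod_ofFn {n k : Type*} [Fintype n] [Fintype k] [DecidableEq n]
    [DecidableEq k] {m : ℕ} {f : ℂ → Fin m → Matrix k k (Matrix n n ℂ)}
    (h : ∀ j a b s t, Differentiable ℂ fun l => f l j a b s t) (a b : k) (s t : n) :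
    Differentiable ℂ fun l => (List.ofFn (f l)).reverse.prod a b s t := by
  induction m generalizing a b s t with
  | zero => simp
  | succ m ih =>
    simp only [List.ofFn_succ, List.reverse_cons, List.prod_append, List.prod_singleton,
      Matrix.mul_apply, Matrix.sum_apply]
    exact Differentiable.fun_sum fun _ _ => Differentiable.fun_sum fun _ _ =>
      (ih (fun j => h j.succ) _ _ _ _).mul (h 0 _ _ _ _)

theorem differentiable_entMono (ν : Fin M → ℂ) (a b : Fin 2) (s t : Spins M) :
    Differentiable ℂ fun l => entMono η ν l a b s t := by
  refine differentiable_list_prod_ofFn (fun j a b s t => ?_) a b s t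
  simp only [laxOp, Matrix.map_apply, siteAlgHom_apply, siteOp, laxMat, entR, sixVertex]
  split_ifs <;> fun_prop

theorem differentiable_twMono (ν : Fin M → ℂ) (κ : ℂ) (a b : Fin 2) (s t : Spins M) :
    Differentiable ℂ fun l => twMono η ν κ l a b s t := by
  simp only [twMono_apply, Matrix.smul_apply]
  exact (differentiable_entMono ν a b s t).const_mul (theta κ a a)

theorem differentiable_twTransfer (ν : Fin M → ℂ) (κ : ℂ) (s t : Spins M) :
    Differentiable ℂ fun l => twTransfer η ν κ l s t := by
  simp only [twTransfer, Matrix.trace, Matrix.diag_apply, Matrix.sum_apply]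
  exact Differentiable.fun_sum fun _ _ => differentiable_twMono ν κ _ _ _ _

end Continuity

/-! ## Simple joint eigenvectors of commuting families -/

section JointEigenvectors

variable {n : Type*} [Fintype n] {ι : Type*}

/-- A commuting family has a joint eigenvector in any non-zero invariant subspace. -/
theorem exists_joint_eigenvector {B : ι → Matrix n n ℂ} (hB : ∀ i j, Commute (B i) (B j))
    {U : Submodule ℂ (n → ℂ)} (hU : U ≠ ⊥) (hinv : ∀ i, ∀ v ∈ U, B i *ᵥ v ∈ U) :
    ∃ (χ : ι → ℂ) (v : n → ℂ), v ∈ U ∧ v ≠ 0 ∧ ∀ i, B i *ᵥ v = χ i • v := by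
  -- On a minimal non-zero invariant subspace every member acts as a scalar, because an eigenspace
  -- of one member is invariant under all the others.
  let S : Set (Submodule ℂ (n → ℂ)) := {W | W ≠ ⊥ ∧ W ≤ U ∧ ∀ i, ∀ v ∈ W, B i *ᵥ v ∈ W}
  obtain ⟨W, ⟨hW0, hWU, hWinv⟩, hmin⟩ :=
    wellFounded_lt.has_min S ⟨U, hU, le_rfl, hinv⟩
  have hscal : ∀ i, ∃ c : ℂ, ∀ v ∈ W, B i *ᵥ v = c • v := by
    intro i
    let f : Module.End ℂ W := ((Matrix.mulVecLin (B i)).restrict (hWinv i) : W →ₗ[ℂ] W)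
    have : Nontrivial W := Submodule.nontrivial_iff_ne_bot.2 hW0
    obtain ⟨c, hc⟩ := Module.End.exists_eigenvalue f
    obtain ⟨w, hw⟩ := hc.exists_hasEigenvector
    refine ⟨c, ?_⟩
    let W' : Submodule ℂ (n → ℂ) := W ⊓ LinearMap.ker (Matrix.mulVecLin (B i) - c • LinearMap.id)
    have hmem : ∀ v, v ∈ W' ↔ v ∈ W ∧ B i *ᵥ v = c • v := by
      intro v
      simp [W', sub_eq_zero]
    have hW'S : W' ∈ S := by
      refine ⟨?_, inf_le_left.trans hWU, ?_⟩
      · intro hbot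
        have hw' : (w : n → ℂ) ∈ W' := by
          rw [hmem]
          exact ⟨w.2, congrArg Subtype.val hw.apply_eq_smul⟩
        rw [hbot, Submodule.mem_bot] at hw'
        exact hw.2 (Subtype.ext hw')
      · intro j v hv
        rw [hmem] at hv ⊢
        refine ⟨hWinv j v hv.1, ?_⟩
        rw [Matrix.mulVec_mulVec, (hB i j).eq, ← Matrix.mulVec_mulVec, hv.2, Matrix.mulVec_smul]
    intro v hv
    have : W ≤ W' := by
      by_contra hnot
      exact hmin W' hW'S (lt_of_le_not_ge inf_le_left hnot)
    exact ((hmem v).1 (this hv)).2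
  choose χ hχ using hscal
  obtain ⟨v, hv, hv0⟩ := Submodule.exists_mem_ne_zero_of_ne_bot hW0
  exact ⟨χ, v, hWU hv, hv0, fun i => hχ i v hv⟩

variable [DecidableEq n]

theorem lift_commute {B : ι → Matrix n n ℂ} (hB : ∀ i j, Commute (B i) (B j))
    (p q : FreeAlgebra ℂ ι) : Commute (FreeAlgebra.lift ℂ B p) (FreeAlgebra.lift ℂ B q) := by
  have h1 : ∀ i (q : FreeAlgebra ℂ ι), Commute (B i) (FreeAlgebra.lift ℂ B q) := by
    intro i q
    induction q using FreeAlgebra.induction with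
    | grade0 r => rw [AlgHom.commutes]; exact (Algebra.commutes r _).symm
    | grade1 j => rw [FreeAlgebra.lift_ι_apply]; exact hB i j
    | mul a b ha hb => rw [map_mul]; exact ha.mul_right hb
    | add a b ha hb => rw [map_add]; exact ha.add_right hb
  induction p using FreeAlgebra.induction with
  | grade0 r => rw [AlgHom.commutes]; exact Algebra.commutes r _
  | grade1 j => rw [FreeAlgebra.lift_ι_apply]; exact h1 j q
  | mul a b ha hb => rw [map_mul]; exact ha.mul_left hb
  | add a b ha hb => rw [map_add]; exact ha.add_left hb

theorem lift_mulVec_of_eigen {B : ι → Matrix n n ℂ} {χ : ι → ℂ} {v : n → ℂ}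
    (hv : ∀ i, B i *ᵥ v = χ i • v) (p : FreeAlgebra ℂ ι) :
    FreeAlgebra.lift ℂ B p *ᵥ v = FreeAlgebra.lift ℂ χ p • v := by
  induction p using FreeAlgebra.induction with
  | grade0 r =>
    rw [AlgHom.commutes, AlgHom.commutes, Algebra.algebraMap_eq_smul_one, Matrix.smul_mulVec,
      Matrix.one_mulVec]
    rfl
  | grade1 j => rw [FreeAlgebra.lift_ι_apply, FreeAlgebra.lift_ι_apply]; exact hv j
  | mul a b ha hb =>
    rw [map_mul, map_mul, ← Matrix.mulVec_mulVec, hb, Matrix.mulVec_smul, ha, smul_smul, mul_comm]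
  | add a b ha hb => rw [map_add, map_add, Matrix.add_mulVec, ha, hb, add_smul]

theorem vecMul_lift_of_eigen {B : ι → Matrix n n ℂ} {χ : ι → ℂ} {v : n → ℂ}
    (hv : ∀ i, v ᵥ* B i = χ i • v) (p : FreeAlgebra ℂ ι) :
    v ᵥ* FreeAlgebra.lift ℂ B p = FreeAlgebra.lift ℂ χ p • v := by
  induction p using FreeAlgebra.induction with
  | grade0 r =>
    rw [AlgHom.commutes, AlgHom.commutes, Algebra.algebraMap_eq_smul_one, Matrix.vecMul_smul,
      Matrix.vecMul_one]
    rfl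
  | grade1 j => rw [FreeAlgebra.lift_ι_apply, FreeAlgebra.lift_ι_apply]; exact hv j
  | mul a b ha hb =>
    rw [map_mul, map_mul, ← Matrix.vecMul_vecMul, ha, Matrix.smul_vecMul, hb, smul_smul]
  | add a b ha hb => rw [map_add, map_add, Matrix.vecMul_add, ha, hb, add_smul]

/-- The projector onto a simple joint eigenvector of a commuting family is a polynomial in the
members of the family. -/
theorem exists_lift_eq_projector {B : ι → Matrix n n ℂ} (hB : ∀ i j, Commute (B i) (B j))
    {χ : ι → ℂ} {ket bra : n → ℂ} (hket : ∀ i, B i *ᵥ ket = χ i • ket)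
    (hbra : ∀ i, bra ᵥ* B i = χ i • bra) (hne : bra ⬝ᵥ ket ≠ 0)
    (huniq : ∀ v, (∀ i, B i *ᵥ v = χ i • v) → ∃ c : ℂ, v = c • ket) :
    ∃ p : FreeAlgebra ℂ ι, FreeAlgebra.lift ℂ χ p = 1 ∧
      FreeAlgebra.lift ℂ B p = (bra ⬝ᵥ ket)⁻¹ • Matrix.vecMulVec ket bra := by
  classical
  -- Among all elements on which the character is `1`, one of minimal rank is chosen; minimality
  -- forces rank one. Elements of the free algebra, unlike matrices, can afterwards be evaluated in
  -- another family.
  let r : FreeAlgebra ℂ ι → ℕ := fun p =>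
    Module.finrank ℂ (LinearMap.range (FreeAlgebra.lift ℂ B p).mulVecLin)
  obtain ⟨p, hp, hmin⟩ : ∃ p : FreeAlgebra ℂ ι, FreeAlgebra.lift ℂ χ p = 1 ∧
      ∀ q : FreeAlgebra ℂ ι, FreeAlgebra.lift ℂ χ q = 1 → r p ≤ r q := by
    have hex : ∃ k, ∃ p : FreeAlgebra ℂ ι, FreeAlgebra.lift ℂ χ p = 1 ∧ r p = k :=
      ⟨_, 1, map_one _, rfl⟩
    obtain ⟨p, hp, hpk⟩ := Nat.find_spec hex
    exact ⟨p, hp, fun q hq => hpk ▸ Nat.find_min' hex ⟨q, hq, rfl⟩⟩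
  refine ⟨p, hp, ?_⟩
  have hpket : FreeAlgebra.lift ℂ B p *ᵥ ket = ket := by
    rw [lift_mulVec_of_eigen hket, hp, one_smul]
  have hpbra : bra ᵥ* FreeAlgebra.lift ℂ B p = bra := by
    rw [vecMul_lift_of_eigen hbra, hp, one_smul]
  set a := FreeAlgebra.lift ℂ B p with ha
  let U : Submodule ℂ (n → ℂ) :=
    LinearMap.range a.mulVecLin ⊓ LinearMap.ker (dotProductBilin ℂ ℂ bra)
  -- If the range met the kernel of `bra`, it would contain a joint eigenvector there, and a further
  -- factor could remove that vector without changing the value of the character.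
  have hU : U = ⊥ := by
    by_contra hU
    have hinv : ∀ i, ∀ v ∈ U, B i *ᵥ v ∈ U := by
      rintro i v ⟨⟨w, rfl⟩, hv⟩
      refine ⟨⟨B i *ᵥ w, ?_⟩, ?_⟩
      · have := lift_commute hB p (FreeAlgebra.ι ℂ i)
        rw [FreeAlgebra.lift_ι_apply] at this
        simp only [Matrix.mulVecLin_apply, Matrix.mulVec_mulVec]
        rw [ha, this.eq]
      · have hv' : bra ⬝ᵥ (a *ᵥ w) = 0 := hv
        change bra ⬝ᵥ (B i *ᵥ (a *ᵥ w)) = 0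
        rw [Matrix.dotProduct_mulVec, hbra, smul_dotProduct, hv', smul_zero]
    obtain ⟨χ', u, ⟨hu1, hu2⟩, hu0, hu⟩ := exists_joint_eigenvector hB hU hinv
    have hu2' : bra ⬝ᵥ u = 0 := hu2
    -- Otherwise `u` would be a multiple of `ket`, on which `bra` does not vanish.
    obtain ⟨i, hi⟩ : ∃ i, χ' i ≠ χ i := by
      by_contra! hall
      obtain ⟨c, rfl⟩ := huniq u fun i => by rw [hu, hall]
      rw [dotProduct_smul, smul_eq_mul] at hu2'
      rcases mul_eq_zero.1 hu2' with h0 | h0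
      · exact hu0 (by rw [h0, zero_smul])
      · exact hne h0
    have hi' : χ i - χ' i ≠ 0 := sub_ne_zero.2 hi.symm
    -- This linear factor has character value `1` and annihilates `u`, so it lowers the rank.
    let q₀ : FreeAlgebra ℂ ι :=
      (χ i - χ' i)⁻¹ • (FreeAlgebra.ι ℂ i - algebraMap ℂ (FreeAlgebra ℂ ι) (χ' i))
    have hq : FreeAlgebra.lift ℂ χ (q₀ * p) = 1 := by
      rw [map_mul, hp, mul_one]
      simp only [q₀, map_smul, map_sub, FreeAlgebra.lift_ι_apply, AlgHom.commutes]
      simp [hi']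
    have hlt : r (q₀ * p) < r p := by
      let f := (FreeAlgebra.lift ℂ B q₀).mulVecLin
      have hr : LinearMap.range (FreeAlgebra.lift ℂ B (q₀ * p)).mulVecLin =
          LinearMap.range (f.domRestrict (LinearMap.range a.mulVecLin)) := by
        rw [map_mul, Matrix.mulVecLin_mul, LinearMap.range_comp, LinearMap.range_domRestrict]
      have hfu : f u = 0 := by
        have e : FreeAlgebra.lift ℂ B q₀ = (χ i - χ' i)⁻¹ • (B i - χ' i • 1) := by
          simp only [q₀, map_smul, map_sub, FreeAlgebra.lift_ι_apply, AlgHom.commutes]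
          rw [Algebra.algebraMap_eq_smul_one]
        change FreeAlgebra.lift ℂ B q₀ *ᵥ u = 0
        rw [e, Matrix.smul_mulVec, Matrix.sub_mulVec, Matrix.smul_mulVec, Matrix.one_mulVec, hu,
          sub_self, smul_zero]
      have hker : 0 < Module.finrank ℂ
          (LinearMap.ker (f.domRestrict (LinearMap.range a.mulVecLin))) := by
        refine Nat.pos_of_ne_zero fun h0 => hu0 ?_
        have hmem : (⟨u, hu1⟩ : LinearMap.range a.mulVecLin) ∈
            LinearMap.ker (f.domRestrict (LinearMap.range a.mulVecLin)) := hfu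
        rw [Submodule.finrank_eq_zero.1 h0, Submodule.mem_bot] at hmem
        exact congrArg Subtype.val hmem
      have := LinearMap.finrank_range_add_finrank_ker
        (f.domRestrict (LinearMap.range a.mulVecLin))
      change Module.finrank ℂ (LinearMap.range (FreeAlgebra.lift ℂ B (q₀ * p)).mulVecLin) <
        Module.finrank ℂ (LinearMap.range a.mulVecLin)
      rw [hr]
      omega
    exact absurd (hmin _ hq) (not_le.2 hlt)
  refine Matrix.toLin'.injective (LinearMap.ext fun v => ?_)
  rw [Matrix.toLin'_apply, Matrix.toLin'_apply, Matrix.smul_mulVec, Matrix.vecMulVec_mulVec]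
  -- As `a` fixes `ket` and `bra`, subtracting the component along `ket` leaves a vector of the
  -- range that `bra` annihilates.
  have hw : a *ᵥ v - ((bra ⬝ᵥ ket)⁻¹ * (bra ⬝ᵥ v)) • ket ∈ U := by
    refine ⟨⟨v - ((bra ⬝ᵥ ket)⁻¹ * (bra ⬝ᵥ v)) • ket, ?_⟩, ?_⟩
    · rw [Matrix.mulVecLin_apply, Matrix.mulVec_sub, Matrix.mulVec_smul, hpket]
    · change bra ⬝ᵥ _ = 0
      rw [dotProduct_sub, dotProduct_smul, Matrix.dotProduct_mulVec, hpbra, smul_eq_mul]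
      field_simp
      ring
  rw [hU, Submodule.mem_bot, sub_eq_zero] at hw
  rw [hw, ← smul_smul]
  congr 1
  ext i
  simp [mul_comm]

/-- Uniqueness is assumed for right eigenvectors only. It passes to left ones because the projector
is an element of the algebra with character value `1`, and so fixes `bra'`. -/
theorem eq_smul_of_vecMul_eigen {B : ι → Matrix n n ℂ} (hB : ∀ i j, Commute (B i) (B j))
    {χ : ι → ℂ} {ket bra bra' : n → ℂ} (hket : ∀ i, B i *ᵥ ket = χ i • ket)
    (hbra : ∀ i, bra ᵥ* B i = χ i • bra) (hne : bra ⬝ᵥ ket ≠ 0)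
    (huniq : ∀ v, (∀ i, B i *ᵥ v = χ i • v) → ∃ c : ℂ, v = c • ket)
    (hbra' : ∀ i, bra' ᵥ* B i = χ i • bra') : ∃ c : ℂ, bra' = c • bra := by
  obtain ⟨p, hp, hP⟩ := exists_lift_eq_projector hB hket hbra hne huniq
  have h := vecMul_lift_of_eigen hbra' p
  rw [hp, one_smul, hP, Matrix.vecMul_smul, Matrix.vecMul_vecMulVec, smul_smul] at h
  exact ⟨_, h.symm⟩

/-- An idempotent matrix of trace one is of the form `|k⟩⟨b|`. -/
theorem exists_vecMulVec_of_idempotent {N : Matrix n n ℂ} (hN : N * N = N) (htr : N.trace = 1) :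
    ∃ k b : n → ℂ, N = Matrix.vecMulVec k b ∧ b ⬝ᵥ k = 1 := by
  have hidem : IsIdempotentElem (Matrix.toLin' N) := by
    rw [IsIdempotentElem, Module.End.mul_eq_comp, ← Matrix.toLin'_mul, hN]
  -- The trace of an idempotent is its rank.
  have hfr : Module.finrank ℂ (LinearMap.range (Matrix.toLin' N)) = 1 := by
    have := (LinearMap.IsIdempotentElem.isProj_range _ hidem).trace
    rw [Matrix.trace_toLin'_eq, htr] at this
    exact_mod_cast this.symm
  obtain ⟨⟨k, hk⟩, hk0, hspan⟩ := finrank_eq_one_iff'.1 hfr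
  have hv : ∀ v, ∃ c : ℂ, N *ᵥ v = c • k := by
    intro v
    obtain ⟨c, hc⟩ := hspan ⟨N *ᵥ v, ⟨v, Matrix.toLin'_apply N v⟩⟩
    exact ⟨c, (congrArg Subtype.val hc).symm⟩
  choose c hc using hv
  have hNeq : N = Matrix.vecMulVec k fun j => c (Pi.single j 1) := by
    ext i j
    have := congrFun (hc (Pi.single j 1)) i
    rw [Matrix.mulVec_single_one] at this
    simpa [Matrix.vecMulVec_apply, mul_comm] using this
  refine ⟨k, _, hNeq, ?_⟩
  rw [hNeq, Matrix.trace_vecMulVec, dotProduct_comm] at htr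
  exact htr

/-- If all words in two families have the same trace, a projector of rank one in the first
algebra can be written so that the corresponding element of the second one is a projector. -/
theorem exists_idempotent_lift {B B' : ι → Matrix n n ℂ} {p : FreeAlgebra ℂ ι}
    (hp : FreeAlgebra.lift ℂ B p * FreeAlgebra.lift ℂ B p = FreeAlgebra.lift ℂ B p) :
    ∃ e : Polynomial ℂ, FreeAlgebra.lift ℂ B (Polynomial.aeval p e) = FreeAlgebra.lift ℂ B p ∧
      FreeAlgebra.lift ℂ B' (Polynomial.aeval p e) * FreeAlgebra.lift ℂ B' (Polynomial.aeval p e) =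
        FreeAlgebra.lift ℂ B' (Polynomial.aeval p e) := by
  open Polynomial in
  set N := FreeAlgebra.lift ℂ B' p with hN
  set P := FreeAlgebra.lift ℂ B p with hP
  -- The polynomial `e = a X g` is congruent to `1` modulo `(X - 1)^(k+1)` and to `0` modulo `X g`,
  -- where the minimal polynomial of `N` is `(X - 1)^k g`. Hence `e(N)` is the spectral projector
  -- for the eigenvalue `1`, while the factor `X` gives `e(P) = P` for the idempotent `P`. The
  -- exponent `k + 1` instead of `k` keeps the argument uniform for `k = 0`.
  obtain ⟨g, hg, hndvd⟩ := (minpoly ℂ N).exists_eq_pow_rootMultiplicity_mul_and_not_dvd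
    (minpoly.ne_zero (Matrix.isIntegral N)) 1
  set k := (minpoly ℂ N).rootMultiplicity 1
  have hirr : Irreducible (X - C (1 : ℂ)) := irreducible_X_sub_C 1
  have hX : ¬ (X - C (1 : ℂ)) ∣ X := by
    rw [dvd_iff_isRoot]
    simp
  have hcop : IsCoprime (X * g) ((X - C (1 : ℂ)) ^ (k + 1)) := by
    refine IsCoprime.pow_right (IsCoprime.symm ?_)
    rw [hirr.coprime_iff_not_dvd, hirr.prime.dvd_mul]
    tauto
  obtain ⟨a, b, hab⟩ := hcop
  refine ⟨a * (X * g), ?_, ?_⟩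
  · rw [← aeval_algHom_apply, ← hP]
    have h1 : aeval P (a * (X * g)) + aeval P b * aeval P ((X - C (1 : ℂ)) ^ (k + 1)) = 1 := by
      rw [← map_mul, ← map_add, hab, map_one]
    have h2 : P * aeval P ((X - C (1 : ℂ)) ^ (k + 1)) = 0 := by
      rw [pow_succ', map_mul, ← mul_assoc]
      simp [mul_sub, hp]
    have h3 : P * aeval P (a * (X * g)) = P := by
      have hc : P * aeval P b = aeval P b * P := by
        have : Commute (aeval P X) (aeval P b) := (Commute.all _ _).map (aeval P)
        simpa using this.eq
      have h4 := congrArg (P * ·) h1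
      simp only [mul_add, mul_one] at h4
      rwa [← mul_assoc P (aeval P b), hc, mul_assoc (aeval P b), h2, mul_zero, add_zero] at h4
    have h5 : a * (X * g) = X * (a * g) := by ring
    calc aeval P (a * (X * g)) = P * aeval P (a * (X * g)) := by
          rw [h5, map_mul, aeval_X, ← mul_assoc, hp]
      _ = P := h3
  · rw [← aeval_algHom_apply, ← hN, ← map_mul, ← sub_eq_zero, ← map_sub]
    have : a * (X * g) * (a * (X * g)) - a * (X * g) =
        -(a * X * b * (X - C 1)) * minpoly ℂ N := by
      rw [hg]
      linear_combination (a * (X * g)) * hab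
    rw [this, map_mul, minpoly.aeval, mul_zero]

end JointEigenvectors

/-! ## Eigenstates of the entire transfer matrix -/

/-- A spin-zero eigenstate of the entire transfer matrix with inhomogeneities `ν`, twist `κ`. -/
structure EntState (η : ℂ) {M : ℕ} (ν : Fin M → ℂ) (κ : ℂ) where
  ket : Spins M → ℂ
  bra : Spins M → ℂ
  eig : ℂ → ℂ
  ket_ne_zero : ket ≠ 0
  bra_ne_zero : bra ≠ 0
  ket_eigen : ∀ l, twTransfer η ν κ l *ᵥ ket = eig l • ket
  bra_eigen : ∀ l, bra ᵥ* twTransfer η ν κ l = eig l • bra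
  ket_spin : spinOp M *ᵥ ket = 0
  bra_spin : spinOp M *ᵥ bra = 0

namespace EntState

variable {η : ℂ} {M : ℕ} {ν : Fin M → ℂ} {κ κ' : ℂ}

/-- The eigenvalue function determines the ket, and `⟨Ψ|Ψ⟩ ≠ 0`. -/
def IsSimple (S : EntState η ν κ) : Prop :=
  S.bra ⬝ᵥ S.ket ≠ 0 ∧ ∀ v : Spins M → ℂ, spinOp M *ᵥ v = 0 →
    (∀ l, twTransfer η ν κ l *ᵥ v = S.eig l • v) → ∃ c : ℂ, v = c • S.ket

/-- The projector onto the eigenstate. -/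
def proj (S : EntState η ν κ) : Op M := (S.bra ⬝ᵥ S.ket)⁻¹ • Matrix.vecMulVec S.ket S.bra

theorem proj_mul_self (S : EntState η ν κ) (hS : S.bra ⬝ᵥ S.ket ≠ 0) :
    S.proj * S.proj = S.proj := by
  rw [proj, Matrix.smul_mul, Matrix.mul_smul, Matrix.vecMulVec_mul_vecMulVec,
    Matrix.vecMulVec_smul, smul_smul, smul_smul, mul_assoc, inv_mul_cancel₀ hS, mul_one]

theorem trace_proj_mul (S : EntState η ν κ) (X : Op M) :
    (S.proj * X).trace = (S.bra ⬝ᵥ S.ket)⁻¹ * (S.bra ⬝ᵥ (X *ᵥ S.ket)) := by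
  rw [proj, Matrix.smul_mul, Matrix.vecMulVec_mul, Matrix.trace_smul, Matrix.trace_vecMulVec,
    dotProduct_comm S.ket (S.bra ᵥ* X), ← Matrix.dotProduct_mulVec, smul_eq_mul]

theorem trace_proj (S : EntState η ν κ) (hS : S.bra ⬝ᵥ S.ket ≠ 0) : S.proj.trace = 1 := by
  have := S.trace_proj_mul 1
  rwa [mul_one, Matrix.one_mulVec, inv_mul_cancel₀ hS] at this

/-- With two projectors inserted, a matrix element times the opposite overlap is a trace. This is
the form in which form factors are compared, and the reason why both overlaps have to be non-zero.
-/
theorem trace_proj_mul_proj (S : EntState η ν κ) (S' : EntState η ν κ') (X : Op M) :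
    (S.proj * (X * S'.proj)).trace = (S.bra ⬝ᵥ S.ket)⁻¹ * (S'.bra ⬝ᵥ S'.ket)⁻¹ *
      ((S.bra ⬝ᵥ (X *ᵥ S'.ket)) * (S'.bra ⬝ᵥ S.ket)) := by
  rw [trace_proj_mul, proj, Matrix.mul_smul, Matrix.mul_vecMulVec, Matrix.smul_mulVec,
    Matrix.vecMulVec_mulVec, dotProduct_smul, smul_eq_mul, op_smul_eq_smul, dotProduct_smul,
    smul_eq_mul]
  ring

/-- The commuting family of the transfer matrices and the spin operator. -/
def family (η : ℂ) {M : ℕ} (ν : Fin M → ℂ) (κ : ℂ) : Option ℂ → Op M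
  | none => spinOp M
  | some l => twTransfer η ν κ l

/-- The joint eigenvalue of the members of the family. -/
def character (S : EntState η ν κ) : Option ℂ → ℂ
  | none => 0
  | some l => S.eig l

theorem family_commute (hη : Complex.sin η ≠ 0) (ν : Fin M → ℂ) (κ : ℂ) (i j : Option ℂ) :
    Commute (family η ν κ i) (family η ν κ j) := by
  rcases i with - | x <;> rcases j with - | y
  · exact Commute.refl _
  · exact (twTransfer_hasDeg ν κ y).commute_spinOp.symm
  · exact (twTransfer_hasDeg ν κ x).commute_spinOp
  · exact twTransfer_commute hη ν κ x y

theorem family_mulVec (S : EntState η ν κ) (i : Option ℂ) :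
    family η ν κ i *ᵥ S.ket = S.character i • S.ket := by
  rcases i with - | x
  · rw [character, zero_smul]; exact S.ket_spin
  · exact S.ket_eigen x

theorem vecMul_family (S : EntState η ν κ) (i : Option ℂ) :
    S.bra ᵥ* family η ν κ i = S.character i • S.bra := by
  rcases i with - | x
  · rw [character, zero_smul]; exact (vecMul_spinOp _).trans S.bra_spin
  · exact S.bra_eigen x

theorem IsSimple.unique {S : EntState η ν κ} (hS : S.IsSimple) (v : Spins M → ℂ)
    (hv : ∀ i, family η ν κ i *ᵥ v = S.character i • v) : ∃ c : ℂ, v = c • S.ket :=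
  hS.2 v (by simpa [family, character] using hv none) fun l => hv (some l)

theorem character_congr {S : EntState η ν κ} {S' : EntState η ν κ} (h : S'.eig = S.eig) :
    S'.character = S.character := by
  funext i
  rcases i with - | x
  · rfl
  · exact congrFun h x

theorem IsSimple.exists_smul (hη : Complex.sin η ≠ 0) {S S' : EntState η ν κ} (hS : S.IsSimple)
    (h : S'.eig = S.eig) :
    ∃ c d : ℂ, c ≠ 0 ∧ d ≠ 0 ∧ S'.ket = c • S.ket ∧ S'.bra = d • S.bra := by
  have hk := S'.family_mulVec
  have hb := S'.vecMul_family
  rw [character_congr h] at hk hb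
  obtain ⟨c, hc⟩ := hS.unique S'.ket hk
  obtain ⟨d, hd⟩ := eq_smul_of_vecMul_eigen (family_commute hη ν κ) S.family_mulVec
    S.vecMul_family hS.1 hS.unique hb
  refine ⟨c, d, ?_, ?_, hc, hd⟩
  · rintro rfl; exact S'.ket_ne_zero (by rw [hc, zero_smul])
  · rintro rfl; exact S'.bra_ne_zero (by rw [hd, zero_smul])

end EntState

/-! ## Traces of words in the monodromy matrix elements -/

section Words

variable {η : ℂ} {M : ℕ}

/-- The generators: the matrix elements of the monodromy matrix, and the spin operator. -/
def generator (η : ℂ) {M : ℕ} (ν : Fin M → ℂ) : Option (Fin 2 × Fin 2 × ℂ) → Op M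
  | none => spinOp M
  | some x => entMono η ν x.2.2 x.1 x.2.1

theorem continuous_lift_generator (w : FreeAlgebra ℂ (Option (Fin 2 × Fin 2 × ℂ))) :
    Continuous fun ν : Fin M → ℂ => FreeAlgebra.lift ℂ (generator η ν) w := by
  induction w using FreeAlgebra.induction with
  | grade0 r => simp only [AlgHom.commutes]; exact continuous_const
  | grade1 g =>
    simp only [FreeAlgebra.lift_ι_apply]
    rcases g with - | ⟨a, b, l⟩
    · exact continuous_const
    · exact (continuous_entMono l).matrix_elem a b
  | mul a b ha hb => simp only [map_mul]; exact ha.matrix_mul hb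
  | add a b ha hb => simp only [map_add]; exact ha.add hb

theorem lift_intertwine {n ι : Type*} [Fintype n] [DecidableEq n] {B B' : ι → Matrix n n ℂ}
    {K : Matrix n n ℂ} (h : ∀ i, K * B i = B' i * K) (w : FreeAlgebra ℂ ι) :
    K * FreeAlgebra.lift ℂ B w = FreeAlgebra.lift ℂ B' w * K := by
  induction w using FreeAlgebra.induction with
  | grade0 r => rw [AlgHom.commutes, AlgHom.commutes]; exact (Algebra.commutes r K).symm
  | grade1 g => rw [FreeAlgebra.lift_ι_apply, FreeAlgebra.lift_ι_apply]; exact h g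
  | mul a b ha hb => rw [map_mul, map_mul, ← mul_assoc, ha, mul_assoc, hb, mul_assoc]
  | add a b ha hb => rw [map_add, map_add, mul_add, add_mul, ha, hb]

/-- Where the exchange operator is invertible it conjugates each word at `ν` to the same word at the
swapped inhomogeneities. Where it degenerates the operators need not be conjugate, but their traces
still agree by continuity in `ν j`. For this reason traces are compared throughout, not operators.
-/
theorem trace_lift_swap (hη : Complex.sin η ≠ 0) (ν : Fin M → ℂ) {i j : Fin M}
    (hij : (j : ℕ) = i + 1) (w : FreeAlgebra ℂ (Option (Fin 2 × Fin 2 × ℂ))) :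
    (FreeAlgebra.lift ℂ (generator η (ν ∘ Equiv.swap i j)) w).trace =
      (FreeAlgebra.lift ℂ (generator η ν) w).trace := by
  have hne : i ≠ j := by rintro rfl; omega
  have hcl : IsClosed {ν : Fin M → ℂ | (FreeAlgebra.lift ℂ (generator η (ν ∘ Equiv.swap i j))
      w).trace = (FreeAlgebra.lift ℂ (generator η ν) w).trace} := by
    refine isClosed_eq ?_ (continuous_lift_generator w).matrix_trace
    have h1 : Continuous fun ν : Fin M → ℂ => ν ∘ Equiv.swap i j := by fun_prop
    exact ((continuous_lift_generator w).comp h1).matrix_trace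
  have hev := eventually_ne_zero_of_entire (f := fun z => Complex.sin (η + (z - ν i)) *
      Complex.sin (η - (z - ν i))) (fun z _ => by fun_prop) ⟨ν i, by simpa using hη⟩ (ν j)
  have hlim : Tendsto (fun z => Function.update ν j z) (𝓝[≠] (ν j)) (𝓝 ν) := by
    have h1 : Continuous fun z => Function.update ν j z := continuous_const.update j continuous_id
    have h2 := h1.tendsto (ν j)
    rw [Function.update_eq_self] at h2
    exact h2.mono_left nhdsWithin_le_nhds
  refine hcl.mem_of_frequently_of_tendsto (Eventually.frequently ?_) hlim
  filter_upwards [hev] with z hz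
  set ν' := Function.update ν j z with hν'
  have hz' : z - ν i = ν' j - ν' i := by
    rw [hν', Function.update_self, Function.update_of_ne hne]
  rw [hz'] at hz
  obtain ⟨K, hK⟩ := rowExchange_isUnit ν' hne (left_ne_zero_of_mul hz) (right_ne_zero_of_mul hz)
  have h := lift_intertwine (K := (K : Op M)) (B := generator η ν')
    (B' := generator η (ν' ∘ Equiv.swap i j)) (fun g => by
      rw [hK]
      rcases g with - | ⟨a, b, l⟩
      · exact rowExchange_commute_spinOp ν' hne
      · exact rowExchange_mul_entMono ν' hij l a b) w
  have h' : FreeAlgebra.lift ℂ (generator η (ν' ∘ Equiv.swap i j)) w =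
      K * FreeAlgebra.lift ℂ (generator η ν') w * (K⁻¹ : (Op M)ˣ) := by
    rw [h, Units.mul_inv_cancel_right]
  rw [h', Matrix.trace_units_conj]

theorem trace_lift_perm (hη : Complex.sin η ≠ 0) (ν : Fin M → ℂ) (P : Equiv.Perm (Fin M))
    (w : FreeAlgebra ℂ (Option (Fin 2 × Fin 2 × ℂ))) :
    (FreeAlgebra.lift ℂ (generator η (ν ∘ P)) w).trace =
      (FreeAlgebra.lift ℂ (generator η ν) w).trace := by
  cases M with
  | zero => rw [Subsingleton.elim (ν ∘ P) ν]
  | succ n =>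
    have hP : P ∈ Submonoid.closure
        (Set.range fun i : Fin n => Equiv.swap i.castSucc i.succ) := by
      rw [Equiv.Perm.mclosure_swap_castSucc_succ]
      exact Submonoid.mem_top P
    induction hP using Submonoid.closure_induction generalizing ν with
    | mem x hx =>
      obtain ⟨i, rfl⟩ := hx
      exact trace_lift_swap hη ν (by simp) w
    | one => rfl
    | mul x y _ _ hx hy =>
      rw [Equiv.Perm.coe_mul, ← Function.comp_assoc, hy, hx]

/-- The members of the commuting family as words. -/
def familyWord (κ : ℂ) : Option ℂ → FreeAlgebra ℂ (Option (Fin 2 × Fin 2 × ℂ))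
  | none => FreeAlgebra.ι ℂ none
  | some l => ∑ a, theta κ a a • FreeAlgebra.ι ℂ (some (a, a, l))

theorem lift_generator_familyWord (ν : Fin M → ℂ) (κ : ℂ) (i : Option ℂ) :
    FreeAlgebra.lift ℂ (generator η ν) (familyWord κ i) = EntState.family η ν κ i := by
  rcases i with - | l
  · rw [familyWord, FreeAlgebra.lift_ι_apply]; rfl
  · simp only [familyWord, map_sum, map_smul, FreeAlgebra.lift_ι_apply, generator,
      EntState.family, twTransfer, Matrix.trace, Matrix.diag_apply, twMono_apply]

theorem lift_generator_lift_familyWord (ν : Fin M → ℂ) (κ : ℂ) (p : FreeAlgebra ℂ (Option ℂ)) :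
    FreeAlgebra.lift ℂ (generator η ν) (FreeAlgebra.lift ℂ (familyWord κ) p) =
      FreeAlgebra.lift ℂ (EntState.family η ν κ) p := by
  have : (FreeAlgebra.lift ℂ (generator η ν)).comp (FreeAlgebra.lift ℂ (familyWord κ)) =
      FreeAlgebra.lift ℂ (EntState.family η ν κ) := by
    apply FreeAlgebra.hom_ext
    funext i
    simp [lift_generator_familyWord]
  exact DFunLike.congr_fun this p

/-- The state at the permuted inhomogeneities, together with a word for both projectors. -/
theorem EntState.IsSimple.exists_permuted (hη : Complex.sin η ≠ 0) {ν : Fin M → ℂ} {κ : ℂ}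
    {S : EntState η ν κ} (hS : S.IsSimple) (P : Equiv.Perm (Fin M)) :
    ∃ (S' : EntState η (ν ∘ P) κ) (e : FreeAlgebra ℂ (Option (Fin 2 × Fin 2 × ℂ))),
      S'.IsSimple ∧ S'.eig = S.eig ∧ FreeAlgebra.lift ℂ (generator η ν) e = S.proj ∧
        FreeAlgebra.lift ℂ (generator η (ν ∘ P)) e = S'.proj := by
  obtain ⟨p, hp, hP⟩ := exists_lift_eq_projector (EntState.family_commute hη ν κ) S.family_mulVec
    S.vecMul_family hS.1 hS.unique
  change _ = S.proj at hP
  obtain ⟨e, he, he'⟩ := exists_idempotent_lift (B := EntState.family η ν κ)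
    (B' := EntState.family η (ν ∘ P) κ) (p := p) (by rw [hP, S.proj_mul_self hS.1])
  rw [hP] at he
  set q := Polynomial.aeval p e
  set N := FreeAlgebra.lift ℂ (EntState.family η (ν ∘ P) κ) q with hN
  have htr : ∀ w : FreeAlgebra ℂ (Option ℂ),
      (FreeAlgebra.lift ℂ (EntState.family η (ν ∘ P) κ) w).trace =
        (FreeAlgebra.lift ℂ (EntState.family η ν κ) w).trace := by
    intro w
    rw [← lift_generator_lift_familyWord, ← lift_generator_lift_familyWord,
      trace_lift_perm hη]
  -- The corrected word is idempotent at both parameter sets, and equal traces make its rank one at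
  -- the permuted set too.
  obtain ⟨k, b, hkb, hbk⟩ := exists_vecMulVec_of_idempotent he'
    (by rw [hN, htr, he, S.trace_proj hS.1])
  have hNk : N *ᵥ k = k := by
    rw [hkb, Matrix.vecMulVec_mulVec, hbk, op_smul_eq_smul, one_smul]
  have hbN : b ᵥ* N = b := by
    rw [hkb, Matrix.vecMul_vecMulVec, hbk, one_smul]
  have hk0 : k ≠ 0 := by rintro rfl; simp at hbk
  have hb0 : b ≠ 0 := by rintro rfl; simp at hbk
  -- The eigenvalue is the trace of a word, projector times family member, hence the same at both
  -- parameter sets.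
  have heig : ∀ i, b ⬝ᵥ (EntState.family η (ν ∘ P) κ i *ᵥ k) = S.character i := by
    intro i
    have h1 := htr (q * FreeAlgebra.ι ℂ i)
    rw [map_mul, map_mul, FreeAlgebra.lift_ι_apply, FreeAlgebra.lift_ι_apply, he,
      S.trace_proj_mul, S.family_mulVec, dotProduct_smul, smul_eq_mul, mul_comm (S.character i),
      ← mul_assoc, inv_mul_cancel₀ hS.1, one_mul, ← hN, hkb, Matrix.vecMulVec_mul,
      Matrix.trace_vecMulVec, dotProduct_comm, ← Matrix.dotProduct_mulVec] at h1
    exact h1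
  have hcomm : ∀ i, Commute N (EntState.family η (ν ∘ P) κ i) := by
    intro i
    have := lift_commute (EntState.family_commute hη (ν ∘ P) κ) q (FreeAlgebra.ι ℂ i)
    rwa [FreeAlgebra.lift_ι_apply] at this
  -- A member of the family commutes with `N` and so preserves its one-dimensional range.
  have hket : ∀ i, EntState.family η (ν ∘ P) κ i *ᵥ k = S.character i • k := by
    intro i
    calc EntState.family η (ν ∘ P) κ i *ᵥ k = N *ᵥ (EntState.family η (ν ∘ P) κ i *ᵥ k) := by
          rw [Matrix.mulVec_mulVec, (hcomm i).eq, ← Matrix.mulVec_mulVec, hNk]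
      _ = S.character i • k := by
          rw [hkb, Matrix.vecMulVec_mulVec, heig, op_smul_eq_smul]
  have hbra : ∀ i, b ᵥ* EntState.family η (ν ∘ P) κ i = S.character i • b := by
    intro i
    calc b ᵥ* EntState.family η (ν ∘ P) κ i = (b ᵥ* EntState.family η (ν ∘ P) κ i) ᵥ* N := by
          rw [Matrix.vecMul_vecMul, ← (hcomm i).eq, ← Matrix.vecMul_vecMul, hbN]
      _ = S.character i • b := by
          rw [hkb, Matrix.vecMul_vecMulVec, ← Matrix.dotProduct_mulVec, heig]
  refine ⟨⟨k, b, S.eig, hk0, hb0, fun l => hket (some l), fun l => hbra (some l), ?_, ?_⟩,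
    FreeAlgebra.lift ℂ (familyWord κ) q, ⟨?_, ?_⟩, rfl, ?_, ?_⟩
  · have := hket none
    rwa [EntState.character, zero_smul] at this
  · have := hbra none
    rwa [EntState.character, zero_smul, EntState.family, vecMul_spinOp] at this
  · change b ⬝ᵥ k ≠ 0
    rw [hbk]; exact one_ne_zero
  · intro v hv hv'
    have hfam : ∀ i, EntState.family η (ν ∘ P) κ i *ᵥ v = S.character i • v := by
      intro i
      rcases i with - | l
      · rw [EntState.character, zero_smul]; exact hv
      · exact hv' l
    have h1 := lift_mulVec_of_eigen hfam q
    -- The character value of the corrected word is read off from `S`, where the word is the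
    -- projector. It forces every vector with this character to be fixed by `N`, that is, to be a
    -- multiple of `k`.
    have h2 : FreeAlgebra.lift ℂ S.character q = 1 := by
      have h3 := lift_mulVec_of_eigen S.family_mulVec q
      rw [he, EntState.proj, Matrix.smul_mulVec, Matrix.vecMulVec_mulVec] at h3
      have h4 : S.ket = FreeAlgebra.lift ℂ S.character q • S.ket := by
        rw [← h3, op_smul_eq_smul, smul_smul, inv_mul_cancel₀ hS.1, one_smul]
      obtain ⟨i, hi⟩ := Function.ne_iff.1 S.ket_ne_zero
      have h5 := congrFun h4 i
      rw [Pi.smul_apply, smul_eq_mul] at h5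
      exact (mul_right_cancel₀ hi (by rw [one_mul]; exact h5)).symm
    rw [h2, one_smul, ← hN, hkb, Matrix.vecMulVec_mulVec, op_smul_eq_smul] at h1
    exact ⟨b ⬝ᵥ v, h1.symm⟩
  · rw [lift_generator_lift_familyWord, he]
  · rw [lift_generator_lift_familyWord, ← hN, hkb, EntState.proj]
    simp [hbk]

end Words

/-! ## Form factors of the entire monodromy matrix -/

section EntireFormFactors

variable {η : ℂ} {M : ℕ} {ν : Fin M → ℂ} {κ κ' : ℂ}

/-- The product of monodromy matrix elements in the numerator of a form factor. -/
def monoProd (η : ℂ) {M : ℕ} (ν : Fin M → ℂ) (κ : ℂ) {m : ℕ} (ξ : Fin m → ℂ) (a b : Spins m) :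
    Op M :=
  (List.ofFn fun j => twMono η ν κ (ξ j) (a j) (b j)).prod

/-- The form factors of the entire monodromy matrix. -/
def entFF (SB : EntState η ν κ') (SK : EntState η ν κ) {m : ℕ} (ξ : Fin m → ℂ) : Op m :=
  fun a b => (SB.bra ⬝ᵥ (monoProd η ν κ ξ a b *ᵥ SK.ket)) /
    ((SB.bra ⬝ᵥ SK.ket) * ∏ j, SK.eig (ξ j))

theorem exists_lift_generator_eq_monoProd (κ : ℂ) {m : ℕ} (ξ : Fin m → ℂ) (a b : Spins m) :
    ∃ w : FreeAlgebra ℂ (Option (Fin 2 × Fin 2 × ℂ)), ∀ ν : Fin M → ℂ,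
      FreeAlgebra.lift ℂ (generator η ν) w = monoProd η ν κ ξ a b := by
  refine ⟨(List.ofFn fun j => theta κ (a j) (a j) •
    FreeAlgebra.ι ℂ (some (a j, b j, ξ j) : Option (Fin 2 × Fin 2 × ℂ))).prod, fun ν => ?_⟩
  rw [map_list_prod, List.map_ofFn, monoProd]
  congr 2
  funext j
  simp only [Function.comp, map_smul, FreeAlgebra.lift_ι_apply, generator, twMono_apply]

/-- Matrix elements between states with the same eigenvalues at permuted inhomogeneities. -/
theorem permuted_matrix_element (hη : Complex.sin η ≠ 0) {SB : EntState η ν κ'}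
    {SK : EntState η ν κ} (hB : SB.IsSimple) (hK : SK.IsSimple) (h1 : SB.bra ⬝ᵥ SK.ket ≠ 0)
    (h2 : SK.bra ⬝ᵥ SB.ket ≠ 0) {P : Equiv.Perm (Fin M)} {SB' : EntState η (ν ∘ P) κ'}
    {SK' : EntState η (ν ∘ P) κ} (hB' : SB'.eig = SB.eig) (hK' : SK'.eig = SK.eig) :
    SB'.bra ⬝ᵥ SK'.ket ≠ 0 ∧ ∀ w : FreeAlgebra ℂ (Option (Fin 2 × Fin 2 × ℂ)),
      (SB'.bra ⬝ᵥ (FreeAlgebra.lift ℂ (generator η (ν ∘ P)) w *ᵥ SK'.ket)) /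
          (SB'.bra ⬝ᵥ SK'.ket) =
        (SB.bra ⬝ᵥ (FreeAlgebra.lift ℂ (generator η ν) w *ᵥ SK.ket)) / (SB.bra ⬝ᵥ SK.ket) := by
  obtain ⟨TB, eB, hTB, hTBe, heB, heB'⟩ := hB.exists_permuted hη P
  obtain ⟨TK, eK, hTK, hTKe, heK, heK'⟩ := hK.exists_permuted hη P
  -- States with the prescribed eigenvalues are multiples of the constructed ones, and the multiples
  -- cancel in the ratio.
  obtain ⟨-, d, -, hd, -, hbra⟩ := hTB.exists_smul hη (hB'.trans hTBe.symm)
  obtain ⟨c, -, hc, -, hket, -⟩ := hTK.exists_smul hη (hK'.trans hTKe.symm)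
  have htr : ∀ w : FreeAlgebra ℂ (Option (Fin 2 × Fin 2 × ℂ)),
      (TB.bra ⬝ᵥ TB.ket)⁻¹ * (TK.bra ⬝ᵥ TK.ket)⁻¹ *
        ((TB.bra ⬝ᵥ (FreeAlgebra.lift ℂ (generator η (ν ∘ P)) w *ᵥ TK.ket)) *
          (TK.bra ⬝ᵥ TB.ket)) =
      (SB.bra ⬝ᵥ SB.ket)⁻¹ * (SK.bra ⬝ᵥ SK.ket)⁻¹ *
        ((SB.bra ⬝ᵥ (FreeAlgebra.lift ℂ (generator η ν) w *ᵥ SK.ket)) *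
          (SK.bra ⬝ᵥ SB.ket)) := by
    intro w
    have := trace_lift_perm hη ν P (eB * (w * eK))
    rwa [map_mul, map_mul, map_mul, map_mul, heB, heB', heK, heK',
      EntState.trace_proj_mul_proj, EntState.trace_proj_mul_proj] at this
  -- The empty word compares the normalizations; it shows that the overlaps at the permuted
  -- parameters do not vanish, and it is the identity by which the one for `w` is divided.
  have h0 := htr 1
  rw [map_one, map_one, Matrix.one_mulVec, Matrix.one_mulVec] at h0
  have hne : (SB.bra ⬝ᵥ SB.ket)⁻¹ * (SK.bra ⬝ᵥ SK.ket)⁻¹ *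
      ((SB.bra ⬝ᵥ SK.ket) * (SK.bra ⬝ᵥ SB.ket)) ≠ 0 :=
    mul_ne_zero (mul_ne_zero (inv_ne_zero hB.1) (inv_ne_zero hK.1)) (mul_ne_zero h1 h2)
  have hne' := hne
  rw [← h0] at hne'
  have h3 : TB.bra ⬝ᵥ TK.ket ≠ 0 := left_ne_zero_of_mul (right_ne_zero_of_mul hne')
  have h4 : TK.bra ⬝ᵥ TB.ket ≠ 0 := right_ne_zero_of_mul (right_ne_zero_of_mul hne')
  rw [hbra, hket]
  constructor
  · rw [smul_dotProduct, dotProduct_smul]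
    exact smul_ne_zero hd (smul_ne_zero hc h3)
  · intro w
    have h5 := htr w
    have hcT := left_ne_zero_of_mul hne'
    have hcS := left_ne_zero_of_mul hne
    simp only [Matrix.mulVec_smul, smul_dotProduct, dotProduct_smul, smul_eq_mul]
    generalize (TB.bra ⬝ᵥ TB.ket)⁻¹ * (TK.bra ⬝ᵥ TK.ket)⁻¹ = cT at *
    generalize (SB.bra ⬝ᵥ SB.ket)⁻¹ * (SK.bra ⬝ᵥ SK.ket)⁻¹ = cS at *
    generalize TB.bra ⬝ᵥ (FreeAlgebra.lift ℂ (generator η (ν ∘ P)) w *ᵥ TK.ket) = x at *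
    generalize SB.bra ⬝ᵥ (FreeAlgebra.lift ℂ (generator η ν) w *ᵥ SK.ket) = y at *
    generalize TB.bra ⬝ᵥ TK.ket = p at *
    generalize TK.bra ⬝ᵥ TB.ket = q at *
    generalize SB.bra ⬝ᵥ SK.ket = r at *
    generalize SK.bra ⬝ᵥ SB.ket = t at *
    rw [div_eq_div_iff (mul_ne_zero hc (mul_ne_zero hd h3)) h1]
    have h6 : cT * q * cS * t * (x * r - y * p) = 0 := by
      linear_combination cS * t * r * h5 - cS * t * y * h0
    have h7 : x * r - y * p = 0 := by
      refine (mul_eq_zero.1 h6).resolve_left ?_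
      exact mul_ne_zero (mul_ne_zero (mul_ne_zero hcT h4) hcS) h2
    linear_combination d * c * h7

theorem entFF_permuted (hη : Complex.sin η ≠ 0) {SB : EntState η ν κ'} {SK : EntState η ν κ}
    (hB : SB.IsSimple) (hK : SK.IsSimple) (h1 : SB.bra ⬝ᵥ SK.ket ≠ 0)
    (h2 : SK.bra ⬝ᵥ SB.ket ≠ 0) {P : Equiv.Perm (Fin M)} {SB' : EntState η (ν ∘ P) κ'}
    {SK' : EntState η (ν ∘ P) κ} (hB' : SB'.eig = SB.eig) (hK' : SK'.eig = SK.eig) {m : ℕ}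
    (ξ : Fin m → ℂ) : entFF SB' SK' ξ = entFF SB SK ξ := by
  ext a b
  obtain ⟨w, hw⟩ := exists_lift_generator_eq_monoProd (η := η) (M := M) κ ξ a b
  have := (permuted_matrix_element hη hB hK h1 h2 hB' hK').2 w
  rw [hw, hw] at this
  rw [entFF, entFF, ← div_div, ← div_div, this, hK']

/-! ### Transposition -/

/-- Transposition combined with the reversal of the order of the sites. -/
def revTranspose (X : Op M) : Op M := fun s t => X (t ∘ Fin.rev) (s ∘ Fin.rev)

/-- Reversal of the order of the sites. -/
def revSpins (M : ℕ) : Spins M ≃ Spins M :=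
  (Fin.revPerm : Equiv.Perm (Fin M)).arrowCongr (Equiv.refl (Fin 2))

theorem revSpins_apply (s : Spins M) : revSpins M s = s ∘ Fin.rev := by
  funext j; simp [revSpins, Equiv.arrowCongr]

theorem comp_rev_comp_rev {α : Type*} {m : ℕ} (s : Fin m → α) : (s ∘ Fin.rev) ∘ Fin.rev = s := by
  funext j; simp

theorem revTranspose_mul (X Y : Op M) :
    revTranspose (X * Y) = revTranspose Y * revTranspose X := by
  ext s t
  simp only [revTranspose, Matrix.mul_apply]
  rw [← (revSpins M).sum_comp]
  simp only [revSpins_apply, mul_comm]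

theorem revTranspose_one : revTranspose (1 : Op M) = 1 := by
  ext s t
  rw [revTranspose, Matrix.one_apply, Matrix.one_apply]
  refine if_congr ⟨fun h => ?_, fun h => by rw [h]⟩ rfl rfl
  rw [← comp_rev_comp_rev s, ← comp_rev_comp_rev t, h]

theorem revTranspose_sum {ι : Type*} (S : Finset ι) (X : ι → Op M) :
    revTranspose (∑ i ∈ S, X i) = ∑ i ∈ S, revTranspose (X i) := by
  ext s t
  simp only [revTranspose, Matrix.sum_apply]

theorem revTranspose_smul (c : ℂ) (X : Op M) : revTranspose (c • X) = c • revTranspose X := rfl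

theorem revTranspose_siteOp (j : Fin M) (X : Matrix (Fin 2) (Fin 2) ℂ) :
    revTranspose (siteOp j X) = siteOp j.rev Xᵀ := by
  ext s t
  simp only [revTranspose, siteOp, Matrix.transpose_apply, Function.comp]
  refine if_congr ⟨fun h k hk => ?_, fun h k hk => ?_⟩ rfl rfl
  · have := h k.rev (by rintro rfl; simp at hk)
    simpa using this.symm
  · exact (h k.rev (by simpa using hk)).symm

/-- `revTranspose`, combined with transposition in the auxiliary space. -/
def revTransposeMat (X : Matrix (Fin 2) (Fin 2) (Op M)) : Matrix (Fin 2) (Fin 2) (Op M) :=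
  fun a b => revTranspose (X b a)

theorem reverse_ofFn {α : Type*} {m : ℕ} (f : Fin m → α) :
    (List.ofFn f).reverse = List.ofFn fun j => f j.rev := by
  apply List.ext_getElem
  · simp
  · intro i h1 h2
    simp only [List.getElem_reverse, List.getElem_ofFn, List.length_ofFn]
    congr 1
    ext
    simp only [Fin.val_rev]
    omega

/-- The Lax matrix is symmetric under simultaneous transposition of the auxiliary and the quantum
space. Transposition reverses the order of the factors; reversing the labels of the sites restores
it and moves the reversal to the inhomogeneities. -/
theorem revTranspose_entMono (ν : Fin M → ℂ) (l : ℂ) (a b : Fin 2) :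
    revTranspose (entMono η ν l a b) = entMono η (ν ∘ Fin.rev) l b a := by
  have hprod : ∀ L : List (Matrix (Fin 2) (Fin 2) (Op M)), ∀ a b,
      revTranspose (L.prod a b) = (L.map revTransposeMat).reverse.prod b a := by
    intro L
    induction L with
    | nil =>
      intro a b
      rw [List.prod_nil, List.map_nil, List.reverse_nil, List.prod_nil]
      by_cases hab : a = b
      · rw [hab, Matrix.one_apply_eq, revTranspose_one]
      · rw [Matrix.one_apply_ne hab, Matrix.one_apply_ne (Ne.symm hab)]; rfl
    | cons X L ih =>
      intro a b
      rw [List.prod_cons, Matrix.mul_apply, revTranspose_sum, List.map_cons, List.reverse_cons,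
        List.prod_append, List.prod_singleton, Matrix.mul_apply]
      simp only [revTranspose_mul, ih, revTransposeMat]
  rw [entMono, hprod, entMono, List.map_reverse, List.reverse_reverse, List.map_ofFn,
    reverse_ofFn]
  have h : (revTransposeMat ∘ fun j => laxOp η j (ν j - l)) =
      fun j => laxOp η j.rev ((ν ∘ Fin.rev) j.rev - l) := by
    funext j
    ext1 a b
    simp only [Function.comp, revTransposeMat, laxOp, Matrix.map_apply, siteAlgHom_apply,
      revTranspose_siteOp, Fin.rev_rev]
    congr 1
    ext s t
    simp only [Matrix.transpose_apply, laxMat, entR, sixVertex]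
    fin_cases a <;> fin_cases b <;> fin_cases s <;> fin_cases t <;> simp
  rw [h]

theorem revTranspose_twTransfer (ν : Fin M → ℂ) (κ l : ℂ) :
    revTranspose (twTransfer η ν κ l) = twTransfer η (ν ∘ Fin.rev) κ l := by
  simp only [twTransfer, Matrix.trace, Matrix.diag_apply, twMono_apply, revTranspose_sum,
    revTranspose_smul, revTranspose_entMono]

theorem revTranspose_mulVec (X : Op M) (v : Spins M → ℂ) :
    revTranspose X *ᵥ (fun s => v (s ∘ Fin.rev)) = fun s => (v ᵥ* X) (s ∘ Fin.rev) := by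
  ext s
  simp only [Matrix.mulVec, Matrix.vecMul, dotProduct, revTranspose]
  rw [← (revSpins M).sum_comp]
  simp only [revSpins_apply, comp_rev_comp_rev, mul_comm]

theorem vecMul_revTranspose (X : Op M) (v : Spins M → ℂ) :
    (fun s => v (s ∘ Fin.rev)) ᵥ* revTranspose X = fun s => (X *ᵥ v) (s ∘ Fin.rev) := by
  ext s
  simp only [Matrix.mulVec, Matrix.vecMul, dotProduct, revTranspose]
  rw [← (revSpins M).sum_comp]
  simp only [revSpins_apply, comp_rev_comp_rev, mul_comm]

theorem dotProduct_rev (v w : Spins M → ℂ) :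
    (fun s : Spins M => v (s ∘ Fin.rev)) ⬝ᵥ (fun s => w (s ∘ Fin.rev)) = w ⬝ᵥ v := by
  simp only [dotProduct]
  rw [← (revSpins M).sum_comp]
  simp only [revSpins_apply, comp_rev_comp_rev, mul_comm]

theorem spinWt_comp_rev {m : ℕ} (s : Spins m) : spinWt (s ∘ Fin.rev) = spinWt s := by
  rw [spinWt, spinWt, ← Equiv.sum_comp (Fin.revPerm : Equiv.Perm (Fin m))]
  simp

theorem spinOp_mulVec_rev {v : Spins M → ℂ} (hv : spinOp M *ᵥ v = 0) :
    spinOp M *ᵥ (fun s => v (s ∘ Fin.rev)) = 0 := by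
  rw [spinOp_mulVec_eq_zero] at hv ⊢
  intro s hs
  rw [← spinWt_comp_rev]
  exact hv _ hs

/-- The transposed state, at the inhomogeneities in reversed order. -/
def EntState.transpose (S : EntState η ν κ) : EntState η (ν ∘ Fin.revPerm) κ where
  ket := fun s => S.bra (s ∘ Fin.rev)
  bra := fun s => S.ket (s ∘ Fin.rev)
  eig := S.eig
  ket_ne_zero h := S.bra_ne_zero <| by
    funext s
    have := congrFun h (s ∘ Fin.rev)
    rwa [comp_rev_comp_rev] at this
  bra_ne_zero h := S.ket_ne_zero <| by
    funext s
    have := congrFun h (s ∘ Fin.rev)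
    rwa [comp_rev_comp_rev] at this
  ket_eigen l := by
    change twTransfer η (ν ∘ Fin.rev) κ l *ᵥ _ = _
    rw [← revTranspose_twTransfer, revTranspose_mulVec, S.bra_eigen]
    rfl
  bra_eigen l := by
    change _ ᵥ* twTransfer η (ν ∘ Fin.rev) κ l = _
    rw [← revTranspose_twTransfer, vecMul_revTranspose, S.ket_eigen]
    rfl
  ket_spin := spinOp_mulVec_rev S.bra_spin
  bra_spin := spinOp_mulVec_rev S.ket_spin

/-- The twist multiplies row indices. Transposition exchanges rows and columns, so the old twist
leaves a factor in `a` while any new twist `κ'` can be attached to `b` and divided out again. -/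
theorem revTranspose_monoProd {m : ℕ} (ξ : Fin m → ℂ) (a b : Spins m) :
    revTranspose (monoProd η ν κ ξ a b) = (∏ j, theta κ (a j) (a j) / theta κ' (b j) (b j)) •
      monoProd η (ν ∘ Fin.rev) κ' (ξ ∘ Fin.rev) (b ∘ Fin.rev) (a ∘ Fin.rev) := by
  have hθ : ∀ (κ : ℂ) (c : Fin 2), theta κ c c ≠ 0 := by
    intro κ c
    fin_cases c <;> simp [theta]
  have key : ∀ {m : ℕ} (ξ : Fin m → ℂ) (a b : Spins m),
      revTranspose (List.ofFn fun j => twMono η ν κ (ξ j) (a j) (b j)).prod =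
      (∏ j, theta κ (a j) (a j) / theta κ' (b j) (b j)) •
        (List.ofFn fun j => twMono η (ν ∘ Fin.rev) κ' (ξ j) (b j) (a j)).reverse.prod := by
    intro m ξ a b
    induction m with
    | zero => simp [revTranspose_one]
    | succ m ih =>
      rw [List.ofFn_succ, List.ofFn_succ, List.prod_cons, List.reverse_cons, List.prod_append,
        List.prod_singleton, revTranspose_mul, ih, Fin.prod_univ_succ, twMono_apply, twMono_apply,
        revTranspose_smul, revTranspose_entMono, Matrix.smul_mul, Matrix.mul_smul,
        Matrix.mul_smul, smul_smul, smul_smul]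
      congr 1
      field_simp [hθ]
  rw [monoProd, key, monoProd, reverse_ofFn]
  rfl

theorem theta_apply_eq_exp (κ : ℂ) (c : Fin 2) :
    theta κ c c = Complex.exp (κ / 2 * (spinSign c : ℂ)) := by
  fin_cases c
  · simp [theta, spinSign]
  · simp [theta, spinSign]
    ring_nf

theorem prod_theta_eq_exp {m : ℕ} (κ : ℂ) (a : Spins m) :
    ∏ j, theta κ (a j) (a j) = Complex.exp (κ / 2 * (spinWt a : ℂ)) := by
  simp only [theta_apply_eq_exp, ← Complex.exp_sum, ← Finset.mul_sum, spinWt, Int.cast_sum]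

/-- Form factors conserve the total spin of the auxiliary spaces. -/
theorem spinWt_eq_of_matrix_element_ne_zero (SB : EntState η ν κ') (SK : EntState η ν κ) {m : ℕ}
    (ξ : Fin m → ℂ) (a b : Spins m)
    (hne : SB.bra ⬝ᵥ (monoProd η ν κ ξ a b *ᵥ SK.ket) ≠ 0) : spinWt a = spinWt b := by
  have hdeg : ∀ {m : ℕ} (ξ : Fin m → ℂ) (a b : Spins m),
      HasDeg (spinWt b - spinWt a) (monoProd η ν κ ξ a b) := by
    intro m ξ a b
    induction m with
    | zero => simpa [monoProd, spinWt] using HasDeg.one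
    | succ m ih =>
      have h1 := (twMono_hasDeg (η := η) ν κ (ξ 0) (a 0) (b 0)).mul
        (ih (fun j => ξ j.succ) (fun j => a j.succ) fun j => b j.succ)
      rw [monoProd, List.ofFn_succ, List.prod_cons]
      have h2 : spinWt b - spinWt a = spinSign (b 0) - spinSign (a 0) +
          (spinWt (fun j => b j.succ) - spinWt fun j => a j.succ) := by
        simp only [spinWt, Fin.sum_univ_succ]
        ring
      rw [h2]
      exact h1
  have := (hdeg ξ a b).dotProduct_mulVec SB.bra_spin SK.ket_spin hne
  omega

/-- Transposition exchanges bra and ket at the cost of reversed inhomogeneities, and permutation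
invariance reverses them back. Spin conservation turns the remaining twist factors into a function
of `spinWt b` alone. -/
theorem entFF_transpose (hη : Complex.sin η ≠ 0) {SB : EntState η ν κ'} {SK : EntState η ν κ}
    (hB : SB.IsSimple) (hK : SK.IsSimple) (h1 : SB.bra ⬝ᵥ SK.ket ≠ 0)
    (h2 : SK.bra ⬝ᵥ SB.ket ≠ 0) {m : ℕ} (ξ : Fin m → ℂ) (hξ : ∀ j, SB.eig (ξ j) ≠ 0)
    (a b : Spins m) :
    entFF SB SK ξ a b = (∏ j, (SK.eig (ξ j) / SB.eig (ξ j))⁻¹) *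
      (Complex.exp ((κ - κ') / 2 * (spinWt b : ℂ)) *
        entFF SK SB (ξ ∘ Fin.rev) (b ∘ Fin.rev) (a ∘ Fin.rev)) := by
  have hperm := entFF_permuted hη hK hB h2 h1 (P := Fin.revPerm) (SB' := SK.transpose)
    (SK' := SB.transpose) rfl rfl (ξ ∘ Fin.rev)
  rw [← hperm]
  have hnum : SB.bra ⬝ᵥ (monoProd η ν κ ξ a b *ᵥ SK.ket) =
      (∏ j, theta κ (a j) (a j) / theta κ' (b j) (b j)) *
        (SK.transpose.bra ⬝ᵥ (monoProd η (ν ∘ Fin.revPerm) κ' (ξ ∘ Fin.rev) (b ∘ Fin.rev)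
          (a ∘ Fin.rev) *ᵥ SB.transpose.ket)) := by
    rw [← smul_eq_mul, ← dotProduct_smul, ← Matrix.smul_mulVec]
    have := revTranspose_monoProd (η := η) (ν := ν) (κ := κ) (κ' := κ') ξ a b
    change _ = _ • monoProd η (ν ∘ Fin.revPerm) κ' _ _ _ at this
    rw [← this]
    change _ = (fun s => SK.ket (s ∘ Fin.rev)) ⬝ᵥ (_ *ᵥ fun s => SB.bra (s ∘ Fin.rev))
    rw [revTranspose_mulVec, dotProduct_rev, Matrix.dotProduct_mulVec]
  have hov : SK.transpose.bra ⬝ᵥ SB.transpose.ket = SB.bra ⬝ᵥ SK.ket := dotProduct_rev _ _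
  -- A vanishing matrix element makes both sides zero; otherwise `a` and `b` have the same weight.
  by_cases hne : SB.bra ⬝ᵥ (monoProd η ν κ ξ a b *ᵥ SK.ket) = 0
  · rw [hnum, mul_eq_zero, Finset.prod_div_distrib, prod_theta_eq_exp, prod_theta_eq_exp,
      ← Complex.exp_sub, or_iff_right (Complex.exp_ne_zero _)] at hne
    rw [entFF, hnum, entFF, hne]
    simp
  · have hwt := spinWt_eq_of_matrix_element_ne_zero SB SK ξ a b hne
    rw [entFF, hnum, entFF, hov, Finset.prod_div_distrib, prod_theta_eq_exp, prod_theta_eq_exp,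
      hwt, ← Complex.exp_sub]
    have e1 : ∏ j, SB.transpose.eig ((ξ ∘ Fin.rev) j) = ∏ j, SB.eig (ξ j) :=
      Equiv.prod_comp (Fin.revPerm : Equiv.Perm (Fin m)) fun j => SB.eig (ξ j)
    have e2 : ∏ j, SB.eig (ξ j) ≠ 0 := Finset.prod_ne_zero_iff.2 fun j _ => hξ j
    rw [e1, Finset.prod_inv_distrib, Finset.prod_div_distrib, inv_div,
      show (κ - κ') / 2 * (spinWt b : ℂ) = κ / 2 * spinWt b - κ' / 2 * spinWt b by ring]
    field_simp

end EntireFormFactors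

/-! ## Tensor products of one-site operators -/

section TensorOp

variable {n : ℕ}

/-- `A_1 ⊗ ⋯ ⊗ A_n`. -/
def tensorOp (A : Fin n → Matrix (Fin 2) (Fin 2) ℂ) : Op n := fun s t => ∏ j, A j (s j) (t j)

theorem tensorOp_mul (A B : Fin n → Matrix (Fin 2) (Fin 2) ℂ) :
    tensorOp (A * B) = tensorOp A * tensorOp B := by
  ext s t
  simp only [tensorOp, Matrix.mul_apply, Pi.mul_apply, Finset.prod_univ_sum,
    Fintype.piFinset_univ, ← Finset.prod_mul_distrib]

theorem siteOp_eq_tensorOp (i : Fin n) (X : Matrix (Fin 2) (Fin 2) ℂ) :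
    siteOp i X = tensorOp (Pi.mulSingle i X) := by
  ext s t
  rw [siteOp, tensorOp, ← Finset.mul_prod_erase _ _ (Finset.mem_univ i), Pi.mulSingle_eq_same]
  have h : ∀ j ∈ Finset.univ.erase i, (Pi.mulSingle i X : Fin n → Matrix (Fin 2) (Fin 2) ℂ) j
      (s j) (t j) = if s j = t j then 1 else 0 := by
    intro j hj
    rw [Pi.mulSingle_eq_of_ne (Finset.ne_of_mem_erase hj), Matrix.one_apply]
  rw [Finset.prod_congr rfl h, Finset.prod_ite_zero]
  simp

theorem tensorOp_one : tensorOp (1 : Fin n → Matrix (Fin 2) (Fin 2) ℂ) = 1 := by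
  ext s t
  simp only [tensorOp, Pi.one_apply, Matrix.one_apply]
  rw [Finset.prod_ite_zero]
  simp [funext_iff]

end TensorOp

/-! ## Blocks with respect to the auxiliary space -/

section Blocks

variable {n : ℕ}

/-- An operator on the factors `0, …, n` as a matrix in the factor `0`. -/
def blockMat (X : Op (n + 1)) : Matrix (Fin 2) (Fin 2) (Op n) := fun a b => block X a b

theorem blockMat_mul (X Y : Op (n + 1)) : blockMat (X * Y) = blockMat X * blockMat Y := by
  ext a b s t
  rw [Matrix.mul_apply, Matrix.sum_apply]
  simp only [blockMat, block, Matrix.mul_apply, sum_cons]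

theorem blockMat_one : blockMat (1 : Op (n + 1)) = 1 := by
  ext a b s t
  simp only [blockMat, block, Matrix.one_apply, Fin.cons_inj]
  by_cases hab : a = b <;> by_cases hst : s = t <;> simp [hab, hst, Matrix.one_apply]

theorem blockMat_list_prod (L : List (Op (n + 1))) :
    blockMat L.prod = (L.map blockMat).prod := by
  induction L with
  | nil => simpa using blockMat_one
  | cons X L ih => rw [List.prod_cons, blockMat_mul, ih, List.map_cons, List.prod_cons]

theorem blockMat_siteOp_zero (A : Matrix (Fin 2) (Fin 2) ℂ) :
    blockMat (siteOp (n := n + 1) 0 A) = A.map (algebraMap ℂ (Op n)) := by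
  ext a b s t
  simp only [blockMat, block, siteOp, Matrix.map_apply, Matrix.algebraMap_matrix_apply,
    Fin.forall_fin_succ, Fin.cons_zero, Fin.cons_succ]
  simp [funext_iff]

theorem blockMat_pairOp_zero_succ (j : Fin n) (R : Op2) :
    blockMat (pairOp 0 j.succ R) = fun a b => siteOp j fun s t => R (a, s) (b, t) := by
  ext a b s t
  simp only [blockMat, block, pairOp, siteOp, Fin.forall_fin_succ, Fin.cons_zero, Fin.cons_succ]
  simp

theorem blockMat_pairOp_succ_zero (j : Fin n) (R : Op2) :
    blockMat (pairOp j.succ 0 R) = fun a b => siteOp j fun s t => R (s, a) (t, b) := by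
  ext a b s t
  simp only [blockMat, block, pairOp, siteOp, Fin.forall_fin_succ, Fin.cons_zero, Fin.cons_succ]
  simp

theorem traceFirst_eq_trace (X : Op (n + 1)) : traceFirst X = (blockMat X).trace := by
  ext s t
  simp only [traceFirst, Matrix.trace, Matrix.diag_apply, Matrix.sum_apply, blockMat, block]

end Blocks

/-! ## Reduction of the staggered model to the entire monodromy matrix -/

section Reduction

variable {γ : ℂ} {T : ℝ} {M : ℕ} {σ : Fin M → ℤˣ} {ν : Fin M → ℂ} {h h' : ℝ}

/-- The local gauge transformation that turns `R^{(-1)}` into `R`. -/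
def gauge (s : ℤˣ) : Matrix (Fin 2) (Fin 2) ℂ := if s = 1 then 1 else sigmaY

theorem sigmaY_mul_self : sigmaY * sigmaY = 1 := by
  ext a b
  fin_cases a <;> fin_cases b <;> simp [sigmaY, Matrix.mul_apply]

theorem gauge_mul_self (s : ℤˣ) : gauge s * gauge s = 1 := by
  unfold gauge
  split_ifs
  · exact one_mul 1
  · exact sigmaY_mul_self

/-- The global gauge transformation. -/
def gaugeOp (σ : Fin M → ℤˣ) : Op M := tensorOp fun j => gauge (σ j)

theorem gaugeOp_mul_self (σ : Fin M → ℤˣ) : gaugeOp σ * gaugeOp σ = 1 := by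
  rw [gaugeOp, ← tensorOp_mul, ← tensorOp_one]
  congr 1
  funext j
  exact gauge_mul_self (σ j)

theorem gaugeOp_conj_siteOp (σ : Fin M → ℤˣ) (j : Fin M) (X : Matrix (Fin 2) (Fin 2) ℂ) :
    gaugeOp σ * siteOp j X * gaugeOp σ = siteOp j (gauge (σ j) * X * gauge (σ j)) := by
  rw [siteOp_eq_tensorOp, siteOp_eq_tensorOp, gaugeOp, ← tensorOp_mul, ← tensorOp_mul]
  congr 1
  funext k
  by_cases hk : k = j
  · subst hk; simp
  · simp [Pi.mulSingle_eq_of_ne hk, gauge_mul_self]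

/-- The inhomogeneities of the equivalent unstaggered model. -/
def entInhom (γ : ℂ) (σ : Fin M → ℤˣ) (ν : Fin M → ℂ) : Fin M → ℂ :=
  fun j => if σ j = 1 then ν j else ν j - Complex.I * γ

/-- The common denominator of the monodromy matrix. -/
def denom (γ : ℂ) (σ : Fin M → ℤˣ) (ν : Fin M → ℂ) (l : ℂ) : ℂ :=
  ∏ j, Complex.sin (ν j - l + Complex.I * ((σ j : ℤ) : ℂ) * γ)

theorem denom_ne_zero_iff {l : ℂ} : denom γ σ ν l ≠ 0 ↔ RegularAt γ σ ν l := by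
  simp [denom, RegularAt, Finset.prod_ne_zero_iff]

theorem denom_analytic : AnalyticOnNhd ℂ (denom γ σ ν) Set.univ := by
  intro z _
  unfold denom
  fun_prop

theorem eventually_regularAt (l : ℂ) : ∀ᶠ z in 𝓝[≠] l, RegularAt γ σ ν z := by
  refine eventually_all.2 fun j => ?_
  refine eventually_ne_zero_of_entire
    (f := fun z => Complex.sin (ν j - z + Complex.I * ((σ j : ℤ) : ℂ) * γ))
    (fun z _ => by fun_prop) ⟨ν j + Complex.I * ((σ j : ℤ) : ℂ) * γ - Real.pi / 2, ?_⟩ l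
  have : ν j - (ν j + Complex.I * ((σ j : ℤ) : ℂ) * γ - Real.pi / 2) +
      Complex.I * ((σ j : ℤ) : ℂ) * γ = (Real.pi / 2 : ℂ) := by ring
  rw [this, Complex.sin_pi_div_two]
  exact one_ne_zero

/-- Crossing symmetry of the six-vertex model. For `s = -1` the minus sign it produces is absorbed
by the denominator, since `sin (l - w + iγ) = -sin (w - l - iγ)`. -/
theorem blockMat_RStag (s : ℤˣ) (j : Fin M) (l w : ℂ)
    (hs : Complex.sin (w - l + Complex.I * ((s : ℤ) : ℂ) * γ) ≠ 0) :
    blockMat (RStag γ s j l w) =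
      (Complex.sin (w - l + Complex.I * ((s : ℤ) : ℂ) * γ))⁻¹ • fun a b =>
        siteOp j (gauge s * laxMat (Complex.I * γ)
          ((if s = 1 then w else w - Complex.I * γ) - l) a b * gauge s) := by
  rcases Int.units_eq_one_or s with rfl | rfl
  · simp only [Units.val_one, Int.cast_one, mul_one] at hs
    simp only [RStag, if_true, gauge, one_mul, mul_one, Units.val_one, Int.cast_one]
    rw [blockMat_pairOp_zero_succ, RMat_eq_smul_entR γ l w hs]
    refine Matrix.ext fun a b => ?_
    exact map_smul (siteAlgHom j) (Complex.sin (w - l + Complex.I * γ))⁻¹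
      (laxMat (Complex.I * γ) (w - l) a b)
  · have hne : ¬ ((-1 : ℤˣ) = 1) := by decide
    simp only [Units.val_neg, Units.val_one, Int.cast_neg, Int.cast_one, mul_neg, mul_one,
      neg_mul] at hs ⊢
    have hs' : Complex.sin (l - w + Complex.I * γ) ≠ 0 := by
      rw [← neg_ne_zero, ← Complex.sin_neg]
      convert hs using 2
      ring
    simp only [RStag, if_neg hne, gauge]
    rw [blockMat_pairOp_succ_zero, RMat_eq_smul_entR γ w l hs']
    have hinv : (Complex.sin (l - w + Complex.I * γ))⁻¹ =
        -(Complex.sin (w - l + -(Complex.I * γ)))⁻¹ := by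
      rw [← inv_neg, ← Complex.sin_neg]
      congr 2
      ring
    rw [hinv]
    have key : ∀ a b : Fin 2, (fun s t => transposeFirst
        (-(Complex.sin (w - l + -(Complex.I * γ)))⁻¹ • entR (Complex.I * γ) (l - w)) (s, a)
          (t, b) : Matrix (Fin 2) (Fin 2) ℂ) =
        (Complex.sin (w - l + -(Complex.I * γ)))⁻¹ •
          (sigmaY * laxMat (Complex.I * γ) (w - Complex.I * γ - l) a b * sigmaY) := by
      intro a b
      have e1 : Complex.sin (w - Complex.I * γ - l + Complex.I * γ) = -Complex.sin (l - w) := by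
        rw [← Complex.sin_neg]; congr 1; ring
      have e2 : Complex.sin (w - Complex.I * γ - l) = -Complex.sin (l - w + Complex.I * γ) := by
        rw [← Complex.sin_neg]; congr 1; ring
      ext s t
      simp only [transposeFirst, laxMat, entR, sixVertex, Matrix.smul_apply, smul_eq_mul,
        Matrix.mul_apply, Fin.sum_univ_two, e1, e2]
      fin_cases a <;> fin_cases b <;> fin_cases s <;> fin_cases t <;> simp [sigmaY] <;>
        first
          | ring1
          | linear_combination (Complex.sin (w - l + -(Complex.I * γ)))⁻¹ *
              Complex.sin (Complex.I * γ) * Complex.I_mul_I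
          | linear_combination -(Complex.sin (w - l + -(Complex.I * γ)))⁻¹ *
              Complex.sin (Complex.I * γ) * Complex.I_mul_I
          | linear_combination (Complex.sin (w - l + -(Complex.I * γ)))⁻¹ *
              Complex.sin (l - w + Complex.I * γ) * Complex.I_mul_I
          | linear_combination -(Complex.sin (w - l + -(Complex.I * γ)))⁻¹ *
              Complex.sin (l - w + Complex.I * γ) * Complex.I_mul_I
          | linear_combination (Complex.sin (w - l + -(Complex.I * γ)))⁻¹ *
              Complex.sin (l - w) * Complex.I_mul_I
          | linear_combination -(Complex.sin (w - l + -(Complex.I * γ)))⁻¹ *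
              Complex.sin (l - w) * Complex.I_mul_I
    refine Matrix.ext fun a b => ?_
    exact (congrArg (siteOp j) (key a b)).trans (map_smul (siteAlgHom j)
      (Complex.sin (w - l + -(Complex.I * γ)))⁻¹
      (sigmaY * laxMat (Complex.I * γ) (w - Complex.I * γ - l) a b * sigmaY))

theorem prod_reverse_ofFn_smul {A : Type*} [Ring A] [Algebra ℂ A] {m : ℕ} (c : Fin m → ℂ)
    (X : Fin m → A) : (List.ofFn fun j => c j • X j).reverse.prod =
      (∏ j, c j) • (List.ofFn X).reverse.prod := by
  induction m with
  | zero => simp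
  | succ m ih =>
    rw [List.ofFn_succ, List.ofFn_succ, List.reverse_cons, List.reverse_cons, List.prod_append,
      List.prod_append, ih, List.prod_singleton, List.prod_singleton, Fin.prod_univ_succ,
      smul_mul_smul_comm, mul_comm (c 0)]

theorem block_monodromy {l : ℂ} (hl : RegularAt γ σ ν l) (a b : Fin 2) :
    block (monodromy γ T σ ν h l) a b = (denom γ σ ν l)⁻¹ • (gaugeOp σ *
      twMono (Complex.I * γ) (entInhom γ σ ν) ((h / T : ℝ) : ℂ) l a b * gaugeOp σ) := by
  -- The gauge acts trivially in the auxiliary space and squares to one, so the conjugations of the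
  -- single factors telescope.
  set G : Matrix (Fin 2) (Fin 2) (Op M) := Matrix.diagonal fun _ => gaugeOp σ with hG
  have hGG : G * G = 1 := by
    rw [hG, Matrix.diagonal_mul_diagonal, gaugeOp_mul_self]; exact Matrix.diagonal_one
  have hlist : blockMat (List.ofFn fun j : Fin M => RStag γ (σ j) j l (ν j)).reverse.prod =
      (denom γ σ ν l)⁻¹ • (G * entMono (Complex.I * γ) (entInhom γ σ ν) l * G) := by
    rw [blockMat_list_prod, List.map_reverse, List.map_ofFn]
    have e : (blockMat ∘ fun j : Fin M => RStag γ (σ j) j l (ν j)) = fun j =>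
        (Complex.sin (ν j - l + Complex.I * ((σ j : ℤ) : ℂ) * γ))⁻¹ •
          (G * laxOp (Complex.I * γ) j (entInhom γ σ ν j - l) * G) := by
      funext j
      rw [Function.comp, blockMat_RStag _ _ _ _ (hl j)]
      congr 1
      refine Matrix.ext fun a b => ?_
      rw [hG, Matrix.mul_diagonal, Matrix.diagonal_mul]
      exact (gaugeOp_conj_siteOp σ j _).symm
    rw [e, prod_reverse_ofFn_smul, Finset.prod_inv_distrib]
    congr 1
    have h1 := prod_ofFn_reverse_intertwine (K := G)
      (f := fun j => laxOp (Complex.I * γ) j (entInhom γ σ ν j - l))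
      (g := fun j => G * laxOp (Complex.I * γ) j (entInhom γ σ ν j - l) * G)
      (fun k => by rw [mul_assoc _ G G, hGG, mul_one])
    rw [entMono, h1, mul_assoc, hGG, mul_one]
  change blockMat (monodromy γ T σ ν h l) a b = _
  rw [monodromy, blockMat_mul, hlist, blockMat_siteOp_zero, map_algebraMap_mul_apply,
    Finset.sum_eq_single a]
  · rw [Matrix.smul_apply, hG, Matrix.mul_diagonal, Matrix.diagonal_mul, twMono_apply,
      Matrix.mul_smul, Matrix.smul_mul, smul_comm]
  · intro c _ hc
    rw [theta_apply, if_neg hc.symm, zero_smul]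
  · simp

theorem transfer_eq {l : ℂ} (hl : RegularAt γ σ ν l) :
    transfer γ T σ ν h l = (denom γ σ ν l)⁻¹ • (gaugeOp σ *
      twTransfer (Complex.I * γ) (entInhom γ σ ν) ((h / T : ℝ) : ℂ) l * gaugeOp σ) := by
  rw [transfer, traceFirst_eq_trace, twTransfer, Matrix.trace, Matrix.trace]
  simp only [Matrix.diag_apply, Finset.mul_sum, Finset.sum_mul, Finset.smul_sum]
  exact Finset.sum_congr rfl fun a _ => block_monodromy hl a a

/-! ### The pseudo-spin under the gauge transformation -/

theorem spinOp_eq_sum : spinOp M = ∑ j, siteOp j sigmaZ := by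
  ext s t
  rw [Matrix.sum_apply, spinOp, Matrix.diagonal_apply]
  by_cases hst : s = t
  · subst hst
    rw [if_pos rfl, spinWt, Int.cast_sum]
    refine Finset.sum_congr rfl fun j _ => ?_
    rw [siteOp, if_pos fun _ _ => rfl]
    generalize s j = c
    fin_cases c <;> simp [spinSign, sigmaZ]
  · rw [if_neg hst]
    refine (Finset.sum_eq_zero fun j _ => ?_).symm
    rw [siteOp]
    split_ifs with hj
    · have hne : s j ≠ t j := fun h' => hst (funext fun k =>
        if hk : k = j then hk ▸ h' else hj k hk)
      generalize s j = c at hne ⊢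
      generalize t j = d at hne ⊢
      fin_cases c <;> fin_cases d <;> simp_all [sigmaZ]
    · rfl

/-- Conjugation by `σ^y` changes the sign of `σ^z` precisely at the sites with `σ j = -1`, which
absorbs the signs of the staggering. -/
theorem pseudoSpin_eq : pseudoSpin σ = (1 / 2 : ℂ) • (gaugeOp σ * spinOp M * gaugeOp σ) := by
  rw [spinOp_eq_sum, Finset.mul_sum, Finset.sum_mul, Finset.smul_sum, pseudoSpin]
  refine Finset.sum_congr rfl fun j _ => ?_
  rw [gaugeOp_conj_siteOp]
  rcases Int.units_eq_one_or (σ j) with hj | hj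
  · simp [hj, gauge]
  · have hne : ¬ ((-1 : ℤˣ) = 1) := by decide
    have e : sigmaY * sigmaZ * sigmaY = (-1 : ℂ) • sigmaZ := by
      ext a b
      fin_cases a <;> fin_cases b <;> simp [sigmaY, sigmaZ, Matrix.mul_apply]
    rw [hj, gauge, if_neg hne, e]
    have : siteOp j ((-1 : ℂ) • sigmaZ) = (-1 : ℂ) • siteOp j sigmaZ :=
      map_smul (siteAlgHom j) _ _
    rw [this, smul_smul]
    congr 1
    simp
    ring

theorem gaugeOp_mulVec_mulVec (σ : Fin M → ℤˣ) (v : Spins M → ℂ) :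
    gaugeOp σ *ᵥ (gaugeOp σ *ᵥ v) = v := by
  rw [Matrix.mulVec_mulVec, gaugeOp_mul_self, Matrix.one_mulVec]

theorem vecMul_gaugeOp_vecMul (σ : Fin M → ℤˣ) (v : Spins M → ℂ) :
    (v ᵥ* gaugeOp σ) ᵥ* gaugeOp σ = v := by
  rw [Matrix.vecMul_vecMul, gaugeOp_mul_self, Matrix.vecMul_one]

theorem pseudoSpin_mulVec_eq_zero {v : Spins M → ℂ} :
    pseudoSpin σ *ᵥ v = 0 ↔ spinOp M *ᵥ (gaugeOp σ *ᵥ v) = 0 := by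
  rw [pseudoSpin_eq, Matrix.smul_mulVec, smul_eq_zero, or_iff_right (by norm_num),
    ← Matrix.mulVec_mulVec, ← Matrix.mulVec_mulVec]
  constructor
  · intro h0
    rw [← gaugeOp_mulVec_mulVec σ (spinOp M *ᵥ _), h0, Matrix.mulVec_zero]
  · intro h0
    rw [h0, Matrix.mulVec_zero]

theorem vecMul_pseudoSpin_eq_zero {v : Spins M → ℂ} :
    v ᵥ* pseudoSpin σ = 0 ↔ spinOp M *ᵥ (v ᵥ* gaugeOp σ) = 0 := by
  rw [pseudoSpin_eq, Matrix.vecMul_smul, smul_eq_zero, or_iff_right (by norm_num),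
    ← Matrix.vecMul_vecMul, ← Matrix.vecMul_vecMul, ← vecMul_spinOp]
  constructor
  · intro h0
    rw [← vecMul_gaugeOp_vecMul σ (_ ᵥ* spinOp M), h0, Matrix.zero_vecMul]
  · intro h0
    rw [h0, Matrix.zero_vecMul]

theorem twTransfer_eq {l : ℂ} (hl : RegularAt γ σ ν l) :
    twTransfer (Complex.I * γ) (entInhom γ σ ν) ((h / T : ℝ) : ℂ) l =
      denom γ σ ν l • (gaugeOp σ * transfer γ T σ ν h l * gaugeOp σ) := by
  rw [transfer_eq hl, Matrix.mul_smul, Matrix.smul_mul, smul_smul,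
    mul_inv_cancel₀ (denom_ne_zero_iff.2 hl), one_smul, mul_assoc, mul_assoc, gaugeOp_mul_self,
    mul_one, ← mul_assoc, gaugeOp_mul_self, one_mul]

theorem transfer_mulVec_iff {l : ℂ} (hl : RegularAt γ σ ν l) (v : Spins M → ℂ) (c : ℂ) :
    transfer γ T σ ν h l *ᵥ v = c • v ↔
      twTransfer (Complex.I * γ) (entInhom γ σ ν) ((h / T : ℝ) : ℂ) l *ᵥ (gaugeOp σ *ᵥ v) =
        (denom γ σ ν l * c) • (gaugeOp σ *ᵥ v) := by
  have hd := denom_ne_zero_iff.2 hl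
  rw [twTransfer_eq hl, Matrix.smul_mulVec, ← Matrix.mulVec_mulVec, gaugeOp_mulVec_mulVec,
    ← Matrix.mulVec_mulVec, ← smul_smul]
  constructor
  · intro h0; rw [h0, Matrix.mulVec_smul]
  · intro h0
    have h1 := smul_right_injective (Spins M → ℂ) hd h0
    rw [← gaugeOp_mulVec_mulVec σ (transfer γ T σ ν h l *ᵥ v), h1, Matrix.mulVec_smul,
      gaugeOp_mulVec_mulVec]

theorem vecMul_transfer_iff {l : ℂ} (hl : RegularAt γ σ ν l) (v : Spins M → ℂ) (c : ℂ) :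
    v ᵥ* transfer γ T σ ν h l = c • v ↔
      (v ᵥ* gaugeOp σ) ᵥ* twTransfer (Complex.I * γ) (entInhom γ σ ν) ((h / T : ℝ) : ℂ) l =
        (denom γ σ ν l * c) • (v ᵥ* gaugeOp σ) := by
  have hd := denom_ne_zero_iff.2 hl
  rw [twTransfer_eq hl, Matrix.vecMul_smul, ← Matrix.vecMul_vecMul, ← Matrix.vecMul_vecMul,
    vecMul_gaugeOp_vecMul, ← smul_smul]
  constructor
  · intro h0; rw [h0, Matrix.smul_vecMul]
  · intro h0
    have h1 := smul_right_injective (Spins M → ℂ) hd h0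
    rw [← vecMul_gaugeOp_vecMul σ (v ᵥ* transfer γ T σ ν h l), h1, Matrix.smul_vecMul,
      vecMul_gaugeOp_vecMul]

/-! ### Correspondence between eigenstates of the staggered and the entire transfer matrix -/

theorem continuous_twTransfer_mulVec {η : ℂ} (μ : Fin M → ℂ) (κ : ℂ) (v : Spins M → ℂ) :
    Continuous fun l => twTransfer η μ κ l *ᵥ v :=
  (continuous_twTransfer μ κ).matrix_mulVec continuous_const

theorem eq_of_eq_on_regularAt {X : Type*} [TopologicalSpace X] [T2Space X] {f g : ℂ → X}
    (hf : Continuous f) (hg : Continuous g) (hfg : ∀ l, RegularAt γ σ ν l → f l = g l) : f = g := by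
  funext l
  refine (isClosed_eq hf hg).mem_of_frequently_of_tendsto (Eventually.frequently ?_)
    (tendsto_id.mono_left (nhdsWithin_le_nhds : 𝓝[≠] l ≤ 𝓝 l))
  filter_upwards [eventually_regularAt (γ := γ) (σ := σ) (ν := ν) l] with z hz
  exact hfg z hz

/-- The eigenvalue is read off from a non-vanishing component of the ket. This expression is
continuous in `l` everywhere, so the eigenvalue equations extend from the regular points, which are
dense, to the poles, where `S.eigenvalue` carries no information. -/
theorem exists_entire_eigenvalue (S : Eigenstate γ T σ ν h) :
    ∃ e : ℂ → ℂ, (∀ l, RegularAt γ σ ν l → e l = denom γ σ ν l * S.eigenvalue l) ∧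
      ∀ l, twTransfer (Complex.I * γ) (entInhom γ σ ν) ((h / T : ℝ) : ℂ) l *ᵥ
        (gaugeOp σ *ᵥ S.ket) = e l • (gaugeOp σ *ᵥ S.ket) ∧
      (S.bra ᵥ* gaugeOp σ) ᵥ* twTransfer (Complex.I * γ) (entInhom γ σ ν) ((h / T : ℝ) : ℂ) l =
        e l • (S.bra ᵥ* gaugeOp σ) := by
  have hk0 : gaugeOp σ *ᵥ S.ket ≠ 0 := fun h0 => S.ket_ne_zero <| by
    rw [← gaugeOp_mulVec_mulVec σ S.ket, h0, Matrix.mulVec_zero]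
  obtain ⟨s, hs⟩ := Function.ne_iff.1 hk0
  set k := gaugeOp σ *ᵥ S.ket
  set b := S.bra ᵥ* gaugeOp σ
  set t := fun l => twTransfer (Complex.I * γ) (entInhom γ σ ν) ((h / T : ℝ) : ℂ) l
  have hreg : ∀ l, RegularAt γ σ ν l →
      (t l *ᵥ k) s / k s = denom γ σ ν l * S.eigenvalue l := by
    intro l hl
    have := congrFun ((transfer_mulVec_iff hl _ _).1 (S.ket_eigen l hl)) s
    rw [Pi.smul_apply, smul_eq_mul] at this
    rw [div_eq_iff hs]
    exact this
  have hcont : Continuous fun l => (t l *ᵥ k) s / k s :=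
    ((continuous_apply s).comp (continuous_twTransfer_mulVec _ _ k)).div_const _
  refine ⟨fun l => (t l *ᵥ k) s / k s, hreg, fun l => ⟨?_, ?_⟩⟩
  · refine congrFun (eq_of_eq_on_regularAt (γ := γ) (σ := σ) (ν := ν)
      (f := fun l => t l *ᵥ k) (g := fun l => ((t l *ᵥ k) s / k s) • k)
      (continuous_twTransfer_mulVec _ _ k) (hcont.smul continuous_const) fun l hl => ?_) l
    simp only [hreg l hl]
    exact (transfer_mulVec_iff hl _ _).1 (S.ket_eigen l hl)
  · refine congrFun (eq_of_eq_on_regularAt (γ := γ) (σ := σ) (ν := ν)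
      (f := fun l => b ᵥ* t l) (g := fun l => ((t l *ᵥ k) s / k s) • b)
      (continuous_const.matrix_vecMul (continuous_twTransfer _ _))
      (hcont.smul continuous_const) fun l hl => ?_) l
    simp only [hreg l hl]
    exact (vecMul_transfer_iff hl _ _).1 (S.bra_eigen l hl)

/-- The eigenstate of the entire transfer matrix that belongs to an eigenstate. -/
def Eigenstate.toEnt (S : Eigenstate γ T σ ν h) :
    EntState (Complex.I * γ) (entInhom γ σ ν) ((h / T : ℝ) : ℂ) where
  ket := gaugeOp σ *ᵥ S.ket
  bra := S.bra ᵥ* gaugeOp σ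
  eig := (exists_entire_eigenvalue S).choose
  ket_ne_zero h0 := S.ket_ne_zero <| by
    rw [← gaugeOp_mulVec_mulVec σ S.ket, h0, Matrix.mulVec_zero]
  bra_ne_zero h0 := S.bra_ne_zero <| by
    rw [← vecMul_gaugeOp_vecMul σ S.bra, h0, Matrix.zero_vecMul]
  ket_eigen l := ((exists_entire_eigenvalue S).choose_spec.2 l).1
  bra_eigen l := ((exists_entire_eigenvalue S).choose_spec.2 l).2
  ket_spin := pseudoSpin_mulVec_eq_zero.1 S.ket_spin
  bra_spin := vecMul_pseudoSpin_eq_zero.1 S.bra_spin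

theorem Eigenstate.toEnt_eig (S : Eigenstate γ T σ ν h) {l : ℂ} (hl : RegularAt γ σ ν l) :
    S.toEnt.eig l = denom γ σ ν l * S.eigenvalue l :=
  (exists_entire_eigenvalue S).choose_spec.1 l hl

/-- The eigenstate that belongs to an eigenstate of the entire transfer matrix. -/
def EntState.toEigenstate (E : EntState (Complex.I * γ) (entInhom γ σ ν) ((h / T : ℝ) : ℂ)) :
    Eigenstate γ T σ ν h where
  ket := gaugeOp σ *ᵥ E.ket
  bra := E.bra ᵥ* gaugeOp σ
  eigenvalue l := E.eig l / denom γ σ ν l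
  ket_ne_zero h0 := E.ket_ne_zero <| by
    rw [← gaugeOp_mulVec_mulVec σ E.ket, h0, Matrix.mulVec_zero]
  bra_ne_zero h0 := E.bra_ne_zero <| by
    rw [← vecMul_gaugeOp_vecMul σ E.bra, h0, Matrix.zero_vecMul]
  ket_eigen l hl := by
    rw [transfer_mulVec_iff hl, gaugeOp_mulVec_mulVec, mul_div_cancel₀ _ (denom_ne_zero_iff.2 hl)]
    exact E.ket_eigen l
  bra_eigen l hl := by
    rw [vecMul_transfer_iff hl, vecMul_gaugeOp_vecMul, mul_div_cancel₀ _ (denom_ne_zero_iff.2 hl)]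
    exact E.bra_eigen l
  ket_spin := by
    rw [pseudoSpin_mulVec_eq_zero, gaugeOp_mulVec_mulVec]
    exact E.ket_spin
  bra_spin := by
    rw [vecMul_pseudoSpin_eq_zero, vecMul_gaugeOp_vecMul]
    exact E.bra_spin

theorem EntState.eig_differentiable {η : ℂ} {μ : Fin M → ℂ} {κ : ℂ} (E : EntState η μ κ) :
    Differentiable ℂ E.eig := by
  obtain ⟨s, hs⟩ := Function.ne_iff.1 E.ket_ne_zero
  have : E.eig = fun l => (∑ t, twTransfer η μ κ l s t * E.ket t) / E.ket s := by
    funext l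
    rw [eq_div_iff hs]
    exact (congrFun (E.ket_eigen l) s).symm
  rw [this]
  exact Differentiable.div_const (Differentiable.fun_sum fun t _ =>
    (differentiable_twTransfer μ κ s t).mul_const _) _

theorem EntState.eig_eq_of_eq_on_regularAt {η : ℂ} {μ μ' : Fin M → ℂ} {κ κ' : ℂ}
    {E : EntState η μ κ} {E' : EntState η μ' κ'}
    (hE : ∀ l, RegularAt γ σ ν l → E'.eig l = E.eig l) : E'.eig = E.eig :=
  eq_of_eq_on_regularAt E'.eig_differentiable.continuous E.eig_differentiable.continuous hE

theorem dotProduct_gaugeOp (b k : Spins M → ℂ) :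
    (b ᵥ* gaugeOp σ) ⬝ᵥ (gaugeOp σ *ᵥ k) = b ⬝ᵥ k := by
  rw [← Matrix.dotProduct_mulVec, gaugeOp_mulVec_mulVec]

theorem Eigenstate.isSimple_toEnt {S : Eigenstate γ T σ ν h} :
    S.toEnt.IsSimple ↔ S.IsSimple := by
  have hov : S.toEnt.bra ⬝ᵥ S.toEnt.ket = S.bra ⬝ᵥ S.ket := dotProduct_gaugeOp _ _
  rw [EntState.IsSimple, Eigenstate.IsSimple, hov]
  refine and_congr_right fun _ => ⟨fun H v hv hv' => ?_, fun H v hv hv' => ?_⟩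
  · have h1 : (fun l => twTransfer (Complex.I * γ) (entInhom γ σ ν) ((h / T : ℝ) : ℂ) l *ᵥ
        (gaugeOp σ *ᵥ v)) = fun l => S.toEnt.eig l • (gaugeOp σ *ᵥ v) := by
      refine eq_of_eq_on_regularAt (γ := γ) (σ := σ) (ν := ν)
        (continuous_twTransfer_mulVec _ _ _)
        (S.toEnt.eig_differentiable.continuous.smul continuous_const) fun l hl => ?_
      rw [S.toEnt_eig hl]
      exact (transfer_mulVec_iff hl _ _).1 (hv' l hl)
    obtain ⟨c, hc⟩ := H _ (pseudoSpin_mulVec_eq_zero.1 hv) fun l => congrFun h1 l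
    refine ⟨c, ?_⟩
    rw [← gaugeOp_mulVec_mulVec σ v, hc, Matrix.mulVec_smul]
    exact congrArg _ (gaugeOp_mulVec_mulVec σ S.ket)
  · obtain ⟨c, hc⟩ := H (gaugeOp σ *ᵥ v)
      (by rwa [pseudoSpin_mulVec_eq_zero, gaugeOp_mulVec_mulVec]) fun l hl => by
        rw [transfer_mulVec_iff hl, gaugeOp_mulVec_mulVec, ← S.toEnt_eig hl]
        exact hv' l
    refine ⟨c, ?_⟩
    rw [← gaugeOp_mulVec_mulVec σ v, hc, Matrix.mulVec_smul]
    rfl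

theorem EntState.toEnt_toEigenstate_eig
    (E : EntState (Complex.I * γ) (entInhom γ σ ν) ((h / T : ℝ) : ℂ)) :
    (E.toEigenstate (γ := γ) (T := T) (σ := σ) (ν := ν) (h := h)).toEnt.eig = E.eig :=
  eig_eq_of_eq_on_regularAt (γ := γ) (σ := σ) (ν := ν) fun l hl => by
    rw [Eigenstate.toEnt_eig _ hl]
    exact mul_div_cancel₀ _ (denom_ne_zero_iff.2 hl)

theorem EntState.isSimple_toEigenstate
    {E : EntState (Complex.I * γ) (entInhom γ σ ν) ((h / T : ℝ) : ℂ)} (hE : E.IsSimple) :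
    (E.toEigenstate (γ := γ) (T := T) (σ := σ) (ν := ν) (h := h)).IsSimple := by
  rw [← Eigenstate.isSimple_toEnt]
  have hk : (E.toEigenstate (γ := γ) (T := T) (σ := σ) (ν := ν) (h := h)).toEnt.ket = E.ket :=
    gaugeOp_mulVec_mulVec σ E.ket
  have hb : (E.toEigenstate (γ := γ) (T := T) (σ := σ) (ν := ν) (h := h)).toEnt.bra = E.bra :=
    vecMul_gaugeOp_vecMul σ E.bra
  rw [EntState.IsSimple, hk, hb, E.toEnt_toEigenstate_eig]
  exact hE

/-- Inner gauge factors cancel in pairs and the outer ones are absorbed into bra and ket. The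
denominators of the monodromy matrices cancel against those of the eigenvalues. -/
theorem ffMatrix_eq (SB : Eigenstate γ T σ ν h') (SK : Eigenstate γ T σ ν h) {m : ℕ}
    (ξ : Fin m → ℂ) (hξ : ∀ j, RegularAt γ σ ν (ξ j)) :
    ffMatrix γ T σ ν h SB.bra SK.ket SK.eigenvalue ξ = entFF SB.toEnt SK.toEnt ξ := by
  ext a b
  have hprod : ∀ {m : ℕ} (ξ : Fin m → ℂ) (a b : Spins m), (∀ j, RegularAt γ σ ν (ξ j)) →
      (List.ofFn fun j => block (monodromy γ T σ ν h (ξ j)) (a j) (b j)).prod =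
        (∏ j, denom γ σ ν (ξ j))⁻¹ • (gaugeOp σ * monoProd (Complex.I * γ) (entInhom γ σ ν)
          ((h / T : ℝ) : ℂ) ξ a b * gaugeOp σ) := by
    intro m ξ a b hξ
    induction m with
    | zero => simp [monoProd, gaugeOp_mul_self]
    | succ m ih =>
      rw [List.ofFn_succ, List.prod_cons, ih (fun j => ξ j.succ) (fun j => a j.succ)
        (fun j => b j.succ) fun j => hξ j.succ, block_monodromy (hξ 0), smul_mul_smul_comm,
        Fin.prod_univ_succ, mul_inv]
      congr 1
      rw [monoProd, monoProd, List.ofFn_succ, List.prod_cons]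
      simp only [mul_assoc]
      rw [← mul_assoc (gaugeOp σ) (gaugeOp σ), gaugeOp_mul_self, one_mul]
  have hov : SB.toEnt.bra ⬝ᵥ SK.toEnt.ket = SB.bra ⬝ᵥ SK.ket := dotProduct_gaugeOp _ _
  have heig : ∏ j, SK.toEnt.eig (ξ j) =
      (∏ j, denom γ σ ν (ξ j)) * ∏ j, SK.eigenvalue (ξ j) := by
    rw [← Finset.prod_mul_distrib]
    exact Finset.prod_congr rfl fun j _ => SK.toEnt_eig (hξ j)
  have hd : ∏ j, denom γ σ ν (ξ j) ≠ 0 :=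
    Finset.prod_ne_zero_iff.2 fun j _ => denom_ne_zero_iff.2 (hξ j)
  rw [ffMatrix, entFF, hprod ξ a b hξ, hov, heig, Matrix.smul_mulVec, dotProduct_smul,
    smul_eq_mul, ← Matrix.mulVec_mulVec, ← Matrix.mulVec_mulVec, Matrix.dotProduct_mulVec SB.bra]
  change _ * (SB.toEnt.bra ⬝ᵥ (_ *ᵥ SK.toEnt.ket)) / _ = _
  field_simp

end Reduction

/-! ## Relations for the form factors of the entire monodromy matrix -/

section EntireRelations

variable {η : ℂ} {M : ℕ} {ν : Fin M → ℂ} {κ κ' : ℂ}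

/-- Matrix elements as linear functionals. -/
def matElem (v w : Spins M → ℂ) : Op M →ₗ[ℂ] ℂ where
  toFun X := v ⬝ᵥ (X *ᵥ w)
  map_add' X Y := by rw [Matrix.add_mulVec, dotProduct_add]
  map_smul' c X := by rw [Matrix.smul_mulVec, dotProduct_smul, RingHom.id_apply]

theorem matElem_apply (v w : Spins M → ℂ) (X : Op M) : matElem v w X = v ⬝ᵥ (X *ᵥ w) := rfl

theorem entFF_apply (SB : EntState η ν κ') (SK : EntState η ν κ) {m : ℕ} (ξ : Fin m → ℂ)
    (a b : Spins m) : entFF SB SK ξ a b = matElem SB.bra SK.ket (monoProd η ν κ ξ a b) /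
      ((SB.bra ⬝ᵥ SK.ket) * ∏ j, SK.eig (ξ j)) := rfl

theorem monoProd_cons {m : ℕ} (ξ : Fin (m + 1) → ℂ) (a b : Spins (m + 1)) :
    monoProd η ν κ ξ a b = twMono η ν κ (ξ 0) (a 0) (b 0) *
      monoProd η ν κ (Fin.tail ξ) (Fin.tail a) (Fin.tail b) := by
  rw [monoProd, List.ofFn_succ, List.prod_cons]
  rfl

theorem monoProd_snoc {m : ℕ} (ξ : Fin (m + 1) → ℂ) (a b : Spins (m + 1)) :
    monoProd η ν κ ξ a b = monoProd η ν κ (Fin.init ξ) (Fin.init a) (Fin.init b) *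
      twMono η ν κ (ξ (Fin.last m)) (a (Fin.last m)) (b (Fin.last m)) := by
  rw [monoProd, List.ofFn_succ', List.concat_eq_append, List.prod_append, List.prod_singleton]
  rfl

theorem entFF_zero (SB : EntState η ν κ') (SK : EntState η ν κ) (hov : SB.bra ⬝ᵥ SK.ket ≠ 0)
    (ξ : Fin 0 → ℂ) : entFF SB SK ξ = 1 := by
  ext a b
  rw [Subsingleton.elim b a, Matrix.one_apply_eq, entFF, monoProd, List.ofFn_zero, List.prod_nil,
    Matrix.one_mulVec, Fin.prod_univ_zero, mul_one, div_self hov]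

theorem twTransfer_eq_sum (ν : Fin M → ℂ) (κ l : ℂ) :
    twTransfer η ν κ l = ∑ c, twMono η ν κ l c c := rfl

/-- Tracing the last space produces a transfer matrix right next to the ket, which is its
eigenvector. -/
theorem traceLast_entFF (SB : EntState η ν κ') (SK : EntState η ν κ) {m : ℕ}
    (ξ : Fin (m + 1) → ℂ) (hξ : SK.eig (ξ (Fin.last m)) ≠ 0) :
    traceLast (entFF SB SK ξ) = entFF SB SK (Fin.init ξ) := by
  ext s t
  simp only [traceLast, entFF_apply, monoProd_snoc, Fin.init_snoc, Fin.snoc_last]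
  rw [← Finset.sum_div, ← map_sum, ← Finset.mul_sum, ← twTransfer_eq_sum, matElem_apply,
    ← Matrix.mulVec_mulVec, SK.ket_eigen, Matrix.mulVec_smul, dotProduct_smul, smul_eq_mul,
    Fin.prod_univ_castSucc, matElem_apply, mul_comm (∏ _, _), mul_left_comm,
    mul_div_mul_left _ _ hξ]
  rfl

theorem trace_eq_trace_traceLast {m : ℕ} (X : Op (m + 1)) : X.trace = (traceLast X).trace := by
  simp only [Matrix.trace, Matrix.diag_apply, traceLast]
  rw [← (Fin.snocEquiv fun _ : Fin (m + 1) => Fin 2).sum_comp, Fintype.sum_prod_type,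
    Finset.sum_comm]
  rfl

theorem trace_entFF (SB : EntState η ν κ') (SK : EntState η ν κ) (hov : SB.bra ⬝ᵥ SK.ket ≠ 0)
    {m : ℕ} (ξ : Fin m → ℂ) (hξ : ∀ j, SK.eig (ξ j) ≠ 0) : (entFF SB SK ξ).trace = 1 := by
  induction m with
  | zero => rw [entFF_zero SB SK hov]; simp
  | succ m ih =>
    rw [trace_eq_trace_traceLast, traceLast_entFF SB SK ξ (hξ _)]
    exact ih _ fun j => hξ j.castSucc

theorem theta_eq_diagonal (κ : ℂ) :
    theta κ = Matrix.diagonal fun c => Complex.exp (κ / 2 * (spinSign c : ℂ)) := by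
  ext a b
  rw [theta_apply, Matrix.diagonal_apply, theta_apply_eq_exp]

theorem siteOp_diagonal {n : ℕ} (i : Fin n) (d : Fin 2 → ℂ) :
    siteOp i (Matrix.diagonal d) = Matrix.diagonal fun s => d (s i) := by
  ext s t
  rw [siteOp, Matrix.diagonal_apply, Matrix.diagonal_apply]
  by_cases hst : s = t
  · subst hst; simp
  · rw [if_neg hst]
    split_ifs with h1 h2
    · exact absurd (funext fun k => if hk : k = i then hk ▸ h2 else h1 k hk) hst
    · rfl
    · rfl

theorem theta_mul_theta_apply (κ κ' : ℂ) (c : Fin 2) :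
    theta κ c c * theta κ' c c = theta (κ + κ') c c := by
  rw [theta_apply_eq_exp, theta_apply_eq_exp, theta_apply_eq_exp, ← Complex.exp_add]
  congr 1
  ring

/-- The monodromy matrices carry the twist `κ` of the ket. The additional factor changes the first
one into that with twist `κ'`, whose trace has the bra as a left eigenvector. -/
theorem traceFirst_entFF (SB : EntState η ν κ') (SK : EntState η ν κ) {m : ℕ}
    (ξ : Fin (m + 1) → ℂ) :
    traceFirst (siteOp 0 (theta (κ' - κ)) * entFF SB SK ξ) =
      (SB.eig (ξ 0) / SK.eig (ξ 0)) • entFF SB SK (Fin.tail ξ) := by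
  ext s t
  have htw : ∀ c, theta (κ' - κ) c c • twMono η ν κ (ξ 0) c c = twMono η ν κ' (ξ 0) c c := by
    intro c
    rw [twMono_apply, twMono_apply, smul_smul, theta_mul_theta_apply, sub_add_cancel]
  have hdiag : siteOp (0 : Fin (m + 1)) (theta (κ' - κ)) =
      Matrix.diagonal fun s => theta (κ' - κ) (s 0) (s 0) := by
    conv_lhs => rw [theta_eq_diagonal]
    rw [siteOp_diagonal]
    simp only [theta_apply_eq_exp]
  rw [hdiag, Matrix.smul_apply]
  simp only [traceFirst, Matrix.diagonal_mul, entFF_apply, monoProd_cons, Fin.cons_zero,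
    Fin.tail_cons, ← mul_div_assoc]
  rw [← Finset.sum_div]
  simp only [← smul_eq_mul (a := theta _ _ _), ← map_smul, ← Matrix.smul_mul, htw]
  rw [← map_sum, ← Finset.sum_mul, ← twTransfer_eq_sum, matElem_apply, ← Matrix.mulVec_mulVec,
    Matrix.dotProduct_mulVec, SB.bra_eigen, smul_dotProduct, Fin.prod_univ_succ, smul_eq_mul,
    smul_eq_mul, ← matElem_apply, mul_left_comm, div_mul_div_comm]
  rfl

theorem tensorPow_theta (m : ℕ) (κ : ℂ) :
    tensorPow m (theta κ) = Matrix.diagonal fun s => Complex.exp (κ / 2 * (spinWt s : ℂ)) := by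
  ext s t
  rw [tensorPow, Matrix.diagonal_apply, ← prod_theta_eq_exp]
  split_ifs with h
  · rw [h]
  · obtain ⟨j, hj⟩ := Function.ne_iff.1 h
    exact Finset.prod_eq_zero (Finset.mem_univ j) (by rw [theta_apply, if_neg hj])

theorem entFF_commute_tensorPow (SB : EntState η ν κ') (SK : EntState η ν κ) {m : ℕ}
    (ξ : Fin m → ℂ) (x : ℂ) : Commute (entFF SB SK ξ) (tensorPow m (theta x)) := by
  rw [tensorPow_theta]
  ext s t
  rw [Matrix.mul_diagonal, Matrix.diagonal_mul]
  by_cases hne : SB.bra ⬝ᵥ (monoProd η ν κ ξ s t *ᵥ SK.ket) = 0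
  · rw [entFF, hne, zero_div, zero_mul, mul_zero]
  · rw [spinWt_eq_of_matrix_element_ne_zero SB SK ξ s t hne, mul_comm]

/-! ### Linear functionals applied to identities between matrices with operator entries -/

section Functional

variable {A : Type*} [Ring A] [Algebra ℂ A]

theorem map_linear_algebraMap_mul {n : Type*} [Fintype n] (f : A →ₗ[ℂ] ℂ) (R : Matrix n n ℂ)
    (Z : Matrix n n A) : (R.map (algebraMap ℂ A) * Z).map f = R * Z.map f := by
  ext s t
  rw [Matrix.map_apply, map_algebraMap_mul_apply, map_sum, Matrix.mul_apply]
  simp only [map_smul, smul_eq_mul, Matrix.map_apply]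

theorem map_linear_mul_algebraMap {n : Type*} [Fintype n] (f : A →ₗ[ℂ] ℂ) (R : Matrix n n ℂ)
    (Z : Matrix n n A) : (Z * R.map (algebraMap ℂ A)).map f = Z.map f * R := by
  ext s t
  rw [Matrix.map_apply, mul_map_algebraMap_apply, map_sum, Matrix.mul_apply]
  simp only [map_smul, smul_eq_mul, Matrix.map_apply, mul_comm]

theorem pairMat_map_algebraMap {n : ℕ} (i j : Fin n) (R : Op2) :
    pairMat i j (R.map (algebraMap ℂ A)) = (pairOp i j R).map (algebraMap ℂ A) := by
  ext s t
  simp only [pairMat, pairOp, Matrix.map_apply]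
  split_ifs
  · rfl
  · exact (map_zero _).symm

theorem siteMat_map_algebraMap {n : ℕ} (i : Fin n) (X : Matrix (Fin 2) (Fin 2) ℂ) :
    siteMat i (X.map (algebraMap ℂ A)) = (siteOp i X).map (algebraMap ℂ A) := by
  ext s t
  simp only [siteMat, siteOp, Matrix.map_apply]
  split_ifs
  · rfl
  · exact (map_zero _).symm

theorem RTT.permuted {R : Op2} {X Y : Matrix (Fin 2) (Fin 2) A} (h : RTT R X Y) :
    (permMat * R).map (algebraMap ℂ A) * (fstMat X * sndMat Y) =
      fstMat Y * sndMat X * (permMat * R).map (algebraMap ℂ A) := by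
  have hP : permMat.map (algebraMap ℂ A) * (sndMat Y * fstMat X) =
      fstMat Y * sndMat X * permMat.map (algebraMap ℂ A) := by
    ext s t
    rw [map_algebraMap_mul_apply, mul_map_algebraMap_apply, Finset.sum_eq_single s.swap,
      Finset.sum_eq_single t.swap, sndMat_mul_fstMat_apply, fstMat_mul_sndMat_apply]
    · simp [permMat]
    · intro k _ hk
      rw [permMat, if_neg hk, zero_smul]
    · simp
    · intro k _ hk
      rw [permMat, if_neg fun h' => hk (by rw [h', Prod.swap_swap]), zero_smul]
    · simp
  rw [Matrix.map_mul, mul_assoc, h, ← mul_assoc, hP, mul_assoc]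

theorem RTT.tensorMat_exchange {R : Op2} {m : ℕ} {X : Fin m → Matrix (Fin 2) (Fin 2) A}
    {i j : Fin m} (hij : (j : ℕ) = i + 1) (h : RTT R (X i) (X j)) :
    pairMat i j ((permMat * R).map (algebraMap ℂ A)) * tensorMat X =
      tensorMat (X ∘ Equiv.swap i j) * pairMat i j ((permMat * R).map (algebraMap ℂ A)) := by
  have hne : i ≠ j := by rintro rfl; omega
  rw [tensorMat_eq_prod, tensorMat_eq_prod]
  refine prod_ofFn_intertwine_adjacent hij (fun k hki hkj => ?_) ?_
  · rw [Function.comp, Equiv.swap_apply_of_ne_of_ne hki hkj]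
    exact pairMat_commute_siteMat hne hki hkj fun a b c d => Algebra.commutes _ _
  · simp only [Function.comp, Equiv.swap_apply_left, Equiv.swap_apply_right]
    rw [← pairMat_fstMat hne, ← pairMat_sndMat hne, ← pairMat_mul hne, ← pairMat_mul hne,
      ← pairMat_fstMat hne, ← pairMat_sndMat hne, ← pairMat_mul hne, ← pairMat_mul hne,
      h.permuted]

end Functional

theorem entFF_eq_smul_map (SB : EntState η ν κ') (SK : EntState η ν κ) {m : ℕ} (ξ : Fin m → ℂ) :
    entFF SB SK ξ = ((SB.bra ⬝ᵥ SK.ket) * ∏ j, SK.eig (ξ j))⁻¹ •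
      (tensorMat fun j => twMono η ν κ (ξ j)).map (matElem SB.bra SK.ket) := by
  ext a b
  rw [Matrix.smul_apply, smul_eq_mul, mul_comm, ← div_eq_mul_inv]
  rfl

theorem entFF_exchange (SB : EntState η ν κ') (SK : EntState η ν κ) {m : ℕ} (ξ : Fin m → ℂ)
    {i j : Fin m} (hij : (j : ℕ) = i + 1) :
    pairOp i j (permMat * entR η (ξ j - ξ i)) * entFF SB SK ξ =
      entFF SB SK (ξ ∘ Equiv.swap i j) * pairOp i j (permMat * entR η (ξ j - ξ i)) := by
  have key := congrArg (fun Z => Z.map (matElem SB.bra SK.ket))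
    (RTT.tensorMat_exchange (X := fun k => twMono η ν κ (ξ k)) hij
      (twMono_rtt ν κ (ξ i) (ξ j)))
  simp only [pairMat_map_algebraMap, map_linear_algebraMap_mul, map_linear_mul_algebraMap] at key
  have hprod : ∏ k, SK.eig ((ξ ∘ Equiv.swap i j) k) = ∏ k, SK.eig (ξ k) :=
    Equiv.prod_comp (Equiv.swap i j) fun k => SK.eig (ξ k)
  rw [entFF_eq_smul_map, entFF_eq_smul_map, hprod, Matrix.mul_smul, Matrix.smul_mul, key]
  rfl

end EntireRelations

/-! ## Asymptotics -/

section Asymptotics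

variable {η : ℂ} {M : ℕ} {ν : Fin M → ℂ} {κ κ' : ℂ} {t : ℂ} {F : Filter ℂ}

/-- The choice `t = ±i` treats both directions at once: it is made so that `exp (t l)` tends to
zero. -/
theorem sin_eq_exp_div (ht : t = Complex.I ∨ t = -Complex.I) (u : ℂ) :
    2 * t * Complex.sin u = Complex.exp (t * u) - Complex.exp (-(t * u)) := by
  rcases ht with rfl | rfl
  · rw [Complex.sin, mul_comm Complex.I u, neg_mul]
    linear_combination (Complex.exp (-(u * Complex.I)) - Complex.exp (u * Complex.I)) *
      Complex.I_mul_I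
  · rw [Complex.sin, show -Complex.I * u = -(u * Complex.I) by ring, neg_neg, neg_mul]
    linear_combination -(Complex.exp (-(u * Complex.I)) - Complex.exp (u * Complex.I)) *
      Complex.I_mul_I

/-- The factor that makes the Lax matrix at `x - l` converge. -/
def laxScale (t x l : ℂ) : ℂ := 2 * t * Complex.exp (-(t * (x - l)))

theorem tendsto_exp_scale (hF : Tendsto (fun l => Complex.exp (t * l)) F (𝓝 0)) (x : ℂ) :
    Tendsto (fun l => Complex.exp (-(t * (x - l)))) F (𝓝 0) := by
  have : (fun l => Complex.exp (-(t * (x - l)))) =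
      fun l => Complex.exp (-(t * x)) * Complex.exp (t * l) := by
    funext l
    rw [← Complex.exp_add]
    ring_nf
  rw [this]
  simpa using hF.const_mul (Complex.exp (-(t * x)))

theorem tendsto_laxScale (hF : Tendsto (fun l => Complex.exp (t * l)) F (𝓝 0)) (x : ℂ) :
    Tendsto (laxScale t x) F (𝓝 0) := by
  have h1 := (tendsto_exp_scale hF x).const_mul (2 * t)
  rw [mul_zero] at h1
  exact h1

theorem tendsto_laxScale_mul_sin (ht : t = Complex.I ∨ t = -Complex.I)
    (hF : Tendsto (fun l => Complex.exp (t * l)) F (𝓝 0)) (x y : ℂ) :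
    Tendsto (fun l => laxScale t x l * Complex.sin (x - l + y)) F (𝓝 (Complex.exp (t * y))) := by
  have : (fun l => laxScale t x l * Complex.sin (x - l + y)) = fun l =>
      Complex.exp (t * y) - Complex.exp (-(t * y)) *
        (Complex.exp (-(t * (x - l))) * Complex.exp (-(t * (x - l)))) := by
    funext l
    rw [laxScale, mul_right_comm, sin_eq_exp_div ht, sub_mul, ← Complex.exp_add,
      ← Complex.exp_add, ← Complex.exp_add, ← Complex.exp_add]
    ring_nf
  rw [this]
  have h2 := ((tendsto_exp_scale hF x).mul (tendsto_exp_scale hF x)).const_mul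
    (Complex.exp (-(t * y)))
  simpa using h2.const_sub (Complex.exp (t * y))

/-- After rescaling, the weights `a`, `b`, `c` of the six-vertex model tend to `exp (t η)`, `1` and
`0`, so that only a diagonal operator survives. -/
theorem tendsto_laxOp (ht : t = Complex.I ∨ t = -Complex.I)
    (hF : Tendsto (fun l => Complex.exp (t * l)) F (𝓝 0)) (j : Fin M) (x : ℂ) :
    Tendsto (fun l => laxScale t x l • laxOp η j (x - l)) F
      (𝓝 (Matrix.diagonal fun a => Matrix.diagonal fun s : Spins M =>
        if a = s j then Complex.exp (t * η) else 1)) := by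
  have hoff : Tendsto (fun l => laxScale t x l * Complex.sin η) F (𝓝 0) := by
    simpa using (tendsto_laxScale hF x).mul_const (Complex.sin η)
  have hη := tendsto_laxScale_mul_sin ht hF x η
  have h0 := tendsto_laxScale_mul_sin ht hF x 0
  simp only [add_zero, mul_zero, Complex.exp_zero] at h0
  refine tendsto_pi_nhds.2 fun a => tendsto_pi_nhds.2 fun b => tendsto_pi_nhds.2 fun s =>
    tendsto_pi_nhds.2 fun r => ?_
  have hval : ∀ l, (laxScale t x l • laxOp η j (x - l)) a b s r = if ∀ k, k ≠ j → s k = r k then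
      laxScale t x l * entR η (x - l) (a, s j) (b, r j) else 0 := by
    intro l
    change laxScale t x l * siteOp j (laxMat η (x - l) a b) s r = _
    rw [siteOp, mul_ite, mul_zero]
    rfl
  simp only [hval]
  by_cases hagree : ∀ k, k ≠ j → s k = r k
  · simp only [if_pos hagree]
    by_cases hab : a = b
    · subst hab
      rw [Matrix.diagonal_apply_eq, Matrix.diagonal_apply]
      by_cases hsr : s j = r j
      · have hs : s = r := funext fun k => if hk : k = j then hk ▸ hsr else hagree k hk
        subst hs
        rw [if_pos rfl]
        simp only [entR, sixVertex, if_true]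
        split_ifs
        · exact hη
        · exact h0
      · rw [if_neg fun h => hsr (by rw [h])]
        have : ∀ l, laxScale t x l * entR η (x - l) (a, s j) (a, r j) = 0 := by
          intro l
          simp only [entR, sixVertex, Prod.mk.injEq, true_and, Prod.swap_prod_mk, if_neg hsr]
          rw [if_neg, mul_zero]
          rintro ⟨h1, h2⟩
          exact hsr (h2.trans h1)
        simp only [this]
        exact tendsto_const_nhds
    · rw [Matrix.diagonal_apply_ne _ hab]
      simp only [entR, sixVertex, Prod.mk.injEq, hab, false_and, if_false]
      split_ifs
      · exact hoff
      · simpa using tendsto_const_nhds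
  · simp only [if_neg hagree]
    have : (Matrix.diagonal (fun a => Matrix.diagonal fun s : Spins M =>
        if a = s j then Complex.exp (t * η) else 1) : Matrix (Fin 2) (Fin 2) (Op M)) a b s r = 0 := by
      rw [Matrix.diagonal_apply]
      split_ifs
      · rw [Matrix.diagonal_apply_ne]
        rintro rfl
        exact hagree fun _ _ => rfl
      · rfl
    rw [this]
    exact tendsto_const_nhds

theorem prod_reverse_ofFn_diagonal (g : Fin M → Fin 2 → Spins M → ℂ) :
    (List.ofFn fun j => (Matrix.diagonal fun a => Matrix.diagonal (g j a) :
      Matrix (Fin 2) (Fin 2) (Op M))).reverse.prod =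
      Matrix.diagonal fun a => Matrix.diagonal fun s => ∏ j, g j a s := by
  let φ : (Fin 2 → Spins M → ℂ) →+* Matrix (Fin 2) (Fin 2) (Op M) :=
    (Matrix.diagonalRingHom (Fin 2) (Op M)).comp
      ((Matrix.diagonalRingHom (Spins M) ℂ).compLeft (Fin 2))
  have h1 : (List.ofFn fun j => (Matrix.diagonal fun a => Matrix.diagonal (g j a) :
      Matrix (Fin 2) (Fin 2) (Op M))) = (List.ofFn g).map φ := by
    rw [List.map_ofFn]
    rfl
  rw [h1, ← List.map_reverse, ← map_list_prod, List.prod_reverse, List.prod_ofFn]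
  change (Matrix.diagonal fun a => Matrix.diagonal ((∏ j, g j) a)) = _
  congr 1
  funext a
  congr 1
  funext s
  simp only [Finset.prod_apply]

theorem tendsto_entMono (ht : t = Complex.I ∨ t = -Complex.I)
    (hF : Tendsto (fun l => Complex.exp (t * l)) F (𝓝 0)) (ν : Fin M → ℂ) :
    Tendsto (fun l => (∏ j, laxScale t (ν j) l) • entMono η ν l) F
      (𝓝 (Matrix.diagonal fun a => Matrix.diagonal fun s : Spins M =>
        ∏ j, if a = s j then Complex.exp (t * η) else 1)) := by
  have hc : Continuous fun X : Fin M → Matrix (Fin 2) (Fin 2) (Op M) =>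
      (List.ofFn X).reverse.prod := continuous_list_prod_ofFn fun j => continuous_apply j
  have h1 := (hc.tendsto _).comp (tendsto_pi_nhds.2 fun j : Fin M =>
    tendsto_laxOp (η := η) ht hF j (ν j))
  rw [prod_reverse_ofFn_diagonal] at h1
  refine h1.congr fun l => ?_
  exact prod_reverse_ofFn_smul (fun j => laxScale t (ν j) l) fun j => laxOp η j (ν j - l)

/-- At total spin zero half of the spins equal `a`. Hence the limit of the monodromy matrix acts on
spin-zero vectors as a scalar that is the same for both values of `a`. -/
theorem prod_exp_of_spinWt_eq_zero (x : ℂ) {s : Spins M} (hs : spinWt s = 0) (a : Fin 2) :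
    (∏ j, if a = s j then Complex.exp x else 1) = Complex.exp (x / 2) ^ M := by
  have h1 : ∀ j, (if a = s j then Complex.exp x else 1) =
      Complex.exp (x / 2) * Complex.exp (x / 2 * spinSign a * spinSign (s j)) := by
    intro j
    rw [← Complex.exp_add]
    generalize s j = c
    fin_cases a <;> fin_cases c <;> simp [spinSign]
  simp only [h1]
  rw [Finset.prod_mul_distrib, ← Complex.exp_sum Finset.univ fun j =>
    x / 2 * spinSign a * spinSign (s j), ← Finset.mul_sum, ← Int.cast_sum]
  change _ * Complex.exp (_ * ((spinWt s : ℤ) : ℂ)) = _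
  simp [hs]

theorem tendsto_twMono_mulVec (ht : t = Complex.I ∨ t = -Complex.I)
    (hF : Tendsto (fun l => Complex.exp (t * l)) F (𝓝 0)) (ν : Fin M → ℂ) (κ : ℂ)
    {v : Spins M → ℂ} (hv : spinOp M *ᵥ v = 0) (a b : Fin 2) :
    Tendsto (fun l => (∏ j, laxScale t (ν j) l) • (twMono η ν κ l a b *ᵥ v)) F
      (𝓝 ((Complex.exp (t * η / 2) ^ M * theta κ a b) • v)) := by
  have hD : (Matrix.diagonal fun s : Spins M => ∏ j, if a = s j then Complex.exp (t * η) else 1)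
      *ᵥ v = Complex.exp (t * η / 2) ^ M • v := by
    funext s
    rw [Matrix.mulVec_diagonal, Pi.smul_apply, smul_eq_mul]
    by_cases h0 : v s = 0
    · rw [h0, mul_zero, mul_zero]
    · rw [prod_exp_of_spinWt_eq_zero _ (spinOp_mulVec_eq_zero.1 hv s h0)]
  have h1 := tendsto_pi_nhds.1 (tendsto_pi_nhds.1 (tendsto_entMono (η := η) ht hF ν) a) b
  have hcont : Continuous fun X : Op M => theta κ a a • (X *ᵥ v) :=
    Continuous.const_smul (g := fun X : Op M => X *ᵥ v)
      (continuous_id.matrix_mulVec continuous_const) (theta κ a a)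
  have h2 := (hcont.tendsto _).comp h1
  have hlim : theta κ a a • ((Matrix.diagonal (fun a => Matrix.diagonal fun s : Spins M =>
      ∏ j, if a = s j then Complex.exp (t * η) else 1) : Matrix (Fin 2) (Fin 2) (Op M)) a b *ᵥ v)
      = (Complex.exp (t * η / 2) ^ M * theta κ a b) • v := by
    rw [Matrix.diagonal_apply, theta_apply κ a b]
    split_ifs with hab
    · rw [hD, smul_smul, mul_comm]
    · rw [Matrix.zero_mulVec, smul_zero, mul_zero, zero_smul]
  rw [hlim] at h2
  refine h2.congr fun l => ?_
  simp only [Function.comp, twMono_apply, Matrix.smul_apply, Matrix.smul_mulVec]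
  rw [smul_comm]

namespace EntState

theorem tendsto_eig (ht : t = Complex.I ∨ t = -Complex.I)
    (hF : Tendsto (fun l => Complex.exp (t * l)) F (𝓝 0)) (S : EntState η ν κ) :
    Tendsto (fun l => (∏ j, laxScale t (ν j) l) * S.eig l) F
      (𝓝 (Complex.exp (t * η / 2) ^ M * (theta κ).trace)) := by
  obtain ⟨s, hs⟩ := Function.ne_iff.1 S.ket_ne_zero
  have h1 := tendsto_finsetSum Finset.univ fun (c : Fin 2) _ =>
    tendsto_twMono_mulVec (η := η) ht hF ν κ S.ket_spin c c
  have h2 : Tendsto (fun l => ((∏ j, laxScale t (ν j) l) * S.eig l) * S.ket s) F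
      (𝓝 ((Complex.exp (t * η / 2) ^ M * (theta κ).trace) * S.ket s)) := by
    have h3 := tendsto_pi_nhds.1 h1 s
    have e : (∑ c, (Complex.exp (t * η / 2) ^ M * theta κ c c) • S.ket) s =
        (Complex.exp (t * η / 2) ^ M * (theta κ).trace) * S.ket s := by
      rw [← Finset.sum_smul, ← Finset.mul_sum]
      rfl
    rw [e] at h3
    refine h3.congr fun l => ?_
    rw [← Finset.smul_sum, ← Matrix.sum_mulVec, ← twTransfer_eq_sum, S.ket_eigen, smul_smul]
    rfl
  have h4 := h2.div_const (S.ket s)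
  simpa only [mul_div_cancel_right₀ _ hs] using h4

theorem tendsto_twMono_div_eig (ht : t = Complex.I ∨ t = -Complex.I)
    (hF : Tendsto (fun l => Complex.exp (t * l)) F (𝓝 0)) (S : EntState η ν κ)
    (hκ : (theta κ).trace ≠ 0) (a b : Fin 2) :
    Tendsto (fun l => (S.eig l)⁻¹ • (twMono η ν κ l a b *ᵥ S.ket)) F
      (𝓝 (((theta κ).trace⁻¹ * theta κ a b) • S.ket)) := by
  have hC : Complex.exp (t * η / 2) ^ M ≠ 0 := pow_ne_zero _ (Complex.exp_ne_zero _)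
  have h1 := ((S.tendsto_eig ht hF).inv₀ (mul_ne_zero hC hκ)).smul
    (tendsto_twMono_mulVec (η := η) ht hF ν κ S.ket_spin a b)
  have ht0 : t ≠ 0 := by rcases ht with rfl | rfl <;> simp
  have hl : ∀ l, ∏ j, laxScale t (ν j) l ≠ 0 := fun l => Finset.prod_ne_zero_iff.2 fun j _ =>
    mul_ne_zero (mul_ne_zero two_ne_zero ht0) (Complex.exp_ne_zero _)
  rw [smul_smul, mul_inv, mul_mul_mul_comm, inv_mul_cancel₀ hC, one_mul] at h1
  refine h1.congr fun l => ?_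
  rw [smul_smul, mul_inv, mul_right_comm, inv_mul_cancel₀ (hl l), one_mul]

/-- Up to a scale factor the eigenvalue has a non-zero limit at `i∞`. Zeros of eigenvalues are
therefore isolated, as meromorphy of the form factors requires. -/
theorem exists_eig_ne_zero (S : EntState η ν κ) (hκ : (theta κ).trace ≠ 0) :
    ∃ l, S.eig l ≠ 0 := by
  by_contra! h0
  have hF : Tendsto (fun l => Complex.exp (Complex.I * l)) (comap Complex.im atTop) (𝓝 0) := by
    rw [Complex.tendsto_exp_nhds_zero_iff]
    simpa using tendsto_comap (f := Complex.im) (x := atTop)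
  have hne : (comap Complex.im atTop).NeBot :=
    NeBot.comap_of_surj inferInstance fun x => ⟨x * Complex.I, by simp⟩
  have h1 := S.tendsto_eig (.inl rfl) hF
  simp only [h0, mul_zero] at h1
  exact mul_ne_zero (pow_ne_zero _ (Complex.exp_ne_zero _)) hκ
    (tendsto_nhds_unique h1 tendsto_const_nhds)

theorem eventually_eig_ne_zero (S : EntState η ν κ) (hκ : (theta κ).trace ≠ 0) (l : ℂ) :
    ∀ᶠ z in 𝓝[≠] l, S.eig z ≠ 0 :=
  eventually_ne_zero_of_entire (fun z _ => S.eig_differentiable.analyticAt z)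
    (S.exists_eig_ne_zero hκ) l

end EntState

/-- The last monodromy matrix stands next to the ket, so its limit can be taken on the ket before
anything else acts. -/
theorem tendsto_entFF_snoc (ht : t = Complex.I ∨ t = -Complex.I)
    (hF : Tendsto (fun l => Complex.exp (t * l)) F (𝓝 0)) (SB : EntState η ν κ')
    (SK : EntState η ν κ) (hκ : (theta κ).trace ≠ 0) {m : ℕ} (ξ : Fin m → ℂ) :
    Tendsto (fun z => entFF SB SK (Fin.snoc ξ z : Fin (m + 1) → ℂ)) F
      (𝓝 (tensorLast (entFF SB SK ξ) ((theta κ).trace⁻¹ • theta κ))) := by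
  refine tendsto_pi_nhds.2 fun a => tendsto_pi_nhds.2 fun b => ?_
  set X := monoProd η ν κ ξ (Fin.init a) (Fin.init b)
  have hcont : Continuous fun v : Spins M → ℂ => (SB.bra ⬝ᵥ (X *ᵥ v)) /
      ((SB.bra ⬝ᵥ SK.ket) * ∏ j, SK.eig (ξ j)) :=
    (continuous_const.dotProduct (continuous_const.matrix_mulVec continuous_id)).div_const _
  have h1 := (hcont.tendsto _).comp
    (SK.tendsto_twMono_div_eig ht hF hκ (a (Fin.last m)) (b (Fin.last m)))
  have hlim : (SB.bra ⬝ᵥ (X *ᵥ (((theta κ).trace⁻¹ * theta κ (a (Fin.last m)) (b (Fin.last m))) •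
      SK.ket))) / ((SB.bra ⬝ᵥ SK.ket) * ∏ j, SK.eig (ξ j)) =
      tensorLast (entFF SB SK ξ) ((theta κ).trace⁻¹ • theta κ) a b := by
    rw [Matrix.mulVec_smul, dotProduct_smul, smul_eq_mul, mul_div_assoc, mul_comm]
    rfl
  rw [hlim] at h1
  refine h1.congr fun z => ?_
  simp only [Function.comp]
  rw [entFF, monoProd_snoc, Matrix.mulVec_smul, dotProduct_smul, smul_eq_mul,
    ← Matrix.mulVec_mulVec, Fin.prod_univ_castSucc]
  simp only [Fin.init_snoc, Fin.snoc_last, Fin.snoc_castSucc]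
  rw [← mul_assoc, inv_mul_eq_div, div_div, mul_comm (SK.eig z)]

theorem tendsto_exp_comap_im {F : Filter ℝ} (hF : F = atTop ∨ F = atBot) :
    ∃ t : ℂ, (t = Complex.I ∨ t = -Complex.I) ∧
      Tendsto (fun l => Complex.exp (t * l)) (comap Complex.im F) (𝓝 0) := by
  rcases hF with rfl | rfl
  · refine ⟨Complex.I, .inl rfl, ?_⟩
    rw [Complex.tendsto_exp_nhds_zero_iff]
    simpa using tendsto_comap (f := Complex.im) (x := atTop)
  · refine ⟨-Complex.I, .inr rfl, ?_⟩
    rw [Complex.tendsto_exp_nhds_zero_iff]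
    simpa using tendsto_comap (f := Complex.im) (x := atBot)

theorem eventually_regularAt_comap_im {γ : ℂ} {σ : Fin M → ℤˣ} {F : Filter ℝ}
    (hF : F = atTop ∨ F = atBot) : ∀ᶠ z in comap Complex.im F, RegularAt γ σ ν z := by
  obtain ⟨t, ht, hF⟩ := tendsto_exp_comap_im hF
  refine eventually_all.2 fun j => ?_
  have h1 := tendsto_laxScale_mul_sin ht hF (ν j) (Complex.I * ((σ j : ℤ) : ℂ) * γ)
  exact (h1.eventually_ne (Complex.exp_ne_zero _)).mono fun z hz => right_ne_zero_of_mul hz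

end Asymptotics

/-! ## Thermal form factors in terms of the entire monodromy matrix -/

section Thermal

variable {γ : ℂ} {T : ℝ} {M : ℕ} {σ : Fin M → ℤˣ} {ν : Fin M → ℂ} {h h' : ℝ}
variable {S0 : Eigenstate γ T σ ν h} {Sn : Eigenstate γ T σ ν h'} {m : ℕ}

theorem thermalFF_one {ξ : Fin m → ℂ} (hξ : ∀ j, RegularAt γ σ ν (ξ j)) :
    thermalFF 1 S0 Sn ξ = entFF Sn.toEnt S0.toEnt ξ := by
  rw [thermalFF, if_pos rfl, ffMatrix_eq _ _ _ hξ]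

theorem thermalFF_neg_one {ξ : Fin m → ℂ} (hξ : ∀ j, RegularAt γ σ ν (ξ j)) :
    thermalFF (-1) S0 Sn ξ = entFF S0.toEnt Sn.toEnt ξ := by
  rw [thermalFF, if_neg (by decide), ffMatrix_eq _ _ _ hξ]

theorem Admissible.regular {ε : ℤˣ} {ξ : Fin m → ℂ} (hξ : Admissible ε S0 Sn ξ) (j : Fin m) :
    RegularAt γ σ ν (ξ j) := (hξ j).1

theorem Eigenstate.toEnt_eig_ne_zero {S : Eigenstate γ T σ ν h} {l : ℂ}
    (hl : RegularAt γ σ ν l) (hS : S.eigenvalue l ≠ 0) : S.toEnt.eig l ≠ 0 := by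
  rw [S.toEnt_eig hl]
  exact mul_ne_zero (denom_ne_zero_iff.2 hl) hS

theorem Admissible.eig_ne_zero_of_one {ξ : Fin m → ℂ} (hξ : Admissible 1 S0 Sn ξ) (j : Fin m) :
    S0.toEnt.eig (ξ j) ≠ 0 :=
  S0.toEnt_eig_ne_zero (hξ j).1 (by simpa using (hξ j).2)

theorem Admissible.eig_ne_zero_of_neg_one {ξ : Fin m → ℂ} (hξ : Admissible (-1) S0 Sn ξ)
    (j : Fin m) : Sn.toEnt.eig (ξ j) ≠ 0 :=
  Sn.toEnt_eig_ne_zero (hξ j).1 (by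
    have := (hξ j).2
    rwa [if_neg (by decide)] at this)

theorem overlap_toEnt (SB : Eigenstate γ T σ ν h) (SK : Eigenstate γ T σ ν h') :
    SB.toEnt.bra ⬝ᵥ SK.toEnt.ket = SB.bra ⬝ᵥ SK.ket := dotProduct_gaugeOp _ _

theorem rho_eq {l : ℂ} (hl : RegularAt γ σ ν l) :
    rho S0 Sn l = Sn.toEnt.eig l / S0.toEnt.eig l := by
  rw [rho, S0.toEnt_eig hl, Sn.toEnt_eig hl, mul_div_mul_left _ _ (denom_ne_zero_iff.2 hl)]

theorem qSigmaZ_eq_theta (γ x : ℂ) : qSigmaZ γ x = theta (-2 * γ * x) := by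
  rw [qSigmaZ, theta, qPow, qPow]
  ring_nf

/-- Since `-2γα = (h' - h)/T`, the factor `q^{±ασ^z}` is the twist that turns one of the two
magnetic fields into the other. -/
theorem qSigmaZ_alpha (hγ : γ ≠ 0) (hT : T ≠ 0) (s : ℂ) :
    qSigmaZ γ (s * alpha γ T h h') =
      theta (s * (((h' / T : ℝ) : ℂ) - ((h / T : ℝ) : ℂ))) := by
  have hT' : (T : ℂ) ≠ 0 := by exact_mod_cast hT
  rw [qSigmaZ_eq_theta, alpha]
  congr 1
  push_cast
  field_simp
  ring

theorem trace_thermalFF (hov : Overlap S0 Sn) (ε : ℤˣ) (ξ : Fin m → ℂ)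
    (hξ : Admissible ε S0 Sn ξ) : (thermalFF ε S0 Sn ξ).trace = 1 := by
  rcases Int.units_eq_one_or ε with rfl | rfl
  · rw [thermalFF_one hξ.regular]
    exact trace_entFF _ _ (by rw [overlap_toEnt]; exact hov.2) ξ hξ.eig_ne_zero_of_one
  · rw [thermalFF_neg_one hξ.regular]
    exact trace_entFF _ _ (by rw [overlap_toEnt]; exact hov.1) ξ hξ.eig_ne_zero_of_neg_one

theorem traceLast_thermalFF (ε : ℤˣ) (ξ : Fin (m + 1) → ℂ) (hξ : Admissible ε S0 Sn ξ) :
    traceLast (thermalFF ε S0 Sn ξ) = thermalFF ε S0 Sn (Fin.init ξ) := by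
  rcases Int.units_eq_one_or ε with rfl | rfl
  · rw [thermalFF_one hξ.regular, thermalFF_one (ξ := Fin.init ξ) fun j => hξ.regular j.castSucc,
      traceLast_entFF _ _ _ (hξ.eig_ne_zero_of_one _)]
  · rw [thermalFF_neg_one hξ.regular, thermalFF_neg_one (ξ := Fin.init ξ) fun j => hξ.regular j.castSucc,
      traceLast_entFF _ _ _ (hξ.eig_ne_zero_of_neg_one _)]

theorem traceFirst_thermalFF (hγ : γ ≠ 0) (hT : T ≠ 0) (ε : ℤˣ) (ξ : Fin (m + 1) → ℂ)
    (hξ : Admissible ε S0 Sn ξ) :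
    traceFirst (siteOp 0 (qSigmaZ γ (((ε : ℤ) : ℂ) * alpha γ T h h')) * thermalFF ε S0 Sn ξ) =
      (rho S0 Sn (ξ 0)) ^ (ε : ℤ) • thermalFF ε S0 Sn (Fin.tail ξ) := by
  rcases Int.units_eq_one_or ε with rfl | rfl
  · rw [thermalFF_one hξ.regular, thermalFF_one (ξ := Fin.tail ξ) fun j => hξ.regular j.succ, qSigmaZ_alpha hγ hT,
      Units.val_one, Int.cast_one, one_mul, traceFirst_entFF, zpow_one, rho_eq (hξ.regular 0)]
  · rw [thermalFF_neg_one hξ.regular, thermalFF_neg_one (ξ := Fin.tail ξ) fun j => hξ.regular j.succ,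
      qSigmaZ_alpha hγ hT, Units.val_neg, Units.val_one, Int.cast_neg, Int.cast_one, neg_one_mul,
      neg_sub, traceFirst_entFF, zpow_neg_one, rho_eq (hξ.regular 0), inv_div]

theorem thermalFF_exchange (ε : ℤˣ) (ξ : Fin m → ℂ) {i j : Fin m} (hij : (j : ℕ) = i + 1)
    (hξ : Admissible ε S0 Sn ξ) (hs : Complex.sin (ξ j - ξ i + Complex.I * γ) ≠ 0) :
    pairOp i j (permMat * RMat γ (ξ i) (ξ j)) * thermalFF ε S0 Sn ξ =
      thermalFF ε S0 Sn (ξ ∘ Equiv.swap i j) * pairOp i j (permMat * RMat γ (ξ i) (ξ j)) := by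
  have hsmul : ∀ (c : ℂ) (X : Op2), pairOp i j (c • X) = c • pairOp i j X := by
    intro c X
    ext s t
    simp only [pairOp, Matrix.smul_apply, smul_eq_mul, mul_ite, mul_zero]
  rw [RMat_eq_smul_entR γ _ _ hs, Matrix.mul_smul, hsmul, Matrix.smul_mul, Matrix.mul_smul]
  congr 1
  rcases Int.units_eq_one_or ε with rfl | rfl
  · rw [thermalFF_one hξ.regular, thermalFF_one (ξ := ξ ∘ Equiv.swap i j) fun k => hξ.regular _, entFF_exchange _ _ _ hij]
  · rw [thermalFF_neg_one hξ.regular, thermalFF_neg_one (ξ := ξ ∘ Equiv.swap i j) fun k => hξ.regular _,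
      entFF_exchange _ _ _ hij]

theorem thermalFF_commute_tensorPow (ε : ℤˣ) (ξ : Fin m → ℂ) (κ : ℂ)
    (hξ : Admissible ε S0 Sn ξ) : Commute (thermalFF ε S0 Sn ξ) (tensorPow m (theta κ)) := by
  rcases Int.units_eq_one_or ε with rfl | rfl
  · rw [thermalFF_one hξ.regular]
    exact entFF_commute_tensorPow _ _ _ _
  · rw [thermalFF_neg_one hξ.regular]
    exact entFF_commute_tensorPow _ _ _ _

theorem thermalFF_transpose (hη : Complex.sin (Complex.I * γ) ≠ 0) (hγ : γ ≠ 0) (hT : T ≠ 0)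
    (hov : Overlap S0 Sn) (h0 : S0.IsSimple) (hn : Sn.IsSimple) (ξ : Fin m → ℂ)
    (hξ : Admissible 1 S0 Sn ξ) (a b : Spins m) :
    thermalFF (-1) S0 Sn ξ a b = (∏ j, (rho S0 Sn (ξ j))⁻¹) *
      (tensorPow m (qSigmaZ γ (alpha γ T h h')) * thermalFF 1 S0 Sn (ξ ∘ Fin.rev))
        (b ∘ Fin.rev) (a ∘ Fin.rev) := by
  have hq : qSigmaZ γ (alpha γ T h h') = theta (((h' / T : ℝ) : ℂ) - ((h / T : ℝ) : ℂ)) := by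
    rw [← one_mul (alpha γ T h h'), qSigmaZ_alpha hγ hT, one_mul]
  rw [thermalFF_neg_one hξ.regular, thermalFF_one (ξ := ξ ∘ Fin.rev) fun j => hξ.regular _, hq, tensorPow_theta,
    Matrix.diagonal_mul, spinWt_comp_rev, entFF_transpose hη (Eigenstate.isSimple_toEnt.2 h0)
      (Eigenstate.isSimple_toEnt.2 hn) (by rw [overlap_toEnt]; exact hov.1)
      (by rw [overlap_toEnt]; exact hov.2) ξ hξ.eig_ne_zero_of_one]
  congr 1
  exact Finset.prod_congr rfl fun j _ => by rw [rho_eq (hξ.regular j)]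

end Thermal

/-! ## Crossing and commutativity of rows -/

section Rows

variable {γ : ℂ} {T : ℝ} {M : ℕ} {σ σ' : Fin M → ℤˣ} {ν ν' : Fin M → ℂ} {h h' : ℝ}

/-- Transport of a state along an equality of the inhomogeneities. -/
def EntState.cast {η κ : ℂ} {μ μ' : Fin M → ℂ} (e : μ = μ') (S : EntState η μ κ) :
    EntState η μ' κ where
  ket := S.ket
  bra := S.bra
  eig := S.eig
  ket_ne_zero := S.ket_ne_zero
  bra_ne_zero := S.bra_ne_zero
  ket_eigen := e ▸ S.ket_eigen
  bra_eigen := e ▸ S.bra_eigen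
  ket_spin := S.ket_spin
  bra_spin := S.bra_spin

theorem EntState.isSimple_cast {η κ : ℂ} {μ μ' : Fin M → ℂ} (e : μ = μ') {S : EntState η μ κ}
    (hS : S.IsSimple) : (S.cast e).IsSimple := by
  subst e
  exact hS

theorem entFF_cast {η κ κ' : ℂ} {μ μ' : Fin M → ℂ} (e : μ = μ') (SB : EntState η μ κ')
    (SK : EntState η μ κ) {m : ℕ} (ξ : Fin m → ℂ) :
    entFF (SB.cast e) (SK.cast e) ξ = entFF SB SK ξ := by
  subst e
  rfl

/-- Stated for any two staggered models whose entire inhomogeneities agree up to a permutation; this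
covers crossing and the permutation of rows at once. -/
theorem Eigenstate.IsSimple.exists_related (hη : Complex.sin (Complex.I * γ) ≠ 0)
    {P : Equiv.Perm (Fin M)} (hμ : entInhom γ σ ν ∘ P = entInhom γ σ' ν')
    {S : Eigenstate γ T σ ν h} (hS : S.IsSimple) :
    ∃ S' : Eigenstate γ T σ' ν' h, S'.IsSimple ∧ S'.toEnt.eig = S.toEnt.eig ∧
      ∀ l, S'.eigenvalue l = S.toEnt.eig l / denom γ σ' ν' l := by
  obtain ⟨E, -, hE, hEe, -⟩ := (Eigenstate.isSimple_toEnt.2 hS).exists_permuted hη P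
  refine ⟨(E.cast hμ).toEigenstate, EntState.isSimple_toEigenstate (EntState.isSimple_cast hμ hE),
    (EntState.toEnt_toEigenstate_eig _).trans hEe, fun l => ?_⟩
  rw [← hEe]
  rfl

theorem overlap_of_related (hη : Complex.sin (Complex.I * γ) ≠ 0) {P : Equiv.Perm (Fin M)}
    (hμ : entInhom γ σ ν ∘ P = entInhom γ σ' ν') {S0 : Eigenstate γ T σ ν h}
    {Sn : Eigenstate γ T σ ν h'} (hov : Overlap S0 Sn) (h0 : S0.IsSimple) (hn : Sn.IsSimple)
    {S0' : Eigenstate γ T σ' ν' h} {Sn' : Eigenstate γ T σ' ν' h'}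
    (h0' : S0'.toEnt.eig = S0.toEnt.eig) (hn' : Sn'.toEnt.eig = Sn.toEnt.eig) :
    Overlap S0' Sn' := by
  have e0 := Eigenstate.isSimple_toEnt.2 h0
  have en := Eigenstate.isSimple_toEnt.2 hn
  have o1 : S0.toEnt.bra ⬝ᵥ Sn.toEnt.ket ≠ 0 := by rw [overlap_toEnt]; exact hov.1
  have o2 : Sn.toEnt.bra ⬝ᵥ S0.toEnt.ket ≠ 0 := by rw [overlap_toEnt]; exact hov.2
  have k1 := (permuted_matrix_element hη e0 en o1 o2 (SB' := S0'.toEnt.cast hμ.symm)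
    (SK' := Sn'.toEnt.cast hμ.symm) h0' hn').1
  have k2 := (permuted_matrix_element hη en e0 o2 o1 (SB' := Sn'.toEnt.cast hμ.symm)
    (SK' := S0'.toEnt.cast hμ.symm) hn' h0').1
  exact ⟨by rw [← overlap_toEnt]; exact k1, by rw [← overlap_toEnt]; exact k2⟩

theorem thermalFF_related (hη : Complex.sin (Complex.I * γ) ≠ 0) {P : Equiv.Perm (Fin M)}
    (hμ : entInhom γ σ ν ∘ P = entInhom γ σ' ν') {S0 : Eigenstate γ T σ ν h}
    {Sn : Eigenstate γ T σ ν h'} (hov : Overlap S0 Sn) (h0 : S0.IsSimple) (hn : Sn.IsSimple)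
    {S0' : Eigenstate γ T σ' ν' h} {Sn' : Eigenstate γ T σ' ν' h'}
    (h0' : S0'.toEnt.eig = S0.toEnt.eig) (hn' : Sn'.toEnt.eig = Sn.toEnt.eig) (ε : ℤˣ) {m : ℕ}
    (ξ : Fin m → ℂ) (hξ : ∀ j, RegularAt γ σ ν (ξ j)) (hξ' : ∀ j, RegularAt γ σ' ν' (ξ j)) :
    thermalFF ε S0 Sn ξ = thermalFF ε S0' Sn' ξ := by
  have e0 := Eigenstate.isSimple_toEnt.2 h0
  have en := Eigenstate.isSimple_toEnt.2 hn
  have o1 : S0.toEnt.bra ⬝ᵥ Sn.toEnt.ket ≠ 0 := by rw [overlap_toEnt]; exact hov.1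
  have o2 : Sn.toEnt.bra ⬝ᵥ S0.toEnt.ket ≠ 0 := by rw [overlap_toEnt]; exact hov.2
  rcases Int.units_eq_one_or ε with rfl | rfl
  · rw [thermalFF_one hξ, thermalFF_one hξ', ← entFF_cast hμ.symm Sn'.toEnt S0'.toEnt]
    exact (entFF_permuted hη en e0 o2 o1 hn' h0' ξ).symm
  · rw [thermalFF_neg_one hξ, thermalFF_neg_one hξ', ← entFF_cast hμ.symm S0'.toEnt Sn'.toEnt]
    exact (entFF_permuted hη e0 en o1 o2 h0' hn' ξ).symm

theorem entInhom_permuted (P : Equiv.Perm (Fin M)) :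
    entInhom γ σ ν ∘ P = entInhom γ (σ ∘ P) (ν ∘ P) := rfl

theorem regularAt_permuted {P : Equiv.Perm (Fin M)} {l : ℂ} (hl : RegularAt γ σ ν l) :
    RegularAt γ (σ ∘ P) (ν ∘ P) l := fun j => hl (P j)

theorem denom_permuted (P : Equiv.Perm (Fin M)) (l : ℂ) :
    denom γ (σ ∘ P) (ν ∘ P) l = denom γ σ ν l :=
  Equiv.prod_comp P fun j => Complex.sin (ν j - l + Complex.I * ((σ j : ℤ) : ℂ) * γ)

theorem PermutedLabel.toEnt_eig {P : Equiv.Perm (Fin M)} {S : Eigenstate γ T σ ν h}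
    {S' : Eigenstate γ T (σ ∘ P) (ν ∘ P) h} (hS : PermutedLabel P S S') :
    S'.toEnt.eig = S.toEnt.eig :=
  EntState.eig_eq_of_eq_on_regularAt (γ := γ) (σ := σ) (ν := ν) fun l hl => by
    rw [S'.toEnt_eig (regularAt_permuted hl), S.toEnt_eig hl, hS l hl, denom_permuted]

theorem permutedLabel_of_eigenvalue_eq {P : Equiv.Perm (Fin M)} {S : Eigenstate γ T σ ν h}
    {S' : Eigenstate γ T (σ ∘ P) (ν ∘ P) h}
    (hS : ∀ l, S'.eigenvalue l = S.toEnt.eig l / denom γ (σ ∘ P) (ν ∘ P) l) :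
    PermutedLabel P S S' := by
  intro l hl
  rw [hS, denom_permuted, S.toEnt_eig hl, mul_div_cancel_left₀ _ (denom_ne_zero_iff.2 hl)]

/-- The reversal of the staggering and the shift of the inhomogeneity compensate each other in the
unstaggered model. Crossing thus corresponds to the identity permutation. -/
theorem entInhom_crossed (j : Fin M) :
    entInhom γ σ ν ∘ Equiv.refl (Fin M) = entInhom γ (flipStag σ j) (shiftInhom γ σ ν j) := by
  funext k
  simp only [Function.comp, Equiv.refl_apply, entInhom, flipStag, shiftInhom]
  by_cases hk : k = j
  · subst hk
    have hne : ¬ ((-1 : ℤˣ) = 1) := by decide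
    rcases Int.units_eq_one_or (σ k) with hs | hs
    · simp [hs, hne]
    · simp [hs, hne]
      ring
  · simp only [Function.update_of_ne hk]
    rfl

/-- Only the factor of row `j` changes, and it becomes `sin (ν j - l)`. This is where the ratio of
eigenvalues in `CrossedLabel` comes from. -/
theorem denom_crossed (j : Fin M) (l : ℂ) :
    denom γ (flipStag σ j) (shiftInhom γ σ ν j) l *
        Complex.sin (ν j - l + Complex.I * ((σ j : ℤ) : ℂ) * γ) =
      denom γ σ ν l * Complex.sin (ν j - l) := by
  rw [denom, denom, ← Finset.mul_prod_erase _ _ (Finset.mem_univ j),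
    ← Finset.mul_prod_erase (s := Finset.univ)
      (f := fun k => Complex.sin (ν k - l + Complex.I * ((σ k : ℤ) : ℂ) * γ)) (a := j)
      (Finset.mem_univ j)]
  have h1 : ∀ k ∈ Finset.univ.erase j, Complex.sin (shiftInhom γ σ ν j k - l +
      Complex.I * ((flipStag σ j k : ℤ) : ℂ) * γ) =
      Complex.sin (ν k - l + Complex.I * ((σ k : ℤ) : ℂ) * γ) := by
    intro k hk
    rw [shiftInhom, flipStag, Function.update_of_ne (Finset.ne_of_mem_erase hk),
      Function.update_of_ne (Finset.ne_of_mem_erase hk)]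
  rw [Finset.prod_congr rfl h1]
  have h2 : shiftInhom γ σ ν j j - l + Complex.I * ((flipStag σ j j : ℤ) : ℂ) * γ = ν j - l := by
    rw [shiftInhom, flipStag, Function.update_self, Function.update_self]
    push_cast
    ring
  rw [h2]
  ring

theorem sin_ne_zero_of_regularAt_crossed {j : Fin M} {l : ℂ}
    (hl : RegularAt γ (flipStag σ j) (shiftInhom γ σ ν j) l) : Complex.sin (ν j - l) ≠ 0 := by
  have h1 := hl j
  rw [shiftInhom, flipStag, Function.update_self, Function.update_self] at h1
  convert h1 using 2
  push_cast
  ring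

theorem CrossedLabel.toEnt_eig {j : Fin M} {S : Eigenstate γ T σ ν h}
    {S' : Eigenstate γ T (flipStag σ j) (shiftInhom γ σ ν j) h} (hS : CrossedLabel j S S') :
    S'.toEnt.eig = S.toEnt.eig := by
  funext l
  have hcl : IsClosed {z | S'.toEnt.eig z = S.toEnt.eig z} :=
    isClosed_eq S'.toEnt.eig_differentiable.continuous S.toEnt.eig_differentiable.continuous
  refine hcl.mem_of_frequently_of_tendsto (Eventually.frequently ?_)
    (tendsto_id.mono_left (nhdsWithin_le_nhds : 𝓝[≠] l ≤ 𝓝 l))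
  filter_upwards [eventually_regularAt (γ := γ) (σ := σ) (ν := ν) l,
    eventually_regularAt (γ := γ) (σ := flipStag σ j) (ν := shiftInhom γ σ ν j) l] with z hz hz'
  change S'.toEnt.eig z = S.toEnt.eig z
  have hs := sin_ne_zero_of_regularAt_crossed hz'
  rw [S'.toEnt_eig hz', S.toEnt_eig hz, hS z hz hz', ← mul_assoc, ← mul_div_assoc,
    denom_crossed, mul_div_cancel_right₀ _ hs]

theorem crossedLabel_of_eigenvalue_eq {j : Fin M} {S : Eigenstate γ T σ ν h}
    {S' : Eigenstate γ T (flipStag σ j) (shiftInhom γ σ ν j) h}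
    (hS : ∀ l, S'.eigenvalue l =
      S.toEnt.eig l / denom γ (flipStag σ j) (shiftInhom γ σ ν j) l) :
    CrossedLabel j S S' := by
  intro l hl hl'
  have hs := sin_ne_zero_of_regularAt_crossed hl'
  rw [hS, S.toEnt_eig hl, div_eq_iff (denom_ne_zero_iff.2 hl'), div_mul_eq_mul_div,
    div_mul_eq_mul_div, eq_div_iff hs]
  linear_combination -S.eigenvalue l * denom_crossed (γ := γ) (σ := σ) (ν := ν) j l

end Rows

/-! ## Meromorphy -/

section Meromorphy

variable {γ : ℂ} {T : ℝ} {M : ℕ} {σ : Fin M → ℤˣ} {ν : Fin M → ℂ} {h h' : ℝ}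

/-- A class of functions that contains the constants and is closed under sums and products
contains the matrix elements of a product of matrices with entries in it. -/
theorem dotProduct_prod_mulVec_mem {X : Type*} (p : (X → ℂ) → Prop)
    (hc : ∀ c : ℂ, p fun _ => c) (hadd : ∀ f g, p f → p g → p fun x => f x + g x)
    (hmul : ∀ f g, p f → p g → p fun x => f x * g x) {n : Type*} [Fintype n] [DecidableEq n]
    {m : ℕ} (B : X → Fin m → Matrix n n ℂ) (hB : ∀ j s t, p fun x => B x j s t)
    (v w : n → ℂ) : p fun x => v ⬝ᵥ ((List.ofFn (B x)).prod *ᵥ w) := by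
  have hsum : ∀ {ι : Type _} (S : Finset ι) (f : ι → X → ℂ), (∀ i, p (f i)) →
      p fun x => ∑ i ∈ S, f i x := by
    intro ι S f hf
    classical
    induction S using Finset.induction_on with
    | empty => simpa using hc 0
    | insert i S hi ih =>
      simp only [Finset.sum_insert hi]
      exact hadd _ _ (hf i) ih
  have hprod : ∀ s t, p fun x => (List.ofFn (B x)).prod s t := by
    induction m with
    | zero =>
      intro s t
      simpa using hc ((1 : Matrix n n ℂ) s t)
    | succ m ih =>
      intro s t
      simp only [List.ofFn_succ, List.prod_cons, Matrix.mul_apply]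
      exact hsum _ _ fun k => hmul _ _ (hB 0 s k)
        (ih (fun x j => B x j.succ) (fun j => hB j.succ) k t)
  simp only [dotProduct, Matrix.mulVec]
  exact hsum _ _ fun s => hmul _ _ (hc _) (hsum _ _ fun t => hmul _ _ (hprod s t) (hc _))

theorem entFF_isMeromorphic {μ : Fin M → ℂ} {η κ κ' : ℂ} (SB : EntState η μ κ')
    (SK : EntState η μ κ) (hov : SB.bra ⬝ᵥ SK.ket ≠ 0) (hκ : (theta κ).trace ≠ 0) {m : ℕ}
    (a b : Spins m) {f : (Fin m → ℂ) → ℂ}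
    (hf : ∀ ξ : Fin m → ℂ, (∀ j, RegularAt γ σ ν (ξ j)) → f ξ = entFF SB SK ξ a b) :
    IsMeromorphic f := by
  intro x₀
  -- The common factor `∏ denom` makes the denominator vanish at irregular points, where nothing is
  -- known about `f`.
  refine ⟨fun ξ => (∏ j, denom γ σ ν (ξ j)) * (SB.bra ⬝ᵥ (monoProd η μ κ ξ a b *ᵥ SK.ket)),
    fun ξ => (∏ j, denom γ σ ν (ξ j)) * ((SB.bra ⬝ᵥ SK.ket) * ∏ j, SK.eig (ξ j)), ?_, ?_, ?_, ?_⟩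
  · refine AnalyticAt.mul (Finset.analyticAt_fun_prod _ fun j _ => ?_) ?_
    · exact (denom_analytic (x₀ j) trivial).comp_of_eq
        ((ContinuousLinearMap.proj (R := ℂ) (φ := fun _ : Fin m => ℂ) j).analyticAt x₀) rfl
    · refine dotProduct_prod_mulVec_mem (fun f => AnalyticAt ℂ f x₀) (fun c => analyticAt_const)
        (fun f g hf hg => hf.add hg) (fun f g hf hg => hf.mul hg)
        (fun ξ j => twMono η μ κ (ξ j) (a j) (b j)) (fun j s t => ?_) _ _
      exact ((differentiable_twMono μ κ (a j) (b j) s t).analyticAt (x₀ j)).comp_of_eq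
        ((ContinuousLinearMap.proj (R := ℂ) (φ := fun _ : Fin m => ℂ) j).analyticAt x₀) rfl
  · refine AnalyticAt.mul (Finset.analyticAt_fun_prod _ fun j _ => ?_)
      (analyticAt_const.mul (Finset.analyticAt_fun_prod _ fun j _ => ?_))
    · exact (denom_analytic (x₀ j) trivial).comp_of_eq
        ((ContinuousLinearMap.proj (R := ℂ) (φ := fun _ : Fin m => ℂ) j).analyticAt x₀) rfl
    · exact (SK.eig_differentiable.analyticAt (x₀ j)).comp_of_eq
        ((ContinuousLinearMap.proj (R := ℂ) (φ := fun _ : Fin m => ℂ) j).analyticAt x₀) rfl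
  -- That the germ of the denominator is non-zero is tested on the line `x₀ + z (1, …, 1)`, along
  -- which all factors are non-zero for small `z ≠ 0`.
  · have hline : Tendsto (fun z : ℂ => fun j => x₀ j + z) (𝓝[≠] 0) (𝓝 x₀) := by
      have : Continuous fun z : ℂ => fun j => x₀ j + z := by fun_prop
      have h0 := this.tendsto 0
      simp only [add_zero] at h0
      exact h0.mono_left nhdsWithin_le_nhds
    refine hline.frequently (Eventually.frequently ?_)
    have hshift : ∀ j, Tendsto (fun z : ℂ => x₀ j + z) (𝓝[≠] 0) (𝓝[≠] (x₀ j)) := by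
      intro j
      refine tendsto_nhdsWithin_of_tendsto_nhds_of_eventually_within _ ?_ ?_
      · have : Continuous fun z : ℂ => x₀ j + z := by fun_prop
        have h0 := this.tendsto 0
        rw [add_zero] at h0
        exact h0.mono_left nhdsWithin_le_nhds
      · filter_upwards [self_mem_nhdsWithin] with z hz
        simpa using hz
    filter_upwards [eventually_all.2 fun j => (hshift j).eventually
      (eventually_regularAt (γ := γ) (σ := σ) (ν := ν) (x₀ j)),
      eventually_all.2 fun j => (hshift j).eventually (SK.eventually_eig_ne_zero hκ (x₀ j))]
      with z hz hz'
    exact mul_ne_zero (Finset.prod_ne_zero_iff.2 fun j _ => denom_ne_zero_iff.2 (hz j))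
      (mul_ne_zero hov (Finset.prod_ne_zero_iff.2 fun j _ => hz' j))
  · refine Eventually.of_forall fun ξ hξ => ?_
    have hd := left_ne_zero_of_mul hξ
    rw [hf ξ fun j => denom_ne_zero_iff.1 (Finset.prod_ne_zero_iff.1 hd j (Finset.mem_univ j)),
      entFF, mul_div_mul_left _ _ hd]

theorem theta_trace_ne_zero (x : ℝ) : (theta (x : ℂ)).trace ≠ 0 := by
  have h1 : (theta (x : ℂ)).trace = ((Real.exp (x / 2) + Real.exp (-x / 2) : ℝ) : ℂ) := by
    rw [Matrix.trace, Fin.sum_univ_two]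
    simp [theta]
  rw [h1]
  have := add_pos (Real.exp_pos (x / 2)) (Real.exp_pos (-x / 2))
  exact_mod_cast this.ne'

/-! ### Meromorphy in a single variable -/

theorem meromorphicAt_block_monodromy (a b : Fin 2) (s t : Spins M) (z₀ : ℂ) :
    MeromorphicAt (fun z => block (monodromy γ T σ ν h z) a b s t) z₀ := by
  have hd : MeromorphicAt (denom γ σ ν) z₀ := (denom_analytic z₀ trivial).meromorphicAt
  have h1 : MeromorphicAt (fun z => (gaugeOp σ * twMono (Complex.I * γ) (entInhom γ σ ν)
      ((h / T : ℝ) : ℂ) z a b * gaugeOp σ) s t) z₀ := by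
    refine AnalyticAt.meromorphicAt (Differentiable.analyticAt ?_ z₀)
    simp only [Matrix.mul_apply]
    exact Differentiable.fun_sum fun k _ => (Differentiable.fun_sum fun k' _ =>
      (differentiable_twMono _ _ a b k' k).const_mul _).mul_const _
  refine (hd.inv.mul h1).congr ?_
  filter_upwards [eventually_regularAt (γ := γ) (σ := σ) (ν := ν) z₀] with z hz
  rw [block_monodromy hz]
  rfl

theorem Eigenstate.meromorphicAt_eigenvalue (S : Eigenstate γ T σ ν h) (z₀ : ℂ) :
    MeromorphicAt S.eigenvalue z₀ := by
  have hd : MeromorphicAt (denom γ σ ν) z₀ := (denom_analytic z₀ trivial).meromorphicAt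
  have h1 : MeromorphicAt S.toEnt.eig z₀ :=
    (S.toEnt.eig_differentiable.analyticAt z₀).meromorphicAt
  refine (h1.div hd).congr ?_
  filter_upwards [eventually_regularAt (γ := γ) (σ := σ) (ν := ν) z₀] with z hz
  rw [Pi.div_apply, S.toEnt_eig hz, mul_div_cancel_left₀ _ (denom_ne_zero_iff.2 hz)]

theorem ffMatrix_meromorphicOn (SB : Eigenstate γ T σ ν h') (SK : Eigenstate γ T σ ν h) {m : ℕ}
    (ξ : Fin m → ℂ) (j : Fin m) (a b : Spins m) :
    MeromorphicOn (fun z => ffMatrix γ T σ ν h SB.bra SK.ket SK.eigenvalue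
      (Function.update ξ j z) a b) Set.univ := by
  intro z₀ _
  simp only [ffMatrix]
  refine MeromorphicAt.fun_div ?_ ((MeromorphicAt.const _ _).fun_mul
    (MeromorphicAt.fun_prod fun k _ => ?_))
  · refine dotProduct_prod_mulVec_mem (fun f => MeromorphicAt f z₀)
      (fun c => MeromorphicAt.const _ _) (fun f g hf hg => hf.fun_add hg)
      (fun f g hf hg => hf.fun_mul hg)
      (fun z k => block (monodromy γ T σ ν h (Function.update ξ j z k)) (a k) (b k))
      (fun k s t => ?_) _ _
    by_cases hk : k = j
    · subst hk
      simp only [Function.update_self]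
      exact meromorphicAt_block_monodromy _ _ _ _ _
    · simp only [Function.update_of_ne hk]
      exact MeromorphicAt.const _ _
  · by_cases hk : k = j
    · subst hk
      simp only [Function.update_self]
      exact SK.meromorphicAt_eigenvalue z₀
    · simp only [Function.update_of_ne hk]
      exact MeromorphicAt.const _ _

variable {S0 : Eigenstate γ T σ ν h} {Sn : Eigenstate γ T σ ν h'} {m : ℕ}

theorem thermalFF_isMeromorphic (hov : Overlap S0 Sn) (ε : ℤˣ) (a b : Spins m) :
    IsMeromorphic fun ξ : Fin m → ℂ => thermalFF ε S0 Sn ξ a b := by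
  rcases Int.units_eq_one_or ε with rfl | rfl
  · exact entFF_isMeromorphic Sn.toEnt S0.toEnt (by rw [overlap_toEnt]; exact hov.2)
      (theta_trace_ne_zero _) a b fun ξ hξ => by rw [thermalFF_one hξ]
  · exact entFF_isMeromorphic S0.toEnt Sn.toEnt (by rw [overlap_toEnt]; exact hov.1)
      (theta_trace_ne_zero _) a b fun ξ hξ => by rw [thermalFF_neg_one hξ]

theorem thermalFF_meromorphicOn (ε : ℤˣ) (ξ : Fin m → ℂ) (j : Fin m) (a b : Spins m) :
    MeromorphicOn (fun z => thermalFF ε S0 Sn (Function.update ξ j z) a b) Set.univ := by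
  unfold thermalFF
  split_ifs
  · exact ffMatrix_meromorphicOn Sn S0 ξ j a b
  · exact ffMatrix_meromorphicOn S0 Sn ξ j a b

theorem regularAt_snoc {ξ : Fin m → ℂ} {z : ℂ} (hξ : ∀ j, RegularAt γ σ ν (ξ j))
    (hz : RegularAt γ σ ν z) (j : Fin (m + 1)) :
    RegularAt γ σ ν ((Fin.snoc ξ z : Fin (m + 1) → ℂ) j) := by
  refine Fin.lastCases ?_ (fun k => ?_) j
  · rwa [Fin.snoc_last]
  · rw [Fin.snoc_castSucc]
    exact hξ k

theorem tendsto_thermalFF_one_snoc {F : Filter ℝ} (hF : F = atTop ∨ F = atBot) (ξ : Fin m → ℂ)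
    (hξ : Admissible 1 S0 Sn ξ) :
    Tendsto (fun z : ℂ => thermalFF 1 S0 Sn (Fin.snoc ξ z : Fin (m + 1) → ℂ))
      (comap Complex.im F) (𝓝 (tensorLast (thermalFF 1 S0 Sn ξ)
        ((theta ((h / T : ℝ) : ℂ)).trace⁻¹ • theta ((h / T : ℝ) : ℂ)))) := by
  obtain ⟨t, ht, hF'⟩ := tendsto_exp_comap_im hF
  rw [thermalFF_one hξ.regular]
  refine (tendsto_entFF_snoc ht hF' Sn.toEnt S0.toEnt (theta_trace_ne_zero _) ξ).congr' ?_
  filter_upwards [eventually_regularAt_comap_im (ν := ν) (γ := γ) (σ := σ) hF] with z hz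
  rw [thermalFF_one (regularAt_snoc hξ.regular hz)]

theorem tendsto_thermalFF_neg_one_snoc {F : Filter ℝ} (hF : F = atTop ∨ F = atBot)
    (ξ : Fin m → ℂ) (hξ : Admissible (-1) S0 Sn ξ) :
    Tendsto (fun z : ℂ => thermalFF (-1) S0 Sn (Fin.snoc ξ z : Fin (m + 1) → ℂ))
      (comap Complex.im F) (𝓝 (tensorLast (thermalFF (-1) S0 Sn ξ)
        ((theta ((h' / T : ℝ) : ℂ)).trace⁻¹ • theta ((h' / T : ℝ) : ℂ)))) := by
  obtain ⟨t, ht, hF'⟩ := tendsto_exp_comap_im hF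
  rw [thermalFF_neg_one hξ.regular]
  refine (tendsto_entFF_snoc ht hF' S0.toEnt Sn.toEnt (theta_trace_ne_zero _) ξ).congr' ?_
  filter_upwards [eventually_regularAt_comap_im (ν := ν) (γ := γ) (σ := σ) hF] with z hz
  rw [thermalFF_neg_one (regularAt_snoc hξ.regular hz)]

end Meromorphy

/-! ## The monodromy matrix at the special points -/

section SpecialPoints

variable {η : ℂ} {M : ℕ}

/-- The matrix unit `E_{x,y}` in the factor `q`. -/
def unitOp {n : ℕ} (q : Fin n) (x y : Fin 2) : Op n := siteOp q (Matrix.single x y 1)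

theorem unitOp_mul {n : ℕ} (q : Fin n) (x y z w : Fin 2) :
    unitOp q x y * unitOp q z w = if y = z then unitOp q x w else 0 := by
  have h1 : unitOp q x y * unitOp q z w =
      siteAlgHom q (Matrix.single x y 1 * Matrix.single z w 1) := (map_mul (siteAlgHom q) _ _).symm
  rw [h1]
  split_ifs with h
  · rw [h, Matrix.single_mul_single_same, one_mul]
    rfl
  · rw [Matrix.single_mul_single_of_ne _ _ _ _ h, map_zero]

theorem unitOp_add {n : ℕ} (q : Fin n) : unitOp q 0 0 + unitOp q 1 1 = 1 := by
  have h1 : unitOp q 0 0 + unitOp q 1 1 =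
      siteAlgHom q (Matrix.single 0 0 1 + Matrix.single 1 1 1) := (map_add (siteAlgHom q) _ _).symm
  have h2 : (Matrix.single 0 0 1 + Matrix.single 1 1 1 : Matrix (Fin 2) (Fin 2) ℂ) = 1 := by
    ext a b
    fin_cases a <;> fin_cases b <;> simp
  rw [h1, h2, map_one]

/-- At `u = 0` the weights are `a = c` and `b = 0`: the Lax matrix is a multiple of the permutation.
-/
theorem laxOp_zero (q : Fin M) (a b : Fin 2) :
    laxOp η q 0 a b = Complex.sin η • unitOp q b a := by
  have h1 : laxMat η 0 a b = Complex.sin η • Matrix.single b a 1 := by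
    ext s t
    simp only [laxMat, entR, sixVertex]
    fin_cases a <;> fin_cases b <;> fin_cases s <;> fin_cases t <;> simp
  exact (congrArg (siteAlgHom q) h1).trans (map_smul (siteAlgHom q) _ _)

/-- At `u = -η` the weights are `a = 0` and `b = -c`: the Lax matrix is a multiple of `P - 1`, hence
of the projector onto the singlet. -/
theorem laxOp_neg (q : Fin M) (a b : Fin 2) :
    laxOp η q (-η) a b = Complex.sin η • (unitOp q b a - if a = b then 1 else 0) := by
  have h1 : laxMat η (-η) a b =
      Complex.sin η • (Matrix.single b a 1 - if a = b then 1 else 0) := by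
    ext s t
    simp only [laxMat, entR, sixVertex]
    fin_cases a <;> fin_cases b <;> fin_cases s <;> fin_cases t <;> simp
  refine (congrArg (siteAlgHom q) h1).trans ?_
  rw [map_smul, map_sub, apply_ite (siteAlgHom q), map_one, map_zero]
  rfl

theorem exists_entMono_eq_mul (hM : 0 < M) (ν : Fin M → ℂ) (l : ℂ) :
    ∃ Z : Matrix (Fin 2) (Fin 2) (Op M),
      entMono η ν l = Z * laxOp η ⟨0, hM⟩ (ν ⟨0, hM⟩ - l) ∧
        ∀ x y a b, Commute (unitOp ⟨0, hM⟩ x y) (Z a b) := by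
  obtain ⟨M, rfl⟩ := Nat.exists_eq_succ_of_ne_zero hM.ne'
  refine ⟨(List.ofFn fun j : Fin M => laxOp η j.succ (ν j.succ - l)).reverse.prod, ?_,
    fun x y a b => ?_⟩
  · rw [entMono, List.ofFn_succ, List.reverse_cons, List.prod_append, List.prod_singleton]
    rfl
  · refine commute_prod_apply _ (fun X hX c d => ?_) a b
    rw [List.mem_reverse, List.mem_ofFn] at hX
    obtain ⟨j, rfl⟩ := hX
    exact siteOp_commute (Fin.succ_ne_zero j).symm _ _

/-- The rightmost Lax matrix is a permutation, which exposes the column index as a matrix unit in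
the first quantum space; the product of matrix units selects from the trace the summand with row
index `a`. -/
theorem twMono_special (hM : 0 < M) (ν : Fin M → ℂ) (κ : ℂ) (a b : Fin 2) :
    twMono η ν κ (ν ⟨0, hM⟩) a b =
      unitOp ⟨0, hM⟩ b a * twTransfer η ν κ (ν ⟨0, hM⟩) := by
  obtain ⟨Z, hZ, hcomm⟩ := exists_entMono_eq_mul (η := η) hM ν (ν ⟨0, hM⟩)
  rw [sub_self] at hZ
  have hmul : ∀ x y c d (W : Op M), unitOp ⟨0, hM⟩ x y * (Z c d * W) =
      Z c d * (unitOp ⟨0, hM⟩ x y * W) := by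
    intro x y c d W
    rw [← mul_assoc, (hcomm x y c d).eq, mul_assoc]
  simp only [twTransfer_eq_sum, twMono_apply, hZ, Matrix.mul_apply, laxOp_zero, Fin.sum_univ_two]
  fin_cases a <;> fin_cases b <;>
    simp [mul_add, hmul, unitOp_mul]

/-- The rightmost Lax matrix is antisymmetric in the auxiliary and the first quantum index, so a
matrix unit multiplied from the right only redistributes the column index. -/
theorem twMono_crossed_special (hM : 0 < M) (ν : Fin M → ℂ) (κ : ℂ) (a c x y : Fin 2) :
    twMono η ν κ (ν ⟨0, hM⟩ + η) a c * unitOp ⟨0, hM⟩ x y =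
      (if y = x then twMono η ν κ (ν ⟨0, hM⟩ + η) a c else 0) -
        if y = c then twMono η ν κ (ν ⟨0, hM⟩ + η) a x else 0 := by
  obtain ⟨Z, hZ, -⟩ := exists_entMono_eq_mul (η := η) hM ν (ν ⟨0, hM⟩ + η)
  rw [sub_add_cancel_left] at hZ
  simp only [twMono_apply, hZ, Matrix.mul_apply, laxOp_neg, Fin.sum_univ_two]
  have h1 := unitOp_add (⟨0, hM⟩ : Fin M)
  rw [← h1]
  fin_cases a <;> fin_cases c <;> fin_cases x <;> fin_cases y <;>
    simp [add_mul, mul_assoc, unitOp_mul, smul_add] <;> abel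

theorem twMono_crossed_eq (hM : 0 < M) (ν : Fin M → ℂ) (κ : ℂ) (x y : Fin 2) :
    twMono η ν κ (ν ⟨0, hM⟩ + η) y x = twTransfer η ν κ (ν ⟨0, hM⟩ + η) *
      ((if y = x then 1 else 0) - unitOp ⟨0, hM⟩ x y) := by
  rw [twTransfer_eq_sum, mul_sub, Finset.sum_mul, Finset.sum_mul]
  simp only [twMono_crossed_special, Finset.sum_sub_distrib, Finset.sum_ite_eq, Finset.mem_univ,
    if_true, mul_ite, mul_one, mul_zero, sub_sub_cancel]

/-- The matrix of operators `Π^a_b = E_{b,a}` in the factor `q`. -/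
def unitMat {n : ℕ} (q : Fin n) : Matrix (Fin 2) (Fin 2) (Op n) := fun a b => unitOp q b a

/-- This trades `1 - P` between two auxiliary spaces for a local operator in the quantum space, the
one by which `twMono_special` represents the monodromy matrix at the point shifted by `-η`. -/
theorem fstMat_twMono_crossed (hM : 0 < M) (ν : Fin M → ℂ) (κ : ℂ) :
    fstMat (twMono η ν κ (ν ⟨0, hM⟩ + η)) * (1 - permMat).map (algebraMap ℂ (Op M)) =
      fstMat (twMono η ν κ (ν ⟨0, hM⟩ + η)) * sndMat (unitMat ⟨0, hM⟩) := by
  ext1 s t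
  rw [mul_map_algebraMap_apply, fstMat_mul_sndMat_apply, unitMat, twMono_crossed_special]
  simp only [Matrix.sub_apply, sub_smul, Finset.sum_sub_distrib]
  congr 1
  · rw [Finset.sum_eq_single t]
    · rw [Matrix.one_apply_eq, one_smul, fstMat]
    · intro k _ hk
      rw [Matrix.one_apply_ne hk, zero_smul]
    · simp
  · rw [Finset.sum_eq_single t.swap]
    · rw [permMat, if_pos rfl, one_smul, fstMat]
      rfl
    · intro k _ hk
      rw [permMat, if_neg hk, zero_smul]
    · simp

/-! ### Non-vanishing of the eigenvalues -/

theorem isUnit_laxMat {u : ℂ} (h1 : Complex.sin (η + u) ≠ 0) (h2 : Complex.sin (η - u) ≠ 0) :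
    IsUnit (laxMat η u) := by
  have key : ∀ u, laxMat η u * laxMat η (-u) =
      (Complex.sin (η + u) * Complex.sin (η - u)) • 1 := by
    intro u
    ext a b s t
    have h3 := congrFun (congrFun (entR_mul_entR_neg η u) (a, s)) (b, t)
    rw [Matrix.mul_apply, Fintype.sum_prod_type] at h3
    rw [Matrix.mul_apply, Matrix.sum_apply]
    simp only [Matrix.mul_apply]
    refine h3.trans ?_
    simp only [Matrix.smul_apply, Matrix.one_apply, Prod.mk.injEq]
    by_cases hab : a = b <;> by_cases hst : s = t <;> simp [hab, hst, Matrix.one_apply]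
  have hc : Complex.sin (η + u) * Complex.sin (η - u) ≠ 0 := mul_ne_zero h1 h2
  have hl := key u
  have hr := key (-u)
  rw [neg_neg, ← sub_eq_add_neg, sub_neg_eq_add, mul_comm (Complex.sin _)] at hr
  refine ⟨⟨laxMat η u, (Complex.sin (η + u) * Complex.sin (η - u))⁻¹ • laxMat η (-u), ?_, ?_⟩, rfl⟩
  · rw [Matrix.mul_smul, hl, smul_smul, inv_mul_cancel₀ hc, one_smul]
  · rw [Matrix.smul_mul, hr, smul_smul, inv_mul_cancel₀ hc, one_smul]

/-- Crossing symmetry, here for the transposition in the auxiliary space. -/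
theorem laxMat_transpose (u : ℂ) : (laxMat η u)ᵀ =
    -(sigmaY.map (algebraMap ℂ (Matrix (Fin 2) (Fin 2) ℂ)) * laxMat η (-η - u) *
      sigmaY.map (algebraMap ℂ (Matrix (Fin 2) (Fin 2) ℂ))) := by
  have e1 : Complex.sin (-η - u + η) = -Complex.sin u := by
    rw [← Complex.sin_neg]; congr 1; ring
  have e2 : Complex.sin (-η - u) = -Complex.sin (u + η) := by
    rw [← Complex.sin_neg]; congr 1; ring
  refine Matrix.ext fun a b => ?_
  rw [Matrix.neg_apply, mul_map_algebraMap_apply]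
  simp only [map_algebraMap_mul_apply, Fin.sum_univ_two, Matrix.transpose_apply]
  ext s t
  simp only [Matrix.add_apply, Matrix.smul_apply, Matrix.neg_apply, laxMat, entR, sixVertex, e1,
    e2, smul_eq_mul]
  fin_cases a <;> fin_cases b <;> fin_cases s <;> fin_cases t <;> simp [sigmaY] <;>
    first
      | ring1
      | linear_combination Complex.sin η * Complex.I_mul_I
      | linear_combination -Complex.sin η * Complex.I_mul_I
      | linear_combination Complex.sin u * Complex.I_mul_I
      | linear_combination -Complex.sin u * Complex.I_mul_I
      | linear_combination Complex.sin (u + η) * Complex.I_mul_I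

theorem isUnit_laxMat_transpose {u : ℂ}
    (h2 : IsUnit (laxMat η (-η - u))) : IsUnit (laxMat η u)ᵀ := by
  have hY : IsUnit (sigmaY.map (algebraMap ℂ (Matrix (Fin 2) (Fin 2) ℂ))) :=
    (IsUnit.of_mul_eq_one _ sigmaY_mul_self).map
      (algebraMap ℂ (Matrix (Fin 2) (Fin 2) ℂ)).mapMatrix
  rw [laxMat_transpose]
  exact ((hY.mul h2).mul hY).neg

theorem isUnit_list_prod {A : Type*} [Monoid A] (L : List A) (h : ∀ x ∈ L, IsUnit x) :
    IsUnit L.prod := by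
  induction L with
  | nil => exact isUnit_one
  | cons x L ih =>
    rw [List.prod_cons]
    exact (h x (List.mem_cons_self)).mul (ih fun y hy => h y (List.mem_cons_of_mem _ hy))

theorem isUnit_entMono {ν : Fin M → ℂ} {l : ℂ} (h : ∀ j, IsUnit (laxMat η (ν j - l))) :
    IsUnit (entMono η ν l) := by
  refine isUnit_list_prod _ fun X hX => ?_
  rw [List.mem_reverse, List.mem_ofFn] at hX
  obtain ⟨j, rfl⟩ := hX
  exact (h j).map (siteAlgHom (n := M) j).mapMatrix

/-- Over a non-commutative ring transposition need not reverse products. It does so here because the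
entries of different factors commute. -/
theorem transpose_prod_reverse_ofFn {A : Type*} [Ring A] {m : ℕ}
    (X : Fin m → Matrix (Fin 2) (Fin 2) A)
    (hc : ∀ i j, i ≠ j → ∀ a b c d, Commute (X i a b) (X j c d)) :
    ((List.ofFn X).reverse.prod)ᵀ = (List.ofFn fun j => (X j)ᵀ).prod := by
  induction m with
  | zero => simp
  | succ m ih =>
    rw [List.ofFn_succ, List.reverse_cons, List.prod_append, List.prod_singleton, List.ofFn_succ,
      List.prod_cons, ← ih (fun j => X j.succ) fun i j hij => hc _ _ fun h =>
        hij (Fin.succ_injective _ h)]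
    ext a b
    rw [Matrix.transpose_apply, Matrix.mul_apply, Matrix.mul_apply]
    refine Finset.sum_congr rfl fun c _ => ?_
    rw [Matrix.transpose_apply, Matrix.transpose_apply]
    refine (commute_prod_apply _ (fun Y hY x y => ?_) b c).symm.eq
    rw [List.mem_reverse, List.mem_ofFn] at hY
    obtain ⟨j, rfl⟩ := hY
    exact hc 0 j.succ (Fin.succ_ne_zero j).symm _ _ _ _

theorem isUnit_entMono_transpose {ν : Fin M → ℂ} {l : ℂ}
    (h : ∀ j, IsUnit (laxMat η (-η - (ν j - l)))) : IsUnit (entMono η ν l)ᵀ := by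
  rw [entMono, transpose_prod_reverse_ofFn _ fun i j hij => laxOp_commute hij _ _]
  refine isUnit_list_prod _ fun X hX => ?_
  rw [List.mem_ofFn] at hX
  obtain ⟨j, rfl⟩ := hX
  exact (isUnit_laxMat_transpose (h j)).map (siteAlgHom (n := M) j).mapMatrix

theorem theta_apply_self_ne_zero (κ : ℂ) (a : Fin 2) : theta κ a a ≠ 0 := by
  rw [theta_apply_eq_exp]
  exact Complex.exp_ne_zero _

namespace EntState

variable {ν : Fin M → ℂ} {κ : ℂ}

/-- If the eigenvalue vanished, `twMono_special` would make all entries of the monodromy matrix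
annihilate the ket, although the monodromy matrix has a left inverse. -/
theorem eig_special_ne_zero (hM : 0 < M) (S : EntState η ν κ)
    (h : ∀ j, IsUnit (laxMat η (ν j - ν ⟨0, hM⟩))) : S.eig (ν ⟨0, hM⟩) ≠ 0 := by
  intro h0
  obtain ⟨u, hu⟩ := isUnit_entMono h
  have hz : ∀ a b, entMono η ν (ν ⟨0, hM⟩) a b *ᵥ S.ket = 0 := by
    intro a b
    have h1 : twMono η ν κ (ν ⟨0, hM⟩) a b *ᵥ S.ket = 0 := by
      rw [twMono_special, ← Matrix.mulVec_mulVec, S.ket_eigen, h0, zero_smul, Matrix.mulVec_zero]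
    rw [twMono_apply, Matrix.smul_mulVec] at h1
    exact (smul_eq_zero.1 h1).resolve_left (theta_apply_self_ne_zero κ a)
  have h2 := congrFun (congrFun u.inv_mul (0 : Fin 2)) (0 : Fin 2)
  rw [Matrix.mul_apply, hu, Matrix.one_apply_eq] at h2
  apply S.ket_ne_zero
  rw [← Matrix.one_mulVec S.ket, ← h2, Matrix.sum_mulVec]
  refine Finset.sum_eq_zero fun c _ => ?_
  rw [← Matrix.mulVec_mulVec, hz, Matrix.mulVec_zero]

/-- The mirror argument for the bra, with the transfer matrix to the left of the local operator. The
monodromy matrix contains a singlet projector at this point, but its transpose in the auxiliary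
space is invertible: crossing maps `-η` to the permutation point `0`. -/
theorem eig_crossed_special_ne_zero (hM : 0 < M) (S : EntState η ν κ)
    (h : ∀ j, IsUnit (laxMat η (ν ⟨0, hM⟩ - ν j))) : S.eig (ν ⟨0, hM⟩ + η) ≠ 0 := by
  intro h0
  obtain ⟨u, hu⟩ := isUnit_entMono_transpose (η := η) (ν := ν) (l := ν ⟨0, hM⟩ + η) fun j => by
    convert h j using 2
    ring
  have hz : ∀ a b, S.bra ᵥ* entMono η ν (ν ⟨0, hM⟩ + η) a b = 0 := by
    intro a b
    have h1 : S.bra ᵥ* twMono η ν κ (ν ⟨0, hM⟩ + η) a b = 0 := by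
      rw [twMono_crossed_eq, ← Matrix.vecMul_vecMul, S.bra_eigen, h0, zero_smul,
        Matrix.zero_vecMul]
    rw [twMono_apply, Matrix.vecMul_smul] at h1
    exact (smul_eq_zero.1 h1).resolve_left (theta_apply_self_ne_zero κ a)
  have h2 := congrFun (congrFun u.mul_inv (0 : Fin 2)) (0 : Fin 2)
  rw [Matrix.mul_apply, hu, Matrix.one_apply_eq] at h2
  apply S.bra_ne_zero
  rw [← Matrix.vecMul_one S.bra, ← h2, Matrix.vecMul_sum]
  refine Finset.sum_eq_zero fun c _ => ?_
  rw [← Matrix.vecMul_vecMul, Matrix.transpose_apply, hz, Matrix.zero_vecMul]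

end EntState

end SpecialPoints

/-! ## The algebra behind the reduced `q`-Knizhnik–Zamolodchikov equation -/

section Algebraic

variable {A : Type*} [Ring A] {m : ℕ}

/-- The element `z` is carried through the `s j`, each passage being paid for by one `r j`. The `r
j` with other indices commute with `s j`, so they can be collected into one product. -/
theorem prod_braid {B : Type*} [Monoid B] {m : ℕ} {r s : Fin m → B} {z : B}
    (h1 : ∀ j, r j * (z * s j) = s j * z * r j) (h2 : ∀ j k, k ≠ j → r j * s k = s k * r j) :
    (List.ofFn r).reverse.prod * (z * (List.ofFn s).prod) =
      (List.ofFn s).prod * z * (List.ofFn r).reverse.prod := by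
  induction m with
  | zero => simp
  | succ m ih =>
    have hs : ∀ k : Fin m, r 0 * s k.succ = s k.succ * r 0 := fun k =>
      h2 0 k.succ (Fin.succ_ne_zero k)
    have hr : ∀ k : Fin m, s 0 * r k.succ = r k.succ * s 0 := fun k =>
      (h2 k.succ 0 (Fin.succ_ne_zero k).symm).symm
    have e1 := prod_ofFn_intertwine (K := r 0) (f := fun k : Fin m => s k.succ)
      (g := fun k => s k.succ) hs
    have e2 := prod_ofFn_reverse_intertwine (K := s 0) (f := fun k : Fin m => r k.succ)
      (g := fun k => r k.succ) hr
    have e3 := ih (r := fun k => r k.succ) (s := fun k => s k.succ) (fun j => h1 j.succ)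
      fun j k hk => h2 _ _ fun h => hk (Fin.succ_injective _ h)
    simp only [List.ofFn_succ, List.reverse_cons, List.prod_append, List.prod_cons,
      List.prod_nil, mul_one]
    generalize (List.ofFn fun k : Fin m => s k.succ).prod = p at *
    generalize (List.ofFn fun k : Fin m => r k.succ).reverse.prod = q at *
    calc q * r 0 * (z * (s 0 * p)) = q * (r 0 * (z * s 0)) * p := by simp only [mul_assoc]
      _ = q * s 0 * z * (r 0 * p) := by rw [h1]; simp only [mul_assoc]
      _ = s 0 * (q * (z * p)) * r 0 := by rw [e1, ← e2]; simp only [mul_assoc]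
      _ = s 0 * p * z * (q * r 0) := by rw [e3]; simp only [mul_assoc]

theorem idMat_tensorMat_snoc (X : Fin m → Matrix (Fin 2) (Fin 2) A)
    (Y : Matrix (Fin 2) (Fin 2) A) :
    idMat (tensorMat (Fin.snoc X Y : Fin (m + 1) → Matrix (Fin 2) (Fin 2) A)) =
      (List.ofFn fun j : Fin m => siteMat j.castSucc.succ (X j)).prod *
        siteMat (Fin.last (m + 1)) Y := by
  rw [tensorMat_eq_prod]
  change idHom (m + 1) _ = _
  rw [map_list_prod, List.map_ofFn, List.ofFn_succ', List.concat_eq_append, List.prod_append,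
    List.prod_singleton]
  simp only [Function.comp, Fin.snoc_castSucc, Fin.snoc_last]
  change (List.ofFn fun j : Fin m => idMat (siteMat j.castSucc (X j))).prod *
    idMat (siteMat (Fin.last m) Y) = _
  simp only [idMat_siteMat, Fin.succ_last]

theorem siteMat_zero_commute_idMat {n : ℕ} {X : Matrix (Fin 2) (Fin 2) A}
    {Z : Matrix (Spins n) (Spins n) A} (h : ∀ a b s t, Commute (X a b) (Z s t)) :
    siteMat 0 X * idMat Z = idMat Z * siteMat 0 X := by
  refine Matrix.ext fun s t => ?_
  rw [siteMat_zero_mul_idMat, idMat_mul_siteMat_zero, (h _ _ _ _).eq]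

variable [Algebra ℂ A]

theorem sndMat_mul_permMat (X : Matrix (Fin 2) (Fin 2) A) :
    sndMat X * permMat.map (algebraMap ℂ A) = permMat.map (algebraMap ℂ A) * fstMat X := by
  refine Matrix.ext fun s t => ?_
  rw [map_algebraMap_mul_apply, mul_map_algebraMap_apply, Finset.sum_eq_single t.swap,
    Finset.sum_eq_single s.swap]
  · simp [permMat, sndMat, fstMat]
  · intro k _ hk
    rw [permMat, if_neg fun h' => hk (by rw [h', Prod.swap_swap]), zero_smul]
  · simp
  · intro k _ hk
    rw [permMat, if_neg hk, zero_smul]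
  · simp

/-- `P_{0,m} R_{0,m-1} ⋯ R_{0,1} θ_0(κ)`. -/
def perpMono (R : Fin m → Op2) (κ : ℂ) : Op (m + 2) :=
  pairOp 0 (Fin.last (m + 1)) permMat *
    (List.ofFn fun j : Fin m => (pairOp 0 j.castSucc.succ (R j) : Op (m + 2))).reverse.prod *
      siteOp 0 (theta κ)

theorem theta_mul_theta (κ κ' : ℂ) : theta κ * theta κ' = theta (κ + κ') := by
  rw [theta_eq_diagonal, theta_eq_diagonal, theta_eq_diagonal, Matrix.diagonal_mul_diagonal]
  congr 1
  funext c
  rw [← Complex.exp_add]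
  ring_nf

theorem theta_zero : theta 0 = 1 := by
  rw [theta_eq_diagonal]
  simp

/-- The operator identity behind the `q`-Knizhnik–Zamolodchikov equation. The factor `Y` in the last
space is moved to space `0` by the permutation, leaves `Z` behind because of `hZ`, and is carried to
the front by the `RTT` relations. -/
theorem perpMono_intertwine {R : Fin m → Op2} {X : Fin m → Matrix (Fin 2) (Fin 2) A}
    {Y Z : Matrix (Fin 2) (Fin 2) A} (hR : ∀ j, RTT (R j) Y (X j))
    (hZ : fstMat Y * (1 - permMat).map (algebraMap ℂ A) = fstMat Y * sndMat Z) (κ κ' : ℂ) :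
    idMat (tensorMat (Fin.snoc X Y : Fin (m + 1) → Matrix (Fin 2) (Fin 2) A)) *
        (pairOp 0 (Fin.last (m + 1)) (1 - permMat) * perpMono R κ').map (algebraMap ℂ A) =
      (perpMono R κ).map (algebraMap ℂ A) *
        (siteMat 0 ((theta (-κ)).map (algebraMap ℂ A) * Y * (theta κ').map (algebraMap ℂ A)) *
          idMat (tensorMat (Fin.snoc X Z : Fin (m + 1) → Matrix (Fin 2) (Fin 2) A))) := by
  have h0n : (0 : Fin (m + 2)) ≠ Fin.last (m + 1) := (Fin.last_pos).ne
  have hj0 : ∀ j : Fin m, j.castSucc.succ ≠ (0 : Fin (m + 2)) := fun j => Fin.succ_ne_zero _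
  have hjn : ∀ j : Fin m, j.castSucc.succ ≠ Fin.last (m + 1) := fun j h => by
    rw [← Fin.succ_last] at h
    exact (Fin.castSucc_lt_last j).ne (Fin.succ_injective _ h)
  have hinj : ∀ j k : Fin m, j ≠ k → j.castSucc.succ ≠ k.castSucc.succ := fun j k hjk h =>
    hjk (Fin.castSucc_injective _ (Fin.succ_injective _ h))
  have hscal : ∀ (B : Type) [Fintype B] (K : Matrix B B ℂ) (a b : B) (x : A),
      Commute (K.map (algebraMap ℂ A) a b) x := fun B _ K a b x => Algebra.commutes _ _
  have hperp : ∀ κ, (perpMono R κ).map (algebraMap ℂ A) =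
      pairMat 0 (Fin.last (m + 1)) (permMat.map (algebraMap ℂ A)) *
        (List.ofFn fun j : Fin m => (pairMat 0 j.castSucc.succ ((R j).map (algebraMap ℂ A)) :
          Matrix (Spins (m + 2)) (Spins (m + 2)) A)).reverse.prod *
        siteMat 0 ((theta κ).map (algebraMap ℂ A)) := by
    intro κ
    rw [perpMono, Matrix.map_mul, Matrix.map_mul, ← pairMat_map_algebraMap,
      ← siteMat_map_algebraMap]
    congr 2
    change (algebraMap ℂ A).mapMatrix _ = _
    rw [map_list_prod, List.map_reverse, List.map_ofFn]
    simp only [pairMat_map_algebraMap]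
    rfl
  rw [Matrix.map_mul, hperp, hperp, idMat_tensorMat_snoc, ← pairMat_map_algebraMap, siteMat_mul,
    siteMat_mul]
  have h7 : siteMat 0 ((theta κ').map (algebraMap ℂ A)) *
      idMat (tensorMat (Fin.snoc X Z : Fin (m + 1) → Matrix (Fin 2) (Fin 2) A)) =
      idMat (tensorMat (Fin.snoc X Z : Fin (m + 1) → Matrix (Fin 2) (Fin 2) A)) *
        siteMat 0 ((theta κ').map (algebraMap ℂ A)) :=
    siteMat_zero_commute_idMat fun a b s t => hscal _ _ _ _ _
  -- The twist of the left `perpMono` does not occur in the product to be moved. It is inserted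
  -- together with its inverse, which explains `theta (-κ)` in the statement.
  have hθ : siteMat 0 ((theta κ).map (algebraMap ℂ A)) *
      siteMat 0 ((theta (-κ)).map (algebraMap ℂ A)) =
        (1 : Matrix (Spins (m + 2)) (Spins (m + 2)) A) := by
    rw [← siteMat_mul, ← Matrix.map_mul, theta_mul_theta, add_neg_cancel, theta_zero,
      Matrix.map_one _ (map_zero _) (map_one _), siteMat_one]
  have h2 : pairMat 0 (Fin.last (m + 1)) (permMat.map (algebraMap ℂ A)) *
      (List.ofFn fun j : Fin m => siteMat j.castSucc.succ (X j)).prod =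
      (List.ofFn fun j : Fin m => siteMat j.castSucc.succ (X j)).prod *
        pairMat 0 (Fin.last (m + 1)) (permMat.map (algebraMap ℂ A)) :=
    prod_ofFn_intertwine fun j => pairMat_commute_siteMat h0n (hj0 j) (hjn j)
      fun _ _ _ _ => hscal _ _ _ _ _
  have h3 : siteMat (Fin.last (m + 1)) Y *
      pairMat 0 (Fin.last (m + 1)) (permMat.map (algebraMap ℂ A)) =
      pairMat 0 (Fin.last (m + 1)) (permMat.map (algebraMap ℂ A)) * siteMat 0 Y := by
    rw [← pairMat_sndMat h0n, ← pairMat_fstMat h0n, ← pairMat_mul h0n, ← pairMat_mul h0n,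
      sndMat_mul_permMat]
  have h4 : siteMat 0 Y * pairMat 0 (Fin.last (m + 1)) ((1 - permMat).map (algebraMap ℂ A)) =
      siteMat 0 Y * siteMat (Fin.last (m + 1)) Z := by
    rw [← pairMat_sndMat h0n, ← pairMat_fstMat h0n, ← pairMat_mul h0n, ← pairMat_mul h0n, hZ]
  have h5 := prod_braid (z := siteMat 0 Y)
    (r := fun j : Fin m => (pairMat 0 j.castSucc.succ ((R j).map (algebraMap ℂ A)) :
      Matrix (Spins (m + 2)) (Spins (m + 2)) A))
    (s := fun j : Fin m => siteMat j.castSucc.succ (X j))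
    (fun j => by
      rw [← pairMat_sndMat (hj0 j).symm (X j), ← pairMat_fstMat (hj0 j).symm Y,
        ← pairMat_mul (hj0 j).symm, ← pairMat_mul (hj0 j).symm, ← pairMat_mul (hj0 j).symm,
        ← pairMat_mul (hj0 j).symm, hR j])
    (fun j k hk => pairMat_commute_siteMat (hj0 j).symm (hj0 k) (hinj k j hk)
      fun _ _ _ _ => hscal _ _ _ _ _)
  have h6 : siteMat (Fin.last (m + 1)) Z *
      (List.ofFn fun j : Fin m => (pairMat 0 j.castSucc.succ ((R j).map (algebraMap ℂ A)) :
          Matrix (Spins (m + 2)) (Spins (m + 2)) A)).reverse.prod =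
      (List.ofFn fun j : Fin m => (pairMat 0 j.castSucc.succ ((R j).map (algebraMap ℂ A)) :
          Matrix (Spins (m + 2)) (Spins (m + 2)) A)).reverse.prod *
        siteMat (Fin.last (m + 1)) Z :=
    prod_ofFn_reverse_intertwine fun j => ((pairMat_commute_siteMat (hj0 j).symm h0n.symm
      (hjn j).symm fun _ _ _ _ => hscal _ _ _ _ _).eq).symm
  have h8 : pairMat 0 (Fin.last (m + 1)) ((1 - permMat).map (algebraMap ℂ A)) *
      pairMat 0 (Fin.last (m + 1)) (permMat.map (algebraMap ℂ A)) =
      pairMat 0 (Fin.last (m + 1)) (permMat.map (algebraMap ℂ A)) *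
        pairMat 0 (Fin.last (m + 1)) ((1 - permMat).map (algebraMap ℂ A)) := by
    rw [← pairMat_mul h0n, ← pairMat_mul h0n, ← Matrix.map_mul, ← Matrix.map_mul, sub_mul, mul_sub,
      one_mul, mul_one]
  rw [mul_assoc _ (siteMat 0 ((theta κ').map _)), h7, idMat_tensorMat_snoc]
  generalize (List.ofFn fun j : Fin m => siteMat j.castSucc.succ (X j)).prod = p at *
  generalize (List.ofFn fun j : Fin m => (pairMat 0 j.castSucc.succ ((R j).map (algebraMap ℂ A)) :
    Matrix (Spins (m + 2)) (Spins (m + 2)) A)).reverse.prod = Q at *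
  generalize (pairMat 0 (Fin.last (m + 1)) (permMat.map (algebraMap ℂ A)) : Matrix (Spins (m + 2)) (Spins (m + 2)) A) = P at *
  generalize (pairMat 0 (Fin.last (m + 1)) ((1 - permMat).map (algebraMap ℂ A)) : Matrix (Spins (m + 2)) (Spins (m + 2)) A) = K at *
  generalize (siteMat 0 ((theta κ').map (algebraMap ℂ A)) : Matrix (Spins (m + 2)) (Spins (m + 2)) A) = θ' at *
  generalize (siteMat 0 ((theta κ).map (algebraMap ℂ A)) : Matrix (Spins (m + 2)) (Spins (m + 2)) A) = θ at *
  generalize (siteMat 0 ((theta (-κ)).map (algebraMap ℂ A)) : Matrix (Spins (m + 2)) (Spins (m + 2)) A) = θi at *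
  generalize (siteMat 0 Y : Matrix (Spins (m + 2)) (Spins (m + 2)) A) = S at *
  generalize (siteMat (Fin.last (m + 1)) Y : Matrix (Spins (m + 2)) (Spins (m + 2)) A) = Sn at *
  generalize (siteMat (Fin.last (m + 1)) Z : Matrix (Spins (m + 2)) (Spins (m + 2)) A) = Zn at *
  calc p * Sn * (K * (P * Q * θ')) = p * Sn * (K * P) * Q * θ' := by simp only [mul_assoc]
    _ = p * (Sn * P) * K * Q * θ' := by rw [h8]; simp only [mul_assoc]
    _ = p * P * (S * K) * Q * θ' := by rw [h3]; simp only [mul_assoc]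
    _ = P * p * S * (Zn * Q) * θ' := by rw [h4, h2]; simp only [mul_assoc]
    _ = P * (p * S * Q) * Zn * θ' := by rw [h6]; simp only [mul_assoc]
    _ = P * Q * 1 * S * p * Zn * θ' := by rw [← h5]; simp only [mul_assoc, one_mul]
    _ = P * Q * θ * (θi * S * (p * Zn * θ')) := by rw [← hθ]; simp only [mul_assoc]

end Algebraic

/-! ## The reduced `q`-Knizhnik–Zamolodchikov equation -/

section RqKZ

variable {η : ℂ} {M : ℕ} {ν : Fin M → ℂ} {κ κ' : ℂ} {m : ℕ}

/-- At the first inhomogeneity the last monodromy matrix is a local operator times the transfer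
matrix. The latter acts on the ket, and its eigenvalue cancels the one in the denominator. -/
theorem entFF_update_special (hM : 0 < M) (SB : EntState η ν κ') (SK : EntState η ν κ)
    (h0 : SK.eig (ν ⟨0, hM⟩) ≠ 0) (ξ : Fin (m + 1) → ℂ) :
    entFF SB SK (Function.update ξ (Fin.last m) (ν ⟨0, hM⟩)) =
      ((SB.bra ⬝ᵥ SK.ket) * ∏ j : Fin m, SK.eig (ξ j.castSucc))⁻¹ •
        (tensorMat (Fin.snoc (fun j : Fin m => twMono η ν κ (ξ j.castSucc)) (unitMat ⟨0, hM⟩) :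
          Fin (m + 1) → Matrix (Fin 2) (Fin 2) (Op M))).map (matElem SB.bra SK.ket) := by
  refine Matrix.ext fun a b => ?_
  rw [Matrix.smul_apply, Matrix.map_apply, smul_eq_mul, entFF_apply, monoProd_snoc,
    Function.update_self, twMono_special, Fin.prod_univ_castSucc, Function.update_self,
    ← mul_assoc, matElem_apply, ← Matrix.mulVec_mulVec, SK.ket_eigen, Matrix.mulVec_smul,
    dotProduct_smul, smul_eq_mul, ← mul_assoc, mul_comm (SK.eig _), mul_div_mul_right _ _ h0,
    mul_comm (_⁻¹), ← div_eq_mul_inv]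
  have hne : ∀ j : Fin m, j.castSucc ≠ Fin.last m := fun j => (Fin.castSucc_lt_last j).ne
  simp only [Function.update_of_ne (hne _)]
  congr 1
  rw [matElem_apply]
  congr 2
  rw [tensorMat, List.ofFn_succ', List.concat_eq_append, List.prod_append, List.prod_singleton]
  simp only [Fin.snoc_castSucc, Fin.snoc_last, monoProd, Fin.init]
  simp only [Function.update_of_ne (hne _)]
  rfl

theorem continuousAt_entFF_update (SB : EntState η ν κ') (SK : EntState η ν κ)
    (ξ : Fin (m + 1) → ℂ) {w : ℂ} (h0 : SK.eig w ≠ 0) :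
    Tendsto (fun z => entFF SB SK (Function.update ξ (Fin.last m) z)) (𝓝 w)
      (𝓝 (entFF SB SK (Function.update ξ (Fin.last m) w))) := by
  refine tendsto_pi_nhds.2 fun a => tendsto_pi_nhds.2 fun b => ?_
  have hne : ∀ j : Fin m, j.castSucc ≠ Fin.last m := fun j => (Fin.castSucc_lt_last j).ne
  have hval : ∀ z, entFF SB SK (Function.update ξ (Fin.last m) z) a b =
      (SB.bra ⬝ᵥ ((monoProd η ν κ (Fin.init ξ) (Fin.init a) (Fin.init b) *
        twMono η ν κ z (a (Fin.last m)) (b (Fin.last m))) *ᵥ SK.ket)) /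
        ((SB.bra ⬝ᵥ SK.ket) * ∏ j : Fin m, SK.eig (ξ j.castSucc)) / SK.eig z := by
    intro z
    rw [entFF, monoProd_snoc, Function.update_self, Fin.prod_univ_castSucc, Function.update_self,
      ← mul_assoc, ← div_div, Fin.init_update_last]
    simp only [Function.update_of_ne (hne _)]
  simp only [hval]
  have hT : Continuous fun z => twMono η ν κ z (a (Fin.last m)) (b (Fin.last m)) :=
    (continuous_apply _).comp ((continuous_apply _).comp (continuous_twMono ν κ))
  have hnum : Continuous fun z => (SB.bra ⬝ᵥ ((monoProd η ν κ (Fin.init ξ) (Fin.init a)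
      (Fin.init b) * twMono η ν κ z (a (Fin.last m)) (b (Fin.last m))) *ᵥ SK.ket)) /
        ((SB.bra ⬝ᵥ SK.ket) * ∏ j : Fin m, SK.eig (ξ j.castSucc)) :=
    (continuous_const.dotProduct
      ((continuous_const.matrix_mul hT).matrix_mulVec continuous_const)).div_const _
  exact (hnum.tendsto w).div (SK.eig_differentiable.continuous.tendsto w) h0

/-- After `perpMono_intertwine` the inverse strips off the left factor. The monodromy matrix in
space `0` then stands next to the bra, and its trace gives the eigenvalue of the bra. What remains
is the form factor at the shifted point in the form of `entFF_update_special`. -/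
theorem entFF_rqKZ (hM : 0 < M) (SB : EntState η ν κ') (SK : EntState η ν κ)
    (hK : SK.eig (ν ⟨0, hM⟩ + η) ≠ 0) (hB : SB.eig (ν ⟨0, hM⟩ + η) ≠ 0)
    {ξ : Fin (m + 1) → ℂ} (hξ : ξ (Fin.last m) = ν ⟨0, hM⟩ + η) {R : Fin m → Op2}
    (hR : ∀ j, RTT (R j) (twMono η ν κ (ν ⟨0, hM⟩ + η)) (twMono η ν κ (ξ j.castSucc)))
    (hU : IsUnit (perpMono R κ)) :
    (SK.eig (ν ⟨0, hM⟩ + η) / SB.eig (ν ⟨0, hM⟩ + η)) • traceFirst ((perpMono R κ)⁻¹ *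
        (idTensor (entFF SB SK ξ) * (pairOp 0 (Fin.last (m + 1)) (1 - permMat) *
          perpMono R κ'))) =
      ((SB.bra ⬝ᵥ SK.ket) * ∏ j : Fin m, SK.eig (ξ j.castSucc))⁻¹ •
        (tensorMat (Fin.snoc (fun j : Fin m => twMono η ν κ (ξ j.castSucc)) (unitMat ⟨0, hM⟩) :
          Fin (m + 1) → Matrix (Fin 2) (Fin 2) (Op M))).map (matElem SB.bra SK.ket) := by
  set x := ν ⟨0, hM⟩ + η
  set φ := matElem SB.bra SK.ket
  set X := fun j : Fin m => twMono η ν κ (ξ j.castSucc)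
  set Z : Matrix (Spins (m + 1)) (Spins (m + 1)) (Op M) :=
    tensorMat (Fin.snoc X (unitMat ⟨0, hM⟩) : Fin (m + 1) → Matrix (Fin 2) (Fin 2) (Op M))
  set c := ((SB.bra ⬝ᵥ SK.ket) * ∏ j : Fin m, SK.eig (ξ j.castSucc))⁻¹
  set G := (theta (-κ)).map (algebraMap ℂ (Op M)) * twMono η ν κ x *
    (theta κ').map (algebraMap ℂ (Op M))
  have hF : idTensor (entFF SB SK ξ) = (c * (SK.eig x)⁻¹) •
      (idMat (tensorMat (Fin.snoc X (twMono η ν κ x) :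
        Fin (m + 1) → Matrix (Fin 2) (Fin 2) (Op M)))).map φ := by
    have e : (fun j => twMono η ν κ (ξ j)) = (Fin.snoc X (twMono η ν κ x) :
        Fin (m + 1) → Matrix (Fin 2) (Fin 2) (Op M)) := by
      funext j
      refine Fin.lastCases ?_ (fun k => ?_) j
      · rw [Fin.snoc_last, hξ]
      · rw [Fin.snoc_castSucc]
    rw [entFF_eq_smul_map, e, Fin.prod_univ_castSucc, hξ, ← mul_assoc, mul_inv]
    refine Matrix.ext fun s t => ?_
    rw [Matrix.smul_apply, Matrix.map_apply, idMat, idTensor, apply_ite φ, map_zero, smul_ite,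
      smul_zero]
    rfl
  have key := congrArg (fun W => W.map φ) (perpMono_intertwine hR (fstMat_twMono_crossed hM ν κ)
    κ κ')
  simp only [map_linear_algebraMap_mul, map_linear_mul_algebraMap] at key
  have hdet := (Matrix.isUnit_iff_isUnit_det _).1 hU
  rw [hF, Matrix.smul_mul, key, Matrix.mul_smul, Matrix.nonsing_inv_mul_cancel_left _ _ hdet]
  -- Only the diagonal enters the trace, and there the two outer twists replace `κ` by `κ'`.
  have hG : ∀ d, G d d = twMono η ν κ' x d d := by
    intro d
    have hθ : theta (-κ) d d * (theta κ d d * theta κ' d d) = theta κ' d d := by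
      rw [theta_mul_theta_apply, theta_mul_theta_apply, neg_add_cancel_left]
    have hs : ∀ e : Fin 2, e ≠ d → ∀ κ, theta κ e d = 0 := fun e he κ => by
      rw [theta_apply, if_neg he]
    have hs' : ∀ e : Fin 2, e ≠ d → ∀ κ, theta κ d e = 0 := fun e he κ => by
      rw [theta_apply, if_neg he.symm]
    change ((theta (-κ)).map (algebraMap ℂ (Op M)) * twMono η ν κ x *
      (theta κ').map (algebraMap ℂ (Op M))) d d = _
    rw [mul_map_algebraMap_apply, Finset.sum_eq_single d, map_algebraMap_mul_apply,
      Finset.sum_eq_single d, twMono_apply, twMono_apply, smul_smul, smul_smul]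
    · congr 1
      linear_combination hθ
    · intro e _ he
      rw [hs' e he, zero_smul]
    · simp
    · intro e _ he
      rw [hs e he, zero_smul]
    · simp
  refine Matrix.ext fun s t => ?_
  have htr : traceFirst ((siteMat 0 G * idMat Z).map φ) s t = SB.eig x * φ (Z s t) := by
    simp only [traceFirst, Matrix.map_apply, siteMat_zero_mul_idMat, Fin.cons_zero, Fin.tail_cons,
      hG]
    rw [← map_sum, ← Finset.sum_mul, ← twTransfer_eq_sum, matElem_apply, ← Matrix.mulVec_mulVec,
      Matrix.dotProduct_mulVec, SB.bra_eigen, smul_dotProduct, smul_eq_mul]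
    rfl
  have hsm : traceFirst ((c * (SK.eig x)⁻¹) • (siteMat 0 G * idMat Z).map φ) s t =
      (c * (SK.eig x)⁻¹) * traceFirst ((siteMat 0 G * idMat Z).map φ) s t := by
    simp only [traceFirst, Matrix.smul_apply, smul_eq_mul, Finset.mul_sum]
  rw [Matrix.smul_apply, hsm, htr, Matrix.smul_apply, Matrix.map_apply, smul_eq_mul, smul_eq_mul]
  field_simp

/-- Both sides are twice the projector onto the singlet: `P^{t_0}` projects onto a maximally
entangled vector, which `σ^y` turns into the singlet. -/
theorem pairOp_crossed_permMat {n : ℕ} {j : Fin (n + 1)} (hj : (0 : Fin (n + 1)) ≠ j) :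
    siteOp 0 sigmaY * pairOp 0 j (transposeFirst permMat) * siteOp 0 sigmaY =
      pairOp 0 j (1 - permMat) := by
  rw [siteOp_eq, ← pairMat_fstMat hj, pairOp_eq, pairOp_eq, ← pairMat_mul hj, ← pairMat_mul hj]
  congr 1
  ext ⟨a, s⟩ ⟨b, t⟩
  simp only [Matrix.mul_apply, Fintype.sum_prod_type, Fin.sum_univ_two, fstMat, transposeFirst,
    permMat, Matrix.sub_apply, Matrix.one_apply, Prod.mk.injEq, Prod.swap_prod_mk]
  fin_cases a <;> fin_cases b <;> fin_cases s <;> fin_cases t <;> simp [sigmaY]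

theorem isUnit_RMat {γ l μ : ℂ} (h1 : Complex.sin (μ - l + Complex.I * γ) ≠ 0)
    (h2 : Complex.sin (μ - l - Complex.I * γ) ≠ 0) : IsUnit (RMat γ l μ) := by
  have h3 : Complex.sin (Complex.I * γ + (μ - l)) ≠ 0 := by rwa [add_comm]
  have h4 : Complex.sin (Complex.I * γ - (μ - l)) ≠ 0 := by
    rw [← neg_ne_zero, ← Complex.sin_neg, neg_sub]
    exact h2
  rw [RMat_eq_smul_entR γ l μ h1]
  refine IsUnit.of_mul_eq_one (((Complex.sin (Complex.I * γ + (μ - l)) *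
    Complex.sin (Complex.I * γ - (μ - l)))⁻¹ * Complex.sin (μ - l + Complex.I * γ)) •
      entR (Complex.I * γ) (-(μ - l))) ?_
  rw [smul_mul_smul_comm, entR_mul_entR_neg, smul_smul]
  convert one_smul ℂ (1 : Op2) using 2
  field_simp

theorem isUnit_perpMono {R : Fin m → Op2} (hR : ∀ j, IsUnit (R j)) (κ : ℂ) :
    IsUnit (perpMono R κ) := by
  have h0 : ∀ {j : Fin (m + 2)}, 0 ≠ j → ∀ X : Op2, IsUnit X → IsUnit (pairOp 0 j X) :=
    fun hj X hX => hX.map (pairHom (A := ℂ) hj)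
  refine ((h0 Fin.last_pos.ne _ (IsUnit.of_mul_eq_one _ permMat_mul_self)).mul
    (isUnit_list_prod _ fun X hX => ?_)).mul ?_
  · rw [List.mem_reverse, List.mem_ofFn] at hX
    obtain ⟨j, rfl⟩ := hX
    exact h0 (Fin.succ_ne_zero _).symm _ (hR j)
  · have hθ : IsUnit (theta κ) := IsUnit.of_mul_eq_one (theta (-κ)) <| by
      rw [theta_mul_theta, add_neg_cancel, theta_zero]
    exact hθ.map (siteAlgHom (n := m + 2) 0)

theorem RMat_self {γ : ℂ} (hη : Complex.sin (Complex.I * γ) ≠ 0) (x : ℂ) :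
    RMat γ x x = permMat := by
  ext ⟨a, s⟩ ⟨b, t⟩
  simp only [RMat, bFun, cFun, permMat, sub_self, zero_add, div_self hη, Complex.sin_zero,
    zero_div]
  fin_cases a <;> fin_cases b <;> fin_cases s <;> fin_cases t <;> simp

/-- The spectral parameter equals the last inhomogeneity, so the leftmost `R`-matrix is the
permutation. -/
theorem monodromyPerp_eq {γ : ℂ} (hη : Complex.sin (Complex.I * γ) ≠ 0) (T : ℝ)
    (ξ : Fin (m + 1) → ℂ) (h : ℝ) :
    monodromyPerp γ T ξ h (ξ (Fin.last m)) =
      perpMono (fun j => RMat γ (ξ (Fin.last m)) (ξ j.castSucc)) ((h / T : ℝ) : ℂ) := by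
  rw [monodromyPerp, List.ofFn_succ', List.concat_eq_append, List.reverse_append,
    List.prod_append, List.reverse_singleton, List.prod_singleton, RMat_self hη]
  rfl

theorem twMono_rtt_RMat {γ x y : ℂ} (hs : Complex.sin (y - x + Complex.I * γ) ≠ 0)
    (ν : Fin M → ℂ) (κ : ℂ) :
    RTT (RMat γ x y) (twMono (Complex.I * γ) ν κ x) (twMono (Complex.I * γ) ν κ y) := by
  have h1 := twMono_rtt (η := Complex.I * γ) ν κ x y
  have h2 : (RMat γ x y).map (algebraMap ℂ (Op M)) = (Complex.sin (y - x + Complex.I * γ))⁻¹ •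
      (entR (Complex.I * γ) (y - x)).map (algebraMap ℂ (Op M)) := by
    rw [RMat_eq_smul_entR γ x y hs]
    refine Matrix.ext fun s t => ?_
    rw [Matrix.map_apply, Matrix.smul_apply, Matrix.smul_apply, Matrix.map_apply, smul_eq_mul,
      map_mul, Algebra.smul_def]
  rw [RTT, h2, Matrix.smul_mul, Matrix.mul_smul, h1]

variable {γ : ℂ} {T : ℝ} {σ : Fin M → ℤˣ} {ν : Fin M → ℂ} {h h' : ℝ}

theorem tendsto_entFF_rqKZ (hη : Complex.sin (Complex.I * γ) ≠ 0) (hσ : ∀ k, σ k = -1)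
    (hM : 0 < M) (hν : ∀ k, Complex.sin (ν ⟨0, hM⟩ - ν k - Complex.I * γ) ≠ 0)
    (SB : Eigenstate γ T σ ν h') (SK : Eigenstate γ T σ ν h) {ξ : Fin (m + 1) → ℂ}
    (hξ0 : ξ (Fin.last m) = ν ⟨0, hM⟩) (hξ : ∀ j, RegularAt γ σ ν (ξ j))
    (hξe : ∀ j, SK.toEnt.eig (ξ j) ≠ 0)
    (hs : ∀ j, j ≠ Fin.last m → Complex.sin (ξ j - ξ (Fin.last m) + Complex.I * γ) ≠ 0 ∧
      Complex.sin (ξ j - ξ (Fin.last m) - Complex.I * γ) ≠ 0) :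
    Tendsto (fun z => entFF SB.toEnt SK.toEnt (Function.update ξ (Fin.last m) z))
      (𝓝 (ξ (Fin.last m) - Complex.I * γ))
      (𝓝 ((SK.toEnt.eig (ξ (Fin.last m)) / SB.toEnt.eig (ξ (Fin.last m))) • traceFirst
        ((monodromyPerp γ T ξ h (ξ (Fin.last m)))⁻¹ * idTensor (entFF SB.toEnt SK.toEnt ξ) *
          siteOp 0 sigmaY * pairOp 0 (Fin.last (m + 1)) (transposeFirst permMat) *
          siteOp 0 sigmaY * monodromyPerp γ T ξ h' (ξ (Fin.last m))))) := by
  have hne : ¬ ((-1 : ℤˣ) = 1) := by decide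
  have hμ : ∀ k, entInhom γ σ ν k = ν k - Complex.I * γ := fun k => by
    rw [entInhom, hσ k, if_neg hne]
  -- With all `σ k = -1` the entire inhomogeneities are `ν k - iγ`. Thus `ξ_m = ν_1` is the crossed
  -- special point and `ξ_m - iγ` is the permutation point.
  have hx : ξ (Fin.last m) = entInhom γ σ ν ⟨0, hM⟩ + Complex.I * γ := by
    rw [hμ, hξ0, sub_add_cancel]
  have hw : ξ (Fin.last m) - Complex.I * γ = entInhom γ σ ν ⟨0, hM⟩ := by
    rw [hμ, hξ0]
  -- Of the two conditions for invertible Lax matrices, one is the regularity of `ξ_m`, the other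
  -- the assumption `hν`.
  have hreg : ∀ k, Complex.sin (Complex.I * γ - (ν k - ν ⟨0, hM⟩)) ≠ 0 := by
    intro k
    have h1 := hξ (Fin.last m) k
    rw [hξ0, hσ k] at h1
    rw [← neg_ne_zero, ← Complex.sin_neg]
    convert h1 using 2
    push_cast
    ring
  have hreg' : ∀ k, Complex.sin (Complex.I * γ + (ν k - ν ⟨0, hM⟩)) ≠ 0 := by
    intro k
    rw [← neg_ne_zero, ← Complex.sin_neg]
    convert hν k using 2
    ring
  have hUK : ∀ k, IsUnit (laxMat (Complex.I * γ) (entInhom γ σ ν k - entInhom γ σ ν ⟨0, hM⟩)) := by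
    intro k
    rw [hμ, hμ, sub_sub_sub_cancel_right]
    exact isUnit_laxMat (hreg' k) (hreg k)
  have hUB : ∀ k, IsUnit (laxMat (Complex.I * γ) (entInhom γ σ ν ⟨0, hM⟩ - entInhom γ σ ν k)) := by
    intro k
    rw [hμ, hμ, sub_sub_sub_cancel_right]
    refine isUnit_laxMat ?_ ?_
    · rw [← neg_sub, ← sub_eq_add_neg]
      exact hreg k
    · convert hreg' k using 2
      ring
  have hK0 := SK.toEnt.eig_special_ne_zero hM hUK
  have hB := SB.toEnt.eig_crossed_special_ne_zero hM hUB
  have hK : SK.toEnt.eig (entInhom γ σ ν ⟨0, hM⟩ + Complex.I * γ) ≠ 0 := by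
    rw [← hx]
    exact hξe _
  have hlast : ∀ j : Fin m, j.castSucc ≠ Fin.last m := fun j => (Fin.castSucc_lt_last j).ne
  have h1 := entFF_rqKZ hM SB.toEnt SK.toEnt hK hB hx
    (R := fun j => RMat γ (ξ (Fin.last m)) (ξ j.castSucc))
    (fun j => by rw [← hx]; exact twMono_rtt_RMat (hs _ (hlast j)).1 _ _)
    (isUnit_perpMono (fun j => isUnit_RMat (hs _ (hlast j)).1 (hs _ (hlast j)).2) _)
  have h2 := continuousAt_entFF_update SB.toEnt SK.toEnt ξ hK0
  rw [entFF_update_special hM SB.toEnt SK.toEnt hK0, ← h1, ← hx, ← hw] at h2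
  rw [monodromyPerp_eq hη, monodromyPerp_eq hη]
  convert h2 using 4
  rw [← pairOp_crossed_permMat Fin.last_pos.ne]
  simp only [mul_assoc]

variable {S0 : Eigenstate γ T σ ν h} {Sn : Eigenstate γ T σ ν h'}

theorem regularAt_update {ξ : Fin m → ℂ} (hξ : ∀ j, RegularAt γ σ ν (ξ j)) (i : Fin m) {z : ℂ}
    (hz : RegularAt γ σ ν z) (j : Fin m) : RegularAt γ σ ν (Function.update ξ i z j) := by
  by_cases hj : j = i
  · rw [hj, Function.update_self]
    exact hz
  · rw [Function.update_of_ne hj]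
    exact hξ j

theorem tendsto_thermalFF_rqKZ (hη : Complex.sin (Complex.I * γ) ≠ 0) (hσ : ∀ k, σ k = -1)
    (hM : 0 < M) (hν : ∀ k, Complex.sin (ν ⟨0, hM⟩ - ν k - Complex.I * γ) ≠ 0) (ε : ℤˣ)
    (ξ : Fin (m + 1) → ℂ) (hξ0 : ξ (Fin.last m) = ν ⟨0, hM⟩) (hξ : Admissible ε S0 Sn ξ)
    (hs : ∀ j, j ≠ Fin.last m → Complex.sin (ξ j - ξ (Fin.last m) + Complex.I * γ) ≠ 0 ∧
      Complex.sin (ξ j - ξ (Fin.last m) - Complex.I * γ) ≠ 0) :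
    Tendsto (fun z : ℂ => thermalFF ε S0 Sn (Function.update ξ (Fin.last m) z))
      (𝓝[≠] (ξ (Fin.last m) - Complex.I * γ))
      (𝓝 ((rho S0 Sn (ξ (Fin.last m))) ^ (-(ε : ℤ)) • traceFirst
        ((monodromyPerp γ T ξ (if ε = 1 then h else h') (ξ (Fin.last m)))⁻¹ *
          idTensor (thermalFF ε S0 Sn ξ) * siteOp 0 sigmaY *
          pairOp 0 (Fin.last (m + 1)) (transposeFirst permMat) * siteOp 0 sigmaY *
          monodromyPerp γ T ξ (if ε = 1 then h' else h) (ξ (Fin.last m))))) := by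
  have hev := eventually_regularAt (γ := γ) (σ := σ) (ν := ν) (ξ (Fin.last m) - Complex.I * γ)
  rcases Int.units_eq_one_or ε with rfl | rfl
  · have h1 := tendsto_entFF_rqKZ hη hσ hM hν Sn S0 hξ0 hξ.regular hξ.eig_ne_zero_of_one hs
    rw [if_pos rfl, if_pos rfl, thermalFF_one hξ.regular, rho_eq (hξ.regular _), Units.val_one,
      zpow_neg_one, inv_div]
    refine (h1.mono_left nhdsWithin_le_nhds).congr' ?_
    filter_upwards [hev] with z hz
    rw [thermalFF_one (regularAt_update hξ.regular _ hz)]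
  · have hne : ¬ ((-1 : ℤˣ) = 1) := by decide
    have h1 := tendsto_entFF_rqKZ hη hσ hM hν S0 Sn hξ0 hξ.regular hξ.eig_ne_zero_of_neg_one hs
    rw [if_neg hne, if_neg hne, thermalFF_neg_one hξ.regular, rho_eq (hξ.regular _),
      Units.val_neg, Units.val_one, neg_neg, zpow_one]
    refine (h1.mono_left nhdsWithin_le_nhds).congr' ?_
    filter_upwards [hev] with z hz
    rw [thermalFF_neg_one (regularAt_update hξ.regular _ hz)]

end RqKZ

end XXZ

end

/-! ### Assembly of the properties -/

theorem mainTheorem2 (γ : ℂ) (hγ : Complex.sinh γ ≠ 0) (T : ℝ) (hT : 0 < T) (h h' : ℝ)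
    {M : ℕ} (hM : Even M) (σ : Fin M → ℤˣ) (ν : Fin M → ℂ)
    (S0 : XXZ.Eigenstate γ T σ ν h) (Sn : XXZ.Eigenstate γ T σ ν h')
    (hov : XXZ.Overlap S0 Sn) :
    -- normalization
    (∀ (ε : ℤˣ) (m : ℕ) (ξ : Fin m → ℂ), XXZ.Admissible ε S0 Sn ξ →
      Matrix.trace (XXZ.thermalFF ε S0 Sn ξ) = 1) ∧
    -- reduction relations
    (∀ (ε : ℤˣ) (m : ℕ) (ξ : Fin (m + 1) → ℂ), XXZ.Admissible ε S0 Sn ξ →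
      XXZ.traceLast (XXZ.thermalFF ε S0 Sn ξ) = XXZ.thermalFF ε S0 Sn (Fin.init ξ) ∧
      XXZ.traceFirst
          (XXZ.siteOp 0 (XXZ.qSigmaZ γ (((ε : ℤ) : ℂ) * XXZ.alpha γ T h h')) *
            XXZ.thermalFF ε S0 Sn ξ) =
        (XXZ.rho S0 Sn (ξ 0)) ^ (ε : ℤ) • XXZ.thermalFF ε S0 Sn (Fin.tail ξ)) ∧
    -- exchange relation
    (∀ (ε : ℤˣ) (m : ℕ) (ξ : Fin m → ℂ) (i j : Fin m), (j : ℕ) = (i : ℕ) + 1 →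
      XXZ.Admissible ε S0 Sn ξ → Complex.sin (ξ j - ξ i + Complex.I * γ) ≠ 0 →
      XXZ.pairOp i j (XXZ.permMat * XXZ.RMat γ (ξ i) (ξ j)) * XXZ.thermalFF ε S0 Sn ξ =
        XXZ.thermalFF ε S0 Sn (ξ ∘ Equiv.swap i j) *
          XXZ.pairOp i j (XXZ.permMat * XXZ.RMat γ (ξ i) (ξ j))) ∧
    -- U(1) symmetry
    (∀ (ε : ℤˣ) (m : ℕ) (ξ : Fin m → ℂ) (κ : ℂ), XXZ.Admissible ε S0 Sn ξ →
      Commute (XXZ.thermalFF ε S0 Sn ξ) (XXZ.tensorPow m (XXZ.theta κ))) ∧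
    -- row reflection (crossing)
    (S0.IsSimple → Sn.IsSimple → ∀ j : Fin M,
      (∃ (S0' : XXZ.Eigenstate γ T (XXZ.flipStag σ j) (XXZ.shiftInhom γ σ ν j) h)
        (Sn' : XXZ.Eigenstate γ T (XXZ.flipStag σ j) (XXZ.shiftInhom γ σ ν j) h'),
        XXZ.CrossedLabel j S0 S0' ∧ XXZ.CrossedLabel j Sn Sn' ∧
          S0'.IsSimple ∧ Sn'.IsSimple ∧ XXZ.Overlap S0' Sn') ∧
      ∀ (S0' : XXZ.Eigenstate γ T (XXZ.flipStag σ j) (XXZ.shiftInhom γ σ ν j) h)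
        (Sn' : XXZ.Eigenstate γ T (XXZ.flipStag σ j) (XXZ.shiftInhom γ σ ν j) h'),
        XXZ.CrossedLabel j S0 S0' → XXZ.CrossedLabel j Sn Sn' →
        ∀ (ε : ℤˣ) (m : ℕ) (ξ : Fin m → ℂ), XXZ.Admissible ε S0 Sn ξ →
          (∀ k, XXZ.RegularAt γ (XXZ.flipStag σ j) (XXZ.shiftInhom γ σ ν j) (ξ k)) →
          XXZ.thermalFF ε S0 Sn ξ = XXZ.thermalFF ε S0' Sn' ξ) ∧
    -- commutativity of rows
    (S0.IsSimple → Sn.IsSimple → ∀ P : Equiv.Perm (Fin M),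
      (∃ (S0' : XXZ.Eigenstate γ T (σ ∘ P) (ν ∘ P) h)
        (Sn' : XXZ.Eigenstate γ T (σ ∘ P) (ν ∘ P) h'),
        XXZ.PermutedLabel P S0 S0' ∧ XXZ.PermutedLabel P Sn Sn' ∧
          S0'.IsSimple ∧ Sn'.IsSimple ∧ XXZ.Overlap S0' Sn') ∧
      ∀ (S0' : XXZ.Eigenstate γ T (σ ∘ P) (ν ∘ P) h)
        (Sn' : XXZ.Eigenstate γ T (σ ∘ P) (ν ∘ P) h'),
        XXZ.PermutedLabel P S0 S0' → XXZ.PermutedLabel P Sn Sn' →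
        ∀ (ε : ℤˣ) (m : ℕ) (ξ : Fin m → ℂ), XXZ.Admissible ε S0 Sn ξ →
          XXZ.thermalFF ε S0 Sn ξ = XXZ.thermalFF ε S0' Sn' ξ) ∧
    -- transposition property
    (S0.IsSimple → Sn.IsSimple → ∀ (m : ℕ) (ξ : Fin m → ℂ),
      XXZ.Admissible 1 S0 Sn ξ → XXZ.Admissible (-1) S0 Sn ξ →
      ∀ a b : XXZ.Spins m,
        XXZ.thermalFF (-1) S0 Sn ξ a b =
          (∏ j, (XXZ.rho S0 Sn (ξ j))⁻¹) *
            (XXZ.tensorPow m (XXZ.qSigmaZ γ (XXZ.alpha γ T h h')) *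
              XXZ.thermalFF 1 S0 Sn (ξ ∘ Fin.rev)) (b ∘ Fin.rev) (a ∘ Fin.rev)) ∧
    -- meromorphy, jointly and in each variable
    (∀ (ε : ℤˣ) (m : ℕ) (a b : XXZ.Spins m),
      XXZ.IsMeromorphic (fun ξ : Fin m → ℂ => XXZ.thermalFF ε S0 Sn ξ a b) ∧
      ∀ (ξ : Fin m → ℂ) (j : Fin m),
        MeromorphicOn (fun z : ℂ => XXZ.thermalFF ε S0 Sn (Function.update ξ j z) a b)
          Set.univ) ∧
    -- asymptotic behaviour
    (∀ (m : ℕ) (ξ : Fin m → ℂ) (F : Filter ℝ), F = atTop ∨ F = atBot →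
      (XXZ.Admissible 1 S0 Sn ξ →
        Tendsto (fun z : ℂ => XXZ.thermalFF 1 S0 Sn (Fin.snoc ξ z : Fin (m + 1) → ℂ))
          (comap Complex.im F)
          (𝓝 (XXZ.tensorLast (XXZ.thermalFF 1 S0 Sn ξ)
            ((Matrix.trace (XXZ.theta ((h / T : ℝ) : ℂ)))⁻¹ • XXZ.theta ((h / T : ℝ) : ℂ))))) ∧
      (XXZ.Admissible (-1) S0 Sn ξ →
        Tendsto (fun z : ℂ => XXZ.thermalFF (-1) S0 Sn (Fin.snoc ξ z : Fin (m + 1) → ℂ))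
          (comap Complex.im F)
          (𝓝 (XXZ.tensorLast (XXZ.thermalFF (-1) S0 Sn ξ)
            ((Matrix.trace (XXZ.theta ((h' / T : ℝ) : ℂ)))⁻¹ •
              XXZ.theta ((h' / T : ℝ) : ℂ)))))) ∧
    -- discrete reduced q-Knizhnik-Zamolodchikov equation; the left-hand side, the value of
    -- the meromorphic function `F^{(ε)}` at `ξ_m - iγ`, is a limit because the monodromy matrix
    -- and the eigenvalue both have a pole there
    ((∀ k, σ k = -1) → ∀ (hM0 : 0 < M),
      (∀ k, Complex.sin (ν ⟨0, hM0⟩ - ν k - Complex.I * γ) ≠ 0) →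
      ∀ (ε : ℤˣ) (m : ℕ) (ξ : Fin (m + 1) → ℂ), ξ (Fin.last m) = ν ⟨0, hM0⟩ →
        XXZ.Admissible ε S0 Sn ξ →
        (∀ j, j ≠ Fin.last m →
          Complex.sin (ξ j - ξ (Fin.last m) + Complex.I * γ) ≠ 0 ∧
          Complex.sin (ξ j - ξ (Fin.last m) - Complex.I * γ) ≠ 0) →
        Tendsto
          (fun z : ℂ => XXZ.thermalFF ε S0 Sn (Function.update ξ (Fin.last m) z))
          (𝓝[≠] (ξ (Fin.last m) - Complex.I * γ))
          (𝓝 ((XXZ.rho S0 Sn (ξ (Fin.last m))) ^ (-(ε : ℤ)) •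
            XXZ.traceFirst
              ((XXZ.monodromyPerp γ T ξ (if ε = 1 then h else h') (ξ (Fin.last m)))⁻¹ *
                XXZ.idTensor (XXZ.thermalFF ε S0 Sn ξ) *
                XXZ.siteOp 0 XXZ.sigmaY *
                XXZ.pairOp 0 (Fin.last (m + 1)) (XXZ.transposeFirst XXZ.permMat) *
                XXZ.siteOp 0 XXZ.sigmaY *
                XXZ.monodromyPerp γ T ξ (if ε = 1 then h' else h) (ξ (Fin.last m)))))) := by
  have hη : Complex.sin (Complex.I * γ) ≠ 0 := by
    rw [mul_comm, Complex.sin_mul_I]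
    exact mul_ne_zero hγ Complex.I_ne_zero
  have hγ0 : γ ≠ 0 := by
    rintro rfl
    exact hγ Complex.sinh_zero
  refine ⟨fun ε m ξ => XXZ.trace_thermalFF hov ε ξ, fun ε m ξ hξ =>
    ⟨XXZ.traceLast_thermalFF ε ξ hξ, XXZ.traceFirst_thermalFF hγ0 hT.ne' ε ξ hξ⟩,
    fun ε m ξ i j hij hξ hs => XXZ.thermalFF_exchange ε ξ hij hξ hs,
    fun ε m ξ κ hξ => XXZ.thermalFF_commute_tensorPow ε ξ κ hξ, fun h0 hn j => ⟨?_, ?_⟩,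
    fun h0 hn P => ⟨?_, ?_⟩, fun h0 hn m ξ hξ _ a b =>
      XXZ.thermalFF_transpose hη hγ0 hT.ne' hov h0 hn ξ hξ a b,
    fun ε m a b => ⟨XXZ.thermalFF_isMeromorphic hov ε a b, fun ξ j =>
      XXZ.thermalFF_meromorphicOn ε ξ j a b⟩,
    fun m ξ F hF => ⟨XXZ.tendsto_thermalFF_one_snoc hF ξ,
      XXZ.tendsto_thermalFF_neg_one_snoc hF ξ⟩,
    fun hσ hM0 hν ε m ξ hξ0 hξ hs => XXZ.tendsto_thermalFF_rqKZ hη hσ hM0 hν ε ξ hξ0 hξ hs⟩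
  · obtain ⟨S0', s0, e0, v0⟩ := h0.exists_related hη (XXZ.entInhom_crossed j)
    obtain ⟨Sn', sn, en, vn⟩ := hn.exists_related hη (XXZ.entInhom_crossed j)
    exact ⟨S0', Sn', XXZ.crossedLabel_of_eigenvalue_eq v0, XXZ.crossedLabel_of_eigenvalue_eq vn,
      s0, sn, XXZ.overlap_of_related hη (XXZ.entInhom_crossed j) hov h0 hn e0 en⟩
  · intro S0' Sn' c0 cn ε m ξ hξ hξ'
    exact XXZ.thermalFF_related hη (XXZ.entInhom_crossed j) hov h0 hn c0.toEnt_eig cn.toEnt_eig ε ξ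
      hξ.regular hξ'
  · obtain ⟨S0', s0, e0, v0⟩ := h0.exists_related hη (XXZ.entInhom_permuted P)
    obtain ⟨Sn', sn, en, vn⟩ := hn.exists_related hη (XXZ.entInhom_permuted P)
    exact ⟨S0', Sn', XXZ.permutedLabel_of_eigenvalue_eq v0,
      XXZ.permutedLabel_of_eigenvalue_eq vn, s0, sn,
      XXZ.overlap_of_related hη (XXZ.entInhom_permuted P) hov h0 hn e0 en⟩
  · intro S0' Sn' c0 cn ε m ξ hξ
    exact XXZ.thermalFF_related hη (XXZ.entInhom_permuted P) hov h0 hn c0.toEnt_eig cn.toEnt_eig ε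
      ξ hξ.regular fun k => XXZ.regularAt_permuted (hξ.regular k)
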